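/- Write $\mathbb{R}_+=[0,\infty)$. A graphex is a measurable symmetric function $W:\mathbb{R}_+^2\to[0,1]$ whose marginal $\mu_W(x)=\int_{\mathbb{R}_+}W(x,y)\,dy$ is a.e. finite, with $\{\mu_W>1\}$ of finite Lebesgue measure, $\int\!\!\int_{\{\mu_W(x)\le 1,\ \mu_W(y)\le 1\}}W(x,y)\,dx\,dy<\infty$ and $\int_{\mathbb{R}_+}W(x,x)\,dx<\infty$. Let $\Pi=\{(\theta_i,\vartheta_i)\}_{i\in\mathbb{N}}$ be a unit-rate Poisson process on $\mathbb{R}_+^2$ and, independently of it, let $\zeta_{\{i,j\}}$ (with $i=j$ allowed) be i.i.d. uniform on $[0,1]$. For $\nu\ge 0$ the graph $G_\nu$ has an edge between $\theta_i$ and $\theta_j$ (a self edge if $i=j$) whenever $\theta_i,\theta_j\le\nu$ and $W(\vartheta_i,\vartheta_j)>\zeta_{\{i,j\}}$; its vertices are the labels that belong to at least one of these edges. Let $D_\nu$ be the degree in $G_\nu$ (self edges counted twice) of a vertex chosen uniformly at random from the vertices of $G_\nu$; thus $\mathrm{P}(D_\nu>k\mid G_\nu)$ is the proportion of the vertices of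 $G_\nu$ whose degree exceeds $k$ (set to $0$, say, if $G_\nu$ has no vertex). **Theorem.** Let $W$ be a graphex that is integrable on $\mathbb{R}_+^2$ and such that 1. there are constants $C,T>0$ such that $\int_{\mathbb{R}_+}W(\lambda,x)W(\omega,x)\,dx\le C\mu_W(\lambda)\mu_W(\omega)$ for all $\lambda\ge0$ and all $\omega>T$; 2. $\mu_W$ is monotonically decreasing (not necessarily strictly) on $\mathbb{R}_+$; 3. $\mu_W$ is differentiable on $(0,\infty)$; 4. there is $\chi>0$ such that for all $x>\chi$ one has $\mu_W'(x)\neq0$ and $\dfrac{\mu_W(x)}{x\,\mu_W'(x)}\ge-1$. Let $\nu\mapsto k_\nu\in[0,\infty)$ satisfy $k_\nu=o(\nu)$ as $\nu\to\infty$, and put $$R_\nu=\frac{\sum_{n\in\mathbb{N},\,n>k_\nu}\int_{\mathbb{R}_+}\frac{1}{n!}e^{-\nu\mu_W(x)}(\nu\mu_W(x))^n\,dx}{\int_{\mathbb{R}_+}\bigl(1-e^{-\nu\mu_W(x)}\bigr)\,dx}.$$ Then $\mathrm{P}(D_\nu>k_\nu\mid G_\nu)-R_\nu\to0$ in probability as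 $\nu\to\infty$. In particular, whenever $\lim_{\nu\to\infty}R_\nu$ exists, $$\mathrm{P}(D_\nu>k_\nu\mid G_\nu)\xrightarrow{\,p\,}\lim_{\nu\to\infty}R_\nu .$$ -/

import Mathlib

open MeasureTheory ProbabilityTheory Filter Set Topology Asymptotics
open scoped ENNReal

noncomputable section

/-- The graphex marginal `μ_W(x) = ∫_{ℝ₊} W(x,y) dy`, as an extended nonnegative number. -/
def eMarginal (W : ℝ → ℝ → ℝ) (x : ℝ) : ℝ≥0∞ :=
  ∫⁻ y in Ici (0 : ℝ), ENNReal.ofReal (W x y)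

/-- The graphex marginal `μ_W(x) = ∫_{ℝ₊} W(x,y) dy`, as a real number. -/
def marginal (W : ℝ → ℝ → ℝ) (x : ℝ) : ℝ :=
  ∫ y in Ici (0 : ℝ), W x y

/-- `W` (that is, the triple `(0, 0, W)`) is a graphex: a symmetric measurable function
`ℝ₊² → [0,1]` satisfying the local finiteness conditions. Only the values of `W` on
the quadrant `ℝ₊² = [0,∞)²` matter. -/
structure IsGraphex (W : ℝ → ℝ → ℝ) : Prop where
  measurable : Measurable (Function.uncurry W)
  mem_Icc : ∀ x ≥ 0, ∀ y ≥ 0, W x y ∈ Icc (0 : ℝ) 1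
  symm : ∀ x ≥ 0, ∀ y ≥ 0, W x y = W y x
  marginal_finite : volume {x : ℝ | 0 ≤ x ∧ eMarginal W x = ∞} = 0
  marginal_large : volume {x : ℝ | 0 ≤ x ∧ 1 < eMarginal W x} < ∞
  small_part : ∫⁻ z in {z : ℝ × ℝ | 0 ≤ z.1 ∧ 0 ≤ z.2 ∧ eMarginal W z.1 ≤ 1 ∧
    eMarginal W z.2 ≤ 1}, ENNReal.ofReal (W z.1 z.2) < ∞
  diagonal : ∫⁻ x in Ici (0 : ℝ), ENNReal.ofReal (W x x) < ∞

/-- The graphex `W` is integrable on `ℝ₊²`. -/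
def IntegrableGraphex (W : ℝ → ℝ → ℝ) : Prop :=
  IntegrableOn (Function.uncurry W) (Ici (0 : ℝ) ×ˢ Ici (0 : ℝ))

variable {Ω : Type*} [MeasurableSpace Ω]

/-- The number of points of the random sequence `p` that fall in `B`. -/
def pointCount (p : ℕ → Ω → ℝ × ℝ) (B : Set (ℝ × ℝ)) (ω : Ω) : ℕ∞ :=
  {i : ℕ | p i ω ∈ B}.encard

/-- The random points `p 0, p 1, …` enumerate a unit rate Poisson process on `ℝ₊²`:
the number of points in a measurable `B ⊆ ℝ₊²` of finite area is Poisson distributed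
with mean the area of `B`, and the counts of disjoint sets are independent. -/
structure IsUnitRatePoissonProcess (P : Measure Ω) (p : ℕ → Ω → ℝ × ℝ) : Prop where
  measurable : ∀ i, Measurable (p i)
  mem_quadrant : ∀ i ω, p i ω ∈ Ici (0 : ℝ) ×ˢ Ici (0 : ℝ)
  count_law : ∀ B : Set (ℝ × ℝ), MeasurableSet B → B ⊆ Ici (0 : ℝ) ×ˢ Ici (0 : ℝ) →
    volume B < ∞ → ∀ n : ℕ,
      P {ω | pointCount p B ω = n} = poissonMeasure (volume B).toNNReal {n}
  count_indep : ∀ (m : ℕ) (B : Fin m → Set (ℝ × ℝ)), (∀ a, MeasurableSet (B a)) →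
    (∀ a, B a ⊆ Ici (0 : ℝ) ×ˢ Ici (0 : ℝ)) → (∀ a, volume (B a) < ∞) →
    (∀ a b, a ≠ b → Disjoint (B a) (B b)) →
      iIndepFun (fun a => pointCount p (B a)) P

/-- The randomness from which a Kallenberg exchangeable graph is generated: a latent unit rate
Poisson process `Π = {(θ_i, ϑ_i)}` on `ℝ₊²` (`p i = (θ_i, ϑ_i)`) and, independently of it,
independent uniform `[0,1]` variables `ζ_{i,j}` indexed by unordered pairs (with `i = j` allowed). -/
structure IsKEGSource (P : Measure Ω) (p : ℕ → Ω → ℝ × ℝ) (ζ : Sym2 ℕ → Ω → ℝ) : Prop where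
  poisson : IsUnitRatePoissonProcess P p
  measurable : ∀ e, Measurable (ζ e)
  uniform : ∀ e, P.map (ζ e) = volume.restrict (Icc (0 : ℝ) 1)
  indep : iIndepFun ζ P
  indep_points : IndepFun (fun ω i => p i ω) (fun ω e => ζ e ω) P

/-- The edge set of the graph `G_ν`, as a symmetric set of pairs of labels in `[0,ν]²`: the points
`(θ_i, ϑ_i)` and `(θ_j, ϑ_j)` of `Π` are joined when `W(ϑ_i, ϑ_j) > ζ_{i,j}`. -/
def kegEdges (W : ℝ → ℝ → ℝ) (p : ℕ → Ω → ℝ × ℝ) (ζ : Sym2 ℕ → Ω → ℝ) (ν : ℝ) (ω : Ω) :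
    Set (ℝ × ℝ) :=
  {e | (∃ i j : ℕ, e = ((p i ω).1, (p j ω).1) ∧ ζ s(i, j) ω < W (p i ω).2 (p j ω).2) ∧
    e ∈ Icc 0 ν ×ˢ Icc 0 ν}

/-- The vertex set of `G_ν`: the labels that participate in at least one edge of `G_ν`. -/
def kegVertices (W : ℝ → ℝ → ℝ) (p : ℕ → Ω → ℝ × ℝ) (ζ : Sym2 ℕ → Ω → ℝ) (ν : ℝ) (ω : Ω) :
    Set ℝ :=
  {x | ∃ y, (x, y) ∈ kegEdges W p ζ ν ω}

open Classical in
/-- The degree in `G_ν` of the vertex with label `x`; a self edge counts twice. (The graph `G_ν`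
of a graphex has almost surely finitely many edges.) -/
def kegDegree (W : ℝ → ℝ → ℝ) (p : ℕ → Ω → ℝ × ℝ) (ζ : Sym2 ℕ → Ω → ℝ) (ν : ℝ) (ω : Ω)
    (x : ℝ) : ℕ :=
  {y | y ≠ x ∧ (x, y) ∈ kegEdges W p ζ ν ω}.ncard +
    if (x, x) ∈ kegEdges W p ζ ν ω then 2 else 0

/-- `P(D_ν > k | G_ν)`, for `D_ν` the degree of a vertex chosen uniformly at random from the
vertices of `G_ν`. It is a random variable, being a function of `G_ν`. -/
def kegDegreeTail (W : ℝ → ℝ → ℝ) (p : ℕ → Ω → ℝ × ℝ) (ζ : Sym2 ℕ → Ω → ℝ) (ν k : ℝ) (ω : Ω) :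
    ℝ :=
  (uniformOn (kegVertices W p ζ ν ω) {x | k < (kegDegree W p ζ ν ω x : ℝ)}).toReal

/-- The deterministic ratio
`(∑_{n > k} ∫ e^{-νμ_W(x)} (νμ_W(x))^n / n! dx) / ∫ (1 - e^{-νμ_W(x)}) dx`. -/
def poissonTailRatio (W : ℝ → ℝ → ℝ) (ν k : ℝ) : ℝ :=
  (∑' n : {n : ℕ // k < (n : ℝ)}, ∫ x in Ici (0 : ℝ),
      Real.exp (-(ν * marginal W x)) * (ν * marginal W x) ^ (n : ℕ) / (n : ℕ).factorial) /
    ∫ x in Ici (0 : ℝ), (1 - Real.exp (-(ν * marginal W x)))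

end

open MeasureTheory ProbabilityTheory Filter Set Topology Asymptotics
open scoped ENNReal

noncomputable section

set_option linter.unusedSectionVars false

/-! Write μ for the marginal and B = ∫ (1 - e^{-νμ}) dx. Seen from a point (θ, x) of Π, the degree
in G_ν is, apart from a self edge, Poisson with mean νμ(x). Hence the number of vertices of degree
above K should be close to ν ∫ P(Poisson(νμ(x)) > K) dx, and the number of all vertices, which is
the case K = 0, close to νB. The quotient of these two predictions is R_ν. It therefore suffices
that both counts deviate from their predictions by o(νB) in probability. Note that B tends to
infinity, because μ is positive everywhere.

The indicator of D > K is not directly tractable, but generating functions are. Given the points,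
τ^{D_i} has a product mean, and the Mecke formulas (`mecke_one`, `mecke_two`, derived from the
Janossy measures in `janossy_eq`) turn product functionals into exponentials. This gives exact first
and second moments for the discounted sums Σ 1_S(x_i)(1 - s^{D_i}) with 0 ≤ s ≤ 1. Their variance
has three parts: the diagonal, at most νB; the direct edges, at most 2ν²∫∫W; and the correlation of
two points through common neighbours. By the overlap hypothesis the last part is at most ν²(T² +
O(B²/ν)). So the variance is o((νB)²), uniformly in S and s (`variance_boxSum_discount_le`,
`eventually_boxSum_discount_concentrated`).

It remains to pass from discounts to the indicator of n > K. For a fixed K, the Weierstrass theorem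
approximates it by polynomials in 2^{-n}, with an error proportional to 1 - 2^{-n}
(`exists_polynomial_above`). For large K, the points are sorted by νμ(x). Above tK nearly all
degrees exceed K, so that 1 - 2^{-n} serves as the indicator; below K/t exceeding K is exponentially
unlikely. The hypotheses on μ make xμ(x) decreasing beyond χ, so the range between K/t and tK has
length at most χ + 9(t-1)B (`IsRegularKernel.volume_midSet_le`), which is negligible against B once
t is close to 1. The large levels start at some K₀(ε) and only finitely many lie below it, so
concentration is uniform in K (`eventually_deviationEvent_le`), and the level may move with ν.

Infinitely many points of Π have a label at most ν, so all counts are made in a box [0,ν] × [0,M].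
The bounds are uniform in M as long as 2^K ν ∫_{x>M} μ ≤ 1, and M is chosen last, so large that with
high probability no edge leaves the box. Loops are O(ν) in mean, hence negligible against νB. -/

variable {Ω : Type*} [MeasurableSpace Ω]

/-! ### Enumerations of coloured points -/

section

/-- The event that the points of `p` lying in `Q` are exactly those with index in `s`. -/
def indexEvent (p : ℕ → Ω → ℝ × ℝ) (Q : Set (ℝ × ℝ)) (s : Set ℕ) : Set Ω :=
  {ω | ∀ i, p i ω ∈ Q ↔ i ∈ s}

lemma measurableSet_indexEvent {p : ℕ → Ω → ℝ × ℝ} (hp : ∀ i, Measurable (p i))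
    {Q : Set (ℝ × ℝ)} (hQ : MeasurableSet Q) (s : Set ℕ) :
    MeasurableSet (indexEvent p Q s) := by
  have : indexEvent p Q s = ⋂ i, {ω | p i ω ∈ Q ↔ i ∈ s} := by
    ext ω; simp [indexEvent]
  rw [this]
  refine MeasurableSet.iInter fun i => ?_
  by_cases h : i ∈ s
  · convert hp i hQ using 1
    ext ω; simp [h]
  · convert (hp i hQ).compl using 1
    ext ω; simp [h]

/-- The number of injective enumerations of the points in `Q` with prescribed colours. -/
lemma tsum_indicator_enumerations {V : Type*} [Fintype V] [DecidableEq V]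
    (x : ℕ → ℝ × ℝ) (Q : Set (ℝ × ℝ)) (c : ℝ × ℝ → V) {n : ℕ} (τ : Fin n → V) :
    (∑' σ : Fin n ↪ ℕ, {σ : Fin n ↪ ℕ | (∀ i, x i ∈ Q ↔ i ∈ range σ) ∧
        ∀ a, c (x (σ a)) = τ a}.indicator (1 : (Fin n ↪ ℕ) → ℝ≥0∞) σ) =
      {y : ℕ → ℝ × ℝ | ∀ v, {i | y i ∈ Q ∩ c ⁻¹' {v}}.encard =
        (Fintype.card {a // τ a = v} : ℕ∞)}.indicator
        (fun _ => ∏ v, ((Fintype.card {a // τ a = v}).factorial : ℝ≥0∞)) x := by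
  classical
  set S := {σ : Fin n ↪ ℕ | (∀ i, x i ∈ Q ↔ i ∈ range σ) ∧ ∀ a, c (x (σ a)) = τ a} with hS
  have hne : S.Nonempty ↔ ∀ v, {i | x i ∈ Q ∩ c ⁻¹' {v}}.encard =
      (Fintype.card {a // τ a = v} : ℕ∞) := by
    constructor
    · rintro ⟨σ, h1, h2⟩ v
      have : {i | x i ∈ Q ∩ c ⁻¹' {v}} = σ '' {a | τ a = v} := by
        ext i
        simp only [mem_ofPred_eq, mem_inter_iff, mem_preimage, mem_singleton_iff, mem_image]
        constructor
        · rintro ⟨hq, hc⟩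
          obtain ⟨a, rfl⟩ := (h1 i).1 hq
          exact ⟨a, by rw [← h2 a, hc], rfl⟩
        · rintro ⟨a, ha, rfl⟩
          exact ⟨(h1 _).2 ⟨a, rfl⟩, by rw [h2 a, ha]⟩
      rw [this, σ.injective.encard_image]
      simp [Set.encard, ENat.card_eq_coe_fintype_card, Fintype.card_subtype]
    · intro h
      -- An enumeration is glued from bijections, one for each colour, between the positions and the
      -- points of that colour.
      have e : ∀ v, Nonempty ({a // τ a = v} ≃ {i | x i ∈ Q ∩ c ⁻¹' {v}}) := by
        intro v
        have hfin : {i | x i ∈ Q ∩ c ⁻¹' {v}}.Finite :=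
          Set.finite_of_encard_eq_coe (h v)
        have := hfin.fintype
        refine ⟨Fintype.equivOfCardEq ?_⟩
        have := h v
        rw [Set.encard, ENat.card_eq_coe_fintype_card] at this
        exact_mod_cast this.symm
      let E := fun v => (e v).some
      have hE : ∀ a, x (E (τ a) ⟨a, rfl⟩).1 ∈ Q ∩ c ⁻¹' {τ a} := fun a =>
        (E (τ a) ⟨a, rfl⟩).2
      refine ⟨⟨fun a => (E (τ a) ⟨a, rfl⟩).1, ?_⟩, ?_, ?_⟩
      · intro a b hab
        have hc : τ a = τ b := by
          rw [← show c _ = _ from (hE a).2, ← show c _ = _ from (hE b).2]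
          exact congrArg (fun i => c (x i)) hab
        -- The colours of `a` and `b` agree only propositionally; a free `v` puts both positions
        -- into the same fibre.
        have key : ∀ v (ha : τ a = v) (hb : τ b = v),
            ((E v ⟨a, ha⟩).1 = (E v ⟨b, hb⟩).1) → a = b := by
          intro v ha hb h
          have := (E v).injective (Subtype.ext h)
          exact congrArg Subtype.val this
        refine key (τ b) hc rfl ?_
        have h3 : ∀ v (ha : τ a = v), (E (τ a) ⟨a, rfl⟩).1 = (E v ⟨a, ha⟩).1 := by
          rintro v rfl; rfl
        rw [← h3 (τ b) hc]; exact hab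
      · intro i
        constructor
        · intro hq
          have hi : i ∈ {i | x i ∈ Q ∩ c ⁻¹' {c (x i)}} := ⟨hq, rfl⟩
          obtain ⟨⟨a, ha⟩, hea⟩ := (E (c (x i))).surjective ⟨i, hi⟩
          refine ⟨a, ?_⟩
          have h3 : ∀ v (ha : τ a = v), (E (τ a) ⟨a, rfl⟩).1 = (E v ⟨a, ha⟩).1 := by
            rintro v rfl; rfl
          change (E (τ a) ⟨a, rfl⟩).1 = i
          rw [h3 _ ha, hea]
        · rintro ⟨a, rfl⟩
          exact (hE a).1
      · intro a
        exact (hE a).2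
  have h1 : (∑' σ : Fin n ↪ ℕ, S.indicator (1 : (Fin n ↪ ℕ) → ℝ≥0∞) σ) =
      ∑' _ : S, (1 : ℝ≥0∞) := (tsum_subtype S (1 : (Fin n ↪ ℕ) → ℝ≥0∞)).symm
  rw [h1]
  by_cases hSn : S.Nonempty
  · rw [Set.indicator_of_mem (show x ∈ {y : ℕ → ℝ × ℝ | ∀ v, {i | y i ∈ Q ∩ c ⁻¹' {v}}.encard =
        (Fintype.card {a // τ a = v} : ℕ∞)} from hne.1 hSn)]
    obtain ⟨σ₀, h₁, h₂⟩ := hSn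
    -- All other enumerations arise from `σ₀` by permuting positions without changing colours, so
    -- they are counted by the stabilizer of `τ`, a product of factorials.
    have hτ : ∀ g : {g : Equiv.Perm (Fin n) // τ ∘ g = τ}, (g.1.toEmbedding.trans σ₀) ∈ S := by
      rintro ⟨g, hg⟩
      refine ⟨fun i => ?_, fun a => ?_⟩
      · rw [h₁ i]
        constructor
        · rintro ⟨a, rfl⟩; exact ⟨g.symm a, by simp⟩
        · rintro ⟨a, rfl⟩; exact ⟨g a, rfl⟩
      · simpa [h₂] using congrFun hg a
    let Φ : {g : Equiv.Perm (Fin n) // τ ∘ g = τ} → S := fun g => ⟨_, hτ g⟩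
    have hΦ : Function.Bijective Φ := by
      constructor
      · intro g g' h
        apply Subtype.ext
        ext a
        have := congrArg (fun s : S => s.1 a) h
        have := σ₀.injective (show σ₀ (g.1 a) = σ₀ (g'.1 a) from this)
        exact congrArg _ this
      · rintro ⟨σ, hs1, hs2⟩
        have hr : ∀ a, σ a ∈ range σ₀ := fun a => (h₁ _).1 ((hs1 _).2 ⟨a, rfl⟩)
        choose f hf using hr
        have hfi : Function.Injective f := by
          intro a b hab
          apply σ.injective
          rw [← hf a, ← hf b, hab]
        let g : Equiv.Perm (Fin n) := Equiv.ofBijective f (Finite.injective_iff_bijective.1 hfi)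
        refine ⟨⟨g, ?_⟩, ?_⟩
        · funext a
          change τ (f a) = τ a
          rw [← h₂, hf, hs2]
        · apply Subtype.ext
          ext a
          exact hf a
    rw [← (Equiv.ofBijective Φ hΦ).tsum_eq, tsum_fintype, Finset.sum_const, Finset.card_univ,
      DomMulAct.stabilizer_card]
    simp
  · rw [Set.indicator_of_notMem (show x ∉ {y : ℕ → ℝ × ℝ | ∀ v, {i | y i ∈ Q ∩ c ⁻¹' {v}}.encard =
        (Fintype.card {a // τ a = v} : ℕ∞)} from fun h => hSn (hne.2 h))]
    rw [Set.not_nonempty_iff_eq_empty] at hSn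
    rw [hSn]
    simp

end

/-! ### Janossy measures of the Poisson process -/

section

instance countable_finEmbedding (n : ℕ) : Countable (Fin n ↪ ℕ) :=
  (DFunLike.coe_injective (F := Fin n ↪ ℕ)).countable

lemma prod_comp_eq_prod_pow {V : Type*} [Fintype V] [DecidableEq V] {n : ℕ} (τ : Fin n → V)
    (f : V → ℝ≥0∞) : ∏ a, f (τ a) = ∏ v, f v ^ Fintype.card {a // τ a = v} := by
  rw [← Finset.prod_fiberwise_of_maps_to (g := τ) (t := Finset.univ) (fun _ _ => Finset.mem_univ _)]
  refine Finset.prod_congr rfl fun v _ => ?_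
  rw [Fintype.card_subtype, Finset.prod_congr rfl (g := fun _ => f v)]
  · rw [Finset.prod_const]
  · intro a ha
    rw [(Finset.mem_filter.1 ha).2]

/-- The colour classes of `Q` are disjoint, so their counts are independent Poisson variables, and
the exponential factors multiply to that of the whole of `Q`. The factorials stay on the left so
that they cancel against the number of enumerations. -/
lemma measure_pointCount_eq {P : Measure Ω} {p : ℕ → Ω → ℝ × ℝ}
    (hP : IsUnitRatePoissonProcess P p) {Q : Set (ℝ × ℝ)} (hQm : MeasurableSet Q)
    (hQ : Q ⊆ Ici (0 : ℝ) ×ˢ Ici (0 : ℝ)) (hQf : volume Q < ∞)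
    {V : Type*} [Fintype V] {c : ℝ × ℝ → V} (hc : ∀ v, MeasurableSet (c ⁻¹' {v})) (m : V → ℕ) :
    P {ω | ∀ v, pointCount p (Q ∩ c ⁻¹' {v}) ω = m v} * ∏ v, ((m v).factorial : ℝ≥0∞) =
      ENNReal.ofReal (Real.exp (-(volume Q).toReal)) * ∏ v, volume (Q ∩ c ⁻¹' {v}) ^ m v := by
  classical
  let e := Fintype.equivFin V
  have hfin : ∀ v, volume (Q ∩ c ⁻¹' {v}) < ∞ := fun v =>
    (measure_mono inter_subset_left).trans_lt hQf
  have hind := hP.count_indep (Fintype.card V) (fun a => Q ∩ c ⁻¹' {e.symm a})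
    (fun a => hQm.inter (hc _)) (fun a => inter_subset_left.trans hQ) (fun a => hfin _)
    (fun a b hab => by
      refine Set.disjoint_left.2 fun x hx hx' => hab ?_
      have h1 : c x = e.symm a := hx.2
      have h2 : c x = e.symm b := hx'.2
      exact e.symm.injective (h1.symm.trans h2))
  have hprod := hind.measure_inter_preimage_eq_mul Finset.univ
    (sets := fun a => {(m (e.symm a) : ℕ∞)}) (fun _ _ => trivial)
  have hset : {ω | ∀ v, pointCount p (Q ∩ c ⁻¹' {v}) ω = m v} =
      ⋂ a ∈ (Finset.univ : Finset (Fin (Fintype.card V))),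
        pointCount p (Q ∩ c ⁻¹' {e.symm a}) ⁻¹' {(m (e.symm a) : ℕ∞)} := by
    ext ω
    simp only [mem_ofPred_eq, Finset.mem_univ, iInter_true, mem_iInter, mem_preimage,
      mem_singleton_iff]
    exact ⟨fun h a => h _, fun h v => by simpa using h (e v)⟩
  rw [hset, hprod]
  have h1 : ∀ a, P (pointCount p (Q ∩ c ⁻¹' {e.symm a}) ⁻¹' {(m (e.symm a) : ℕ∞)}) =
      poissonMeasure (volume (Q ∩ c ⁻¹' {e.symm a})).toNNReal {m (e.symm a)} := fun a =>
    hP.count_law _ (hQm.inter (hc _)) (inter_subset_left.trans hQ) (hfin _) _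
  simp_rw [h1]
  rw [Equiv.prod_comp e.symm (fun v => poissonMeasure (volume (Q ∩ c ⁻¹' {v})).toNNReal {m v}),
    ← Finset.prod_mul_distrib]
  have hsum : (volume Q).toReal = ∑ v, (volume (Q ∩ c ⁻¹' {v})).toReal := by
    rw [← ENNReal.toReal_sum (fun v _ => (hfin v).ne)]
    have := sum_measure_preimage_singleton (μ := volume.restrict Q) Finset.univ
      (f := c) (fun y _ => hc y)
    simp only [Finset.coe_univ, preimage_univ, Measure.restrict_apply_univ] at this
    rw [← this]
    congr 1
    refine Finset.sum_congr rfl fun v _ => ?_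
    rw [Measure.restrict_apply (hc v), inter_comm]
  rw [hsum, ← Finset.sum_neg_distrib, Real.exp_sum,
    ENNReal.ofReal_prod_of_nonneg (fun _ _ => (Real.exp_pos _).le), ← Finset.prod_mul_distrib]
  refine Finset.prod_congr rfl fun v _ => ?_
  rw [poissonMeasure_singleton]
  set r := volume (Q ∩ c ⁻¹' {v}) with hr
  have hr' : ((r.toNNReal : NNReal) : ℝ) = r.toReal := rfl
  have hf : ((m v).factorial : ℝ≥0∞) = ENNReal.ofReal ((m v).factorial : ℝ) := by simp
  rw [hr', hf, ← ENNReal.ofReal_mul (by positivity), div_mul_cancel₀ _ (by positivity),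
    ENNReal.ofReal_mul (by positivity), ENNReal.ofReal_pow (by positivity),
    ENNReal.ofReal_toReal (hfin v).ne]

/-- By Tonelli the sum is the mean number of enumerations with colours `τ`. That number is a
constant product of factorials when the colour counts are right and zero otherwise, and
`measure_pointCount_eq` absorbs the factorials. -/
lemma tsum_measure_enumerations {P : Measure Ω} {p : ℕ → Ω → ℝ × ℝ}
    (hP : IsUnitRatePoissonProcess P p) {Q : Set (ℝ × ℝ)} (hQm : MeasurableSet Q)
    (hQ : Q ⊆ Ici (0 : ℝ) ×ˢ Ici (0 : ℝ)) (hQf : volume Q < ∞)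
    {V : Type*} [Fintype V] {c : ℝ × ℝ → V} (hc : ∀ v, MeasurableSet (c ⁻¹' {v}))
    {n : ℕ} (τ : Fin n → V) :
    ∑' σ : Fin n ↪ ℕ, P (indexEvent p Q (range σ) ∩ {ω | ∀ a, c (p (σ a) ω) = τ a}) =
      ENNReal.ofReal (Real.exp (-(volume Q).toReal)) * ∏ a, volume (Q ∩ c ⁻¹' {τ a}) := by
  classical
  have hms : ∀ σ : Fin n ↪ ℕ,
      MeasurableSet (indexEvent p Q (range σ) ∩ {ω | ∀ a, c (p (σ a) ω) = τ a}) := by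
    intro σ
    refine (measurableSet_indexEvent hP.measurable hQm _).inter ?_
    have : {ω | ∀ a, c (p (σ a) ω) = τ a} = ⋂ a, p (σ a) ⁻¹' (c ⁻¹' {τ a}) := by
      ext ω; simp
    rw [this]
    exact MeasurableSet.iInter fun a => hP.measurable _ (hc _)
  set A : Set Ω := {ω | ∀ v, pointCount p (Q ∩ c ⁻¹' {v}) ω = (Fintype.card {a // τ a = v} : ℕ)}
  set K : ℝ≥0∞ := ∏ v, ((Fintype.card {a // τ a = v}).factorial : ℝ≥0∞)
  have hpt : ∀ ω, ∑' σ : Fin n ↪ ℕ, (indexEvent p Q (range σ) ∩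
      {ω | ∀ a, c (p (σ a) ω) = τ a}).indicator (1 : Ω → ℝ≥0∞) ω =
      A.indicator (fun _ => K) ω := by
    intro ω
    have h := tsum_indicator_enumerations (fun i => p i ω) Q c τ
    have e1 : A.indicator (fun _ => K) ω = {y : ℕ → ℝ × ℝ | ∀ v, {i | y i ∈ Q ∩ c ⁻¹' {v}}.encard =
        (Fintype.card {a // τ a = v} : ℕ∞)}.indicator
        (fun _ => ∏ v, ((Fintype.card {a // τ a = v}).factorial : ℝ≥0∞)) (fun i => p i ω) := by
      rfl
    rw [e1, ← h]
    rfl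
  -- The counts are not known to be measurable; `A` is recovered as a level set of the measurable
  -- sum of indicators, which separates it because `K` is nonzero.
  have hA : MeasurableSet A := by
    have hK : K ≠ 0 := Finset.prod_ne_zero_iff.2 fun v _ => by
      exact_mod_cast Nat.factorial_ne_zero _
    have hmeas : Measurable (A.indicator (fun _ => K)) := by
      simp_rw [← funext hpt]
      exact Measurable.tsum fun σ => measurable_one.indicator (hms σ)
    have : A = (A.indicator (fun _ => K)) ⁻¹' {K} := by
      ext ω
      by_cases h : ω ∈ A <;> simp [h, hK.symm]
    rw [this]
    exact hmeas (measurableSet_singleton K)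
  have h1 : ∑' σ : Fin n ↪ ℕ, P (indexEvent p Q (range σ) ∩ {ω | ∀ a, c (p (σ a) ω) = τ a}) =
      P A * K := by
    calc _ = ∑' σ : Fin n ↪ ℕ, ∫⁻ ω, (indexEvent p Q (range σ) ∩
          {ω | ∀ a, c (p (σ a) ω) = τ a}).indicator (1 : Ω → ℝ≥0∞) ω ∂P := by
          refine tsum_congr fun σ => ?_
          rw [lintegral_indicator_one (hms σ)]
      _ = ∫⁻ ω, A.indicator (fun _ => K) ω ∂P := by
          rw [← lintegral_tsum fun σ => (measurable_one.indicator (hms σ)).aemeasurable]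
          exact lintegral_congr hpt
      _ = P A * K := by
          rw [lintegral_indicator_const hA, mul_comm]
  rw [h1, measure_pointCount_eq hP hQm hQ hQf hc, prod_comp_eq_prod_pow τ fun v =>
    volume (Q ∩ c ⁻¹' {v})]

/-- The Janossy measures of a unit rate Poisson process on a set of finite area. -/
theorem janossy_eq {P : Measure Ω} {p : ℕ → Ω → ℝ × ℝ}
    (hP : IsUnitRatePoissonProcess P p) {Q : Set (ℝ × ℝ)} (hQm : MeasurableSet Q)
    (hQ : Q ⊆ Ici (0 : ℝ) ×ˢ Ici (0 : ℝ)) (hQf : volume Q < ∞) (n : ℕ) :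
    Measure.pi (fun _ : Fin n => volume.restrict Q) =
      ENNReal.ofReal (Real.exp (volume Q).toReal) •
        Measure.sum fun σ : Fin n ↪ ℕ =>
          (P.restrict (indexEvent p Q (range σ))).map fun ω a => p (σ a) ω := by
  classical
  refine Measure.pi_eq fun S hS => ?_
  -- The colour of a point records which sides `S a` contain it. A measurable rectangle is then a
  -- finite disjoint union of colour patterns, and `t a` collects the colours that lie in `S a`.
  let c : ℝ × ℝ → (Fin n → Bool) := fun q a => decide (q ∈ S a)
  have hc : ∀ v, MeasurableSet (c ⁻¹' {v}) := by
    intro v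
    have : c ⁻¹' {v} = ⋂ a, (if v a then S a else (S a)ᶜ) := by
      ext q
      simp only [mem_preimage, mem_singleton_iff, mem_iInter, funext_iff, c]
      refine forall_congr' fun a => ?_
      by_cases h : v a <;> simp [h]
    rw [this]
    refine MeasurableSet.iInter fun a => ?_
    split_ifs
    · exact hS a
    · exact (hS a).compl
  let t : Fin n → Finset (Fin n → Bool) := fun a => Finset.univ.filter fun v => v a = true
  have hJ : ∀ σ : Fin n ↪ ℕ,
      ((P.restrict (indexEvent p Q (range σ))).map fun ω a => p (σ a) ω) (univ.pi S) =
      ∑ τ ∈ Fintype.piFinset t,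
        P (indexEvent p Q (range σ) ∩ {ω | ∀ a, c (p (σ a) ω) = τ a}) := by
    intro σ
    have hmeas : Measurable fun ω a => p (σ a) ω :=
      measurable_pi_lambda _ fun a => hP.measurable _
    rw [Measure.map_apply hmeas (MeasurableSet.univ_pi hS)]
    have hf : ∀ τ : Fin n → Fin n → Bool,
        (fun ω a => c (p (σ a) ω)) ⁻¹' {τ} = {ω | ∀ a, c (p (σ a) ω) = τ a} := by
      intro τ
      ext ω
      simp [funext_iff]
    have hfm : ∀ τ : Fin n → Fin n → Bool, MeasurableSet ((fun ω a => c (p (σ a) ω)) ⁻¹' {τ}) := by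
      intro τ
      have : (fun ω a => c (p (σ a) ω)) ⁻¹' {τ} = ⋂ a, p (σ a) ⁻¹' (c ⁻¹' {τ a}) := by
        rw [hf]; ext ω; simp
      rw [this]
      exact MeasurableSet.iInter fun a => hP.measurable _ (hc _)
    have := sum_measure_preimage_singleton (μ := P.restrict (indexEvent p Q (range σ)))
      (Fintype.piFinset t) (f := fun ω a => c (p (σ a) ω)) (fun τ _ => hfm τ)
    have e : (fun ω a => p (σ a) ω) ⁻¹' univ.pi S =
        (fun ω a => c (p (σ a) ω)) ⁻¹' (Fintype.piFinset t : Set (Fin n → Fin n → Bool)) := by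
      ext ω
      simp [t, c]
    rw [e, ← this]
    refine Finset.sum_congr rfl fun τ _ => ?_
    rw [Measure.restrict_apply (hfm τ), hf, inter_comm]
  rw [Measure.smul_apply, Measure.sum_apply _ (MeasurableSet.univ_pi hS)]
  simp_rw [hJ]
  rw [Summable.tsum_finsetSum fun _ _ => ENNReal.summable]
  simp_rw [tsum_measure_enumerations hP hQm hQ hQf hc]
  rw [← Finset.mul_sum, smul_eq_mul, ← mul_assoc, ← ENNReal.ofReal_mul (by positivity),
    ← Real.exp_add, add_neg_cancel, Real.exp_zero, ENNReal.ofReal_one, one_mul,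
    ← Finset.prod_univ_sum t fun _ v => volume (Q ∩ c ⁻¹' {v})]
  refine Finset.prod_congr rfl fun a _ => ?_
  have := sum_measure_preimage_singleton (μ := volume.restrict Q) (t a)
      (f := c) (fun y _ => hc y)
  have e : c ⁻¹' (t a : Set (Fin n → Bool)) = S a := by
    ext q
    simp [t, c]
  rw [e] at this
  rw [← this]
  refine Finset.sum_congr rfl fun v _ => ?_
  rw [Measure.restrict_apply (hc v), inter_comm]

end

/-! ### Mecke formulas for product functionals -/

section

lemma Measurable.of_uncurry_comp {A B C D : Type*} [MeasurableSpace A] [MeasurableSpace B]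
    [MeasurableSpace C] [MeasurableSpace D] {g : A → B → C} (hg : Measurable (Function.uncurry g))
    {u : D → A} (hu : Measurable u) {v : D → B} (hv : Measurable v) :
    Measurable fun x => g (u x) (v x) :=
  hg.comp (hu.prodMk hv)

/-- The coordinates in `s` are integrated out one at a time: neither `f` nor the parameter of `g`
sees them, so each contributes the same factor. -/
lemma lmarginal_mul_prod {ι E : Type*} [DecidableEq ι] [MeasurableSpace E]
    (m : Measure E) [SigmaFinite m] (s : Finset ι) {g : (ι → E) → E → ℝ≥0∞}
    (hg : Measurable (Function.uncurry g))
    (hgs : ∀ i ∈ s, ∀ x y, g (Function.update x i y) = g x) {f : (ι → E) → ℝ≥0∞}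
    (hf : Measurable f) (hfs : ∀ i ∈ s, ∀ x y, f (Function.update x i y) = f x) :
    (∫⋯∫⁻_s, (fun x => f x * ∏ k ∈ s, g x (x k)) ∂fun _ => m) =
      fun x => f x * (∫⁻ y, g x y ∂m) ^ s.card := by
  induction s using Finset.induction_on generalizing f with
  | empty => simp
  | insert i s hi ih =>
    have hpm : Measurable fun x : ι → E => ∏ k ∈ insert i s, g x (x k) :=
      Finset.measurable_prod _ fun k _ =>
        hg.of_uncurry_comp measurable_id (measurable_pi_apply k)
    have hgm : Measurable fun x : ι → E => ∫⁻ y, g x y ∂m :=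
      hg.lintegral_prod_right'
    have hfp : Measurable fun x : ι → E => f x * ∏ k ∈ insert i s, g x (x k) := hf.mul hpm
    rw [lmarginal_insert' _ hfp hi]
    have h1 : ∀ x : ι → E, ∫⁻ y, f (Function.update x i y) *
        ∏ k ∈ insert i s, g (Function.update x i y) (Function.update x i y k) ∂m =
        (f x * ∫⁻ y, g x y ∂m) * ∏ k ∈ s, g x (x k) := by
      intro x
      have h2 : ∀ y, f (Function.update x i y) *
        ∏ k ∈ insert i s, g (Function.update x i y) (Function.update x i y k) =
        (f x * ∏ k ∈ s, g x (x k)) * g x y := by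
        intro y
        rw [hfs i (Finset.mem_insert_self _ _), hgs i (Finset.mem_insert_self _ _),
          Finset.prod_insert hi, Function.update_self, mul_comm (g x y), ← mul_assoc]
        congr 2
        refine Finset.prod_congr rfl fun k hk => ?_
        rw [Function.update_of_ne (fun h : k = i => hi (h ▸ hk))]
      simp_rw [h2]
      have hgx : Measurable (g x) := hg.of_uncurry_comp measurable_const measurable_id
      rw [lintegral_const_mul _ hgx]
      ring
    simp_rw [h1]
    rw [ih (fun j hj => hgs j (Finset.mem_insert_of_mem hj)) (f := fun x => f x * ∫⁻ y, g x y ∂m)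
      (hf.mul hgm)]
    · funext x
      rw [Finset.card_insert_of_notMem hi, pow_succ]
      ring
    · intro j hj x y
      rw [hfs j (Finset.mem_insert_of_mem hj), hgs j (Finset.mem_insert_of_mem hj)]

lemma lintegral_pi_one_point {E : Type*} [MeasurableSpace E] [Nonempty E]
    (m : Measure E) [SigmaFinite m] {n : ℕ} (a : Fin n) {α : E → ℝ≥0∞} (hα : Measurable α)
    {g : E → E → ℝ≥0∞} (hg : Measurable (Function.uncurry g)) :
    ∫⁻ x : Fin n → E, α (x a) * ∏ k ∈ Finset.univ.erase a, g (x a) (x k)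
        ∂Measure.pi (fun _ => m) =
      ∫⁻ q, α q * (∫⁻ y, g q y ∂m) ^ (n - 1) ∂m := by
  have hgm : Measurable fun z : (Fin n → E) × E => g (z.1 a) z.2 := by
    have h : Measurable fun z : (Fin n → E) × E => (z.1 a, z.2) := by fun_prop
    exact hg.comp h
  have hF : Measurable fun x : Fin n → E => α (x a) * ∏ k ∈ Finset.univ.erase a, g (x a) (x k) :=
    (hα.comp (measurable_pi_apply a)).mul (Finset.measurable_prod _ fun k _ =>
      hg.of_uncurry_comp (measurable_pi_apply a) (measurable_pi_apply k))
  have hs := (Finset.insert_erase (Finset.mem_univ a)).symm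
  have has := Finset.notMem_erase a Finset.univ
  have hcard : (Finset.univ.erase a).card = n - 1 := by
    rw [Finset.card_erase_of_mem (Finset.mem_univ a)]; simp
  have hne : ∀ i ∈ Finset.univ.erase a, a ≠ i := fun i hi => (Finset.ne_of_mem_erase hi).symm
  generalize Finset.univ.erase a = s at *
  rw [lintegral_eq_lmarginal_univ (fun _ => Classical.arbitrary E), hs,
    lmarginal_insert _ hF has]
  refine lintegral_congr fun q => ?_
  rw [lmarginal_mul_prod m s (g := fun x y => g (x a) y)
    (f := fun x => α (x a)) hgm ?_ (hα.comp (measurable_pi_apply a)) ?_, hcard]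
  · simp
  · intro i hi x y
    rw [Function.update_of_ne (hne i hi)]
  · intro i hi x y
    rw [Function.update_of_ne (hne i hi)]

lemma lintegral_pi_two_point {E : Type*} [MeasurableSpace E] [Nonempty E]
    (m : Measure E) [SigmaFinite m] {n : ℕ} (a b : Fin n) (hab : a ≠ b) {α : E → E → ℝ≥0∞}
    (hα : Measurable (Function.uncurry α))
    {g : E × E → E → ℝ≥0∞} (hg : Measurable (Function.uncurry g)) :
    ∫⁻ x : Fin n → E, α (x a) (x b) * ∏ k ∈ (Finset.univ.erase a).erase b, g (x a, x b) (x k)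
        ∂Measure.pi (fun _ => m) =
      ∫⁻ q, ∫⁻ q', α q q' * (∫⁻ y, g (q, q') y ∂m) ^ (n - 2) ∂m ∂m := by
  have hgm : Measurable fun z : (Fin n → E) × E => g (z.1 a, z.1 b) z.2 := by
    have h : Measurable fun z : (Fin n → E) × E => ((z.1 a, z.1 b), z.2) := by fun_prop
    exact hg.comp h
  have hαm : Measurable fun x : Fin n → E => α (x a) (x b) :=
    hα.of_uncurry_comp (measurable_pi_apply a) (measurable_pi_apply b)
  have hF : Measurable fun x : Fin n → E =>
      α (x a) (x b) * ∏ k ∈ (Finset.univ.erase a).erase b, g (x a, x b) (x k) :=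
    hαm.mul (Finset.measurable_prod _ fun k _ =>
      hg.of_uncurry_comp ((measurable_pi_apply a).prodMk (measurable_pi_apply b))
        (measurable_pi_apply k))
  have hb : b ∈ Finset.univ.erase a := Finset.mem_erase.2 ⟨hab.symm, Finset.mem_univ _⟩
  have hs : (Finset.univ : Finset (Fin n)) = insert a (insert b ((Finset.univ.erase a).erase b)) := by
    rw [Finset.insert_erase hb, Finset.insert_erase (Finset.mem_univ a)]
  set s := (Finset.univ.erase a).erase b with hsdef
  have has : a ∉ s := fun h => Finset.notMem_erase a _ (Finset.mem_of_mem_erase h)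
  have hbs : b ∉ s := Finset.notMem_erase _ _
  have hcard : s.card = n - 2 := by
    rw [hsdef, Finset.card_erase_of_mem hb, Finset.card_erase_of_mem (Finset.mem_univ a)]
    simp [Nat.sub_sub]
  rw [lintegral_eq_lmarginal_univ (fun _ => Classical.arbitrary E), hs,
    lmarginal_insert _ hF (by simp [hab, has])]
  refine lintegral_congr fun q => ?_
  rw [lmarginal_insert _ hF hbs]
  refine lintegral_congr fun q' => ?_
  rw [lmarginal_mul_prod m s (g := fun x y => g (x a, x b) y)
    (f := fun x => α (x a) (x b)) hgm ?_ hαm ?_, hcard]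
  · simp [Function.update_of_ne hab]
  all_goals
    intro i hi x y
    rw [Function.update_of_ne (ne_of_mem_of_not_mem hi has).symm,
      Function.update_of_ne (ne_of_mem_of_not_mem hi hbs).symm]

lemma card_finEmbedding_map_eq {n : ℕ} (F : Finset ℕ) (hF : F.card = n) :
    Nat.card {σ : Fin n ↪ ℕ // Finset.univ.map σ = F} = n.factorial := by
  have e : {σ : Fin n ↪ ℕ // Finset.univ.map σ = F} ≃ (Fin n ≃ F) :=
    { toFun := fun σ => Equiv.ofBijective
        (fun a => ⟨σ.1 a, σ.2.subset (Finset.mem_map_of_mem _ (Finset.mem_univ _))⟩)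
        ⟨fun a b h => σ.1.injective (congrArg Subtype.val h), fun ⟨i, hi⟩ => by
          obtain ⟨a, -, ha⟩ := Finset.mem_map.1 (σ.2.superset hi)
          exact ⟨a, Subtype.ext ha⟩⟩
      invFun := fun e => ⟨e.toEmbedding.trans (Function.Embedding.subtype _), by
        ext i
        simp only [Finset.mem_map, Finset.mem_univ, true_and]
        constructor
        · rintro ⟨a, rfl⟩; exact (e a).2
        · intro hi; exact ⟨e.symm ⟨i, hi⟩, by simp⟩⟩
      left_inv := fun σ => by ext; rfl
      right_inv := fun e => by ext; rfl }
  rw [Nat.card_congr e]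
  have e0 : Fin n ≃ F := Fintype.equivOfCardEq (by simp [hF])
  rw [Nat.card_eq_fintype_card, Fintype.card_equiv e0, Fintype.card_fin]

/-- Janossy measures count ordered configurations, and a set of `n` indices has `n.factorial`
orderings. -/
lemma tsum_finEmbedding_map (n : ℕ) (h : Finset ℕ → ℝ≥0∞) :
    ∑' σ : Fin n ↪ ℕ, h (Finset.univ.map σ) =
      n.factorial * ∑' F : Finset ℕ, if F.card = n then h F else 0 := by
  rw [← (Equiv.sigmaFiberEquiv (fun σ : Fin n ↪ ℕ => Finset.univ.map σ)).tsum_eq,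
    ENNReal.tsum_sigma', ← ENNReal.tsum_mul_left]
  refine tsum_congr fun F => ?_
  by_cases hF : F.card = n
  · rw [if_pos hF]
    have hc := card_finEmbedding_map_eq F hF
    have hfin : Finite {σ : Fin n ↪ ℕ // Finset.univ.map σ = F} :=
      Nat.finite_of_card_ne_zero (by rw [hc]; exact Nat.factorial_ne_zero _)
    have := Fintype.ofFinite {σ : Fin n ↪ ℕ // Finset.univ.map σ = F}
    have h1 : ∀ σ : {σ : Fin n ↪ ℕ // Finset.univ.map σ = F}, h (Finset.univ.map
        (Equiv.sigmaFiberEquiv (fun σ : Fin n ↪ ℕ => Finset.univ.map σ) ⟨F, σ⟩)) = h F :=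
      fun σ => congrArg h σ.2
    simp_rw [h1]
    rw [tsum_fintype, Finset.sum_const, Finset.card_univ, ← Nat.card_eq_fintype_card, hc,
      nsmul_eq_mul]
  · rw [if_neg hF, mul_zero, ENNReal.tsum_eq_zero]
    rintro ⟨σ, hσ⟩
    exact absurd (by rw [← hσ]; simp) hF

/-- Expectations of symmetric functionals of a unit rate Poisson process on a set of finite
area, as a series of integrals. -/
theorem tsum_lintegral_indexEvent {P : Measure Ω} {p : ℕ → Ω → ℝ × ℝ}
    (hP : IsUnitRatePoissonProcess P p) {Q : Set (ℝ × ℝ)} (hQm : MeasurableSet Q)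
    (hQ : Q ⊆ Ici (0 : ℝ) ×ˢ Ici (0 : ℝ)) (hQf : volume Q < ∞)
    {Ψ : Finset ℕ → (ℕ → ℝ × ℝ) → ℝ≥0∞} {H : ∀ n, (Fin n → ℝ × ℝ) → ℝ≥0∞}
    (hH : ∀ n, Measurable (H n))
    (hΨ : ∀ n (σ : Fin n ↪ ℕ) x, Ψ (Finset.univ.map σ) x = H n fun a => x (σ a)) :
    ∑' F : Finset ℕ, ∫⁻ ω in indexEvent p Q F, Ψ F (fun i => p i ω) ∂P =
      ENNReal.ofReal (Real.exp (-(volume Q).toReal)) * ∑' n : ℕ, (n.factorial : ℝ≥0∞)⁻¹ *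
        ∫⁻ x, H n x ∂Measure.pi (fun _ => volume.restrict Q) := by
  set h : Finset ℕ → ℝ≥0∞ := fun F => ∫⁻ ω in indexEvent p Q F, Ψ F (fun i => p i ω) ∂P
  have h1 : ∀ n : ℕ, ∫⁻ x, H n x ∂Measure.pi (fun _ => volume.restrict Q) =
      ENNReal.ofReal (Real.exp (volume Q).toReal) *
        (n.factorial * ∑' F : Finset ℕ, if F.card = n then h F else 0) := by
    intro n
    rw [janossy_eq hP hQm hQ hQf, lintegral_smul_measure, lintegral_sum_measure,
      ← tsum_finEmbedding_map, smul_eq_mul]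
    congr 1
    refine tsum_congr fun σ => ?_
    rw [lintegral_map (hH n) (measurable_pi_lambda _ fun a => hP.measurable _)]
    simp only [h, hΨ]
    congr 2
    simp
  have h2 : ∀ n : ℕ, ENNReal.ofReal (Real.exp (-(volume Q).toReal)) *
      ((n.factorial : ℝ≥0∞)⁻¹ * (ENNReal.ofReal (Real.exp (volume Q).toReal) *
        (n.factorial * ∑' F : Finset ℕ, if F.card = n then h F else 0))) =
        ∑' F : Finset ℕ, if F.card = n then h F else 0 := by
    intro n
    have e1 : ENNReal.ofReal (Real.exp (-(volume Q).toReal)) *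
        ENNReal.ofReal (Real.exp (volume Q).toReal) = 1 := by
      rw [← ENNReal.ofReal_mul (Real.exp_pos _).le, ← Real.exp_add]; simp
    have e2 : (n.factorial : ℝ≥0∞)⁻¹ * n.factorial = 1 :=
      ENNReal.inv_mul_cancel (by exact_mod_cast n.factorial_ne_zero) (ENNReal.natCast_ne_top _)
    calc _ = (ENNReal.ofReal (Real.exp (-(volume Q).toReal)) *
        ENNReal.ofReal (Real.exp (volume Q).toReal)) * ((n.factorial : ℝ≥0∞)⁻¹ * n.factorial) *
          ∑' F : Finset ℕ, (if F.card = n then h F else 0) := by ring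
      _ = _ := by rw [e1, e2, one_mul, one_mul]
  simp_rw [h1]
  rw [← ENNReal.tsum_mul_left]
  simp_rw [h2]
  rw [ENNReal.tsum_comm]
  refine tsum_congr fun F => ?_
  rw [tsum_eq_single F.card (fun n hn => if_neg hn.symm), if_pos rfl]

lemma ofReal_exp_mul_tsum {b x : ℝ} (hx : 0 ≤ x) :
    ENNReal.ofReal (Real.exp (-b)) * ∑' n : ℕ, (n.factorial : ℝ≥0∞)⁻¹ * ENNReal.ofReal x ^ n =
      ENNReal.ofReal (Real.exp (x - b)) := by
  have h : ∀ n : ℕ, (n.factorial : ℝ≥0∞)⁻¹ * ENNReal.ofReal x ^ n =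
      ENNReal.ofReal (x ^ n / n.factorial) := by
    intro n
    rw [ENNReal.ofReal_div_of_pos (by positivity), ENNReal.ofReal_pow hx, ENNReal.ofReal_natCast,
      div_eq_mul_inv, mul_comm]
  simp_rw [h]
  rw [← ENNReal.ofReal_tsum_of_nonneg (fun n => by positivity) (Real.summable_pow_div_factorial x),
    ← ENNReal.ofReal_mul (Real.exp_pos _).le, sub_eq_neg_add, Real.exp_add, Real.exp_eq_exp_ℝ,
    NormedSpace.exp_eq_tsum_div (𝔸 := ℝ)]

lemma inv_factorial_succ_mul (n : ℕ) :
    ((n + 1).factorial : ℝ≥0∞)⁻¹ * ((n + 1 : ℕ) : ℝ≥0∞) = (n.factorial : ℝ≥0∞)⁻¹ := by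
  rw [Nat.factorial_succ, Nat.cast_mul, ENNReal.mul_inv (Or.inr (ENNReal.natCast_ne_top _))
    (Or.inl (ENNReal.natCast_ne_top _)), mul_right_comm, ENNReal.inv_mul_cancel
    (by exact_mod_cast n.succ_ne_zero) (ENNReal.natCast_ne_top _), one_mul]

/-- One-point Mecke formula for product functionals. -/
theorem mecke_one {P : Measure Ω} {p : ℕ → Ω → ℝ × ℝ}
    (hP : IsUnitRatePoissonProcess P p) {Q : Set (ℝ × ℝ)} (hQm : MeasurableSet Q)
    (hQ : Q ⊆ Ici (0 : ℝ) ×ˢ Ici (0 : ℝ)) (hQf : volume Q < ∞)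
    {α : ℝ × ℝ → ℝ≥0∞} (hα : Measurable α) {g : ℝ × ℝ → ℝ × ℝ → ℝ≥0∞}
    (hg : Measurable (Function.uncurry g)) {G : ℝ × ℝ → ℝ} (hG0 : ∀ q ∈ Q, 0 ≤ G q)
    (hG : ∀ q ∈ Q, ∫⁻ y in Q, g q y = ENNReal.ofReal (G q)) :
    ∑' F : Finset ℕ, ∫⁻ ω in indexEvent p Q F, ∑ i ∈ F, α (p i ω) *
        ∏ k ∈ F.erase i, g (p i ω) (p k ω) ∂P =
      ∫⁻ q in Q, α q * ENNReal.ofReal (Real.exp (G q - (volume Q).toReal)) := by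
  have hgm : Measurable fun q => ∫⁻ y in Q, g q y := hg.lintegral_prod_right'
  have hmH : ∀ n (a : Fin n), Measurable fun x : Fin n → ℝ × ℝ =>
      α (x a) * ∏ k ∈ Finset.univ.erase a, g (x a) (x k) := fun n a =>
    (hα.comp (measurable_pi_apply a)).mul (Finset.measurable_prod _ fun k _ =>
      hg.of_uncurry_comp (measurable_pi_apply a) (measurable_pi_apply k))
  rw [tsum_lintegral_indexEvent hP hQm hQ hQf
    (Ψ := fun F x => ∑ i ∈ F, α (x i) * ∏ k ∈ F.erase i, g (x i) (x k))
    (H := fun n x => ∑ a, α (x a) * ∏ k ∈ Finset.univ.erase a, g (x a) (x k))]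
  · have h1 : ∀ n : ℕ, ∫⁻ x : Fin n → ℝ × ℝ, ∑ a, α (x a) *
        ∏ k ∈ Finset.univ.erase a, g (x a) (x k) ∂Measure.pi (fun _ => volume.restrict Q) =
        n * ∫⁻ q in Q, α q * (∫⁻ y in Q, g q y) ^ (n - 1) := by
      intro n
      rw [lintegral_finsetSum _ fun a _ => hmH n a]
      simp_rw [lintegral_pi_one_point _ _ hα hg]
      simp
    simp_rw [h1]
    -- There is no point to single out for `n = 0`. Afterwards `n / n! = 1 / (n - 1)!` shifts the
    -- index and leaves a full exponential series.
    rw [tsum_eq_zero_add' ENNReal.summable]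
    simp only [Nat.cast_zero, zero_mul, mul_zero, zero_add, ← mul_assoc, inv_factorial_succ_mul,
      Nat.add_sub_cancel]
    have h2 : ∀ n : ℕ, (n.factorial : ℝ≥0∞)⁻¹ * ∫⁻ q in Q, α q * (∫⁻ y in Q, g q y) ^ n =
        ∫⁻ q in Q, (n.factorial : ℝ≥0∞)⁻¹ * (α q * (∫⁻ y in Q, g q y) ^ n) := fun n =>
      (lintegral_const_mul _ (hα.mul (hgm.pow_const n))).symm
    have hin : ∀ n : ℕ, Measurable fun q => (n.factorial : ℝ≥0∞)⁻¹ *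
        (α q * (∫⁻ y in Q, g q y) ^ n) := fun n =>
      measurable_const.mul (hα.mul (hgm.pow_const n))
    simp_rw [h2]
    rw [← lintegral_tsum fun n => (hin n).aemeasurable, ← lintegral_const_mul _
      (Measurable.tsum hin)]
    refine setLIntegral_congr_fun hQm fun q hq => ?_
    rw [hG q hq, ← ofReal_exp_mul_tsum (hG0 q hq), mul_left_comm (α q), ← ENNReal.tsum_mul_left (a := α q)]
    congr 1
    exact tsum_congr fun n => by ring
  · exact fun n => Finset.measurable_sum _ fun a _ => hmH n a
  · intro n σ x
    simp [Finset.sum_map, ← Finset.map_erase]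

/-- Two-point Mecke formula for product functionals. -/
theorem mecke_two {P : Measure Ω} {p : ℕ → Ω → ℝ × ℝ}
    (hP : IsUnitRatePoissonProcess P p) {Q : Set (ℝ × ℝ)} (hQm : MeasurableSet Q)
    (hQ : Q ⊆ Ici (0 : ℝ) ×ˢ Ici (0 : ℝ)) (hQf : volume Q < ∞)
    {α : ℝ × ℝ → ℝ × ℝ → ℝ≥0∞} (hα : Measurable (Function.uncurry α))
    {g : (ℝ × ℝ) × (ℝ × ℝ) → ℝ × ℝ → ℝ≥0∞}
    (hg : Measurable (Function.uncurry g)) {G : ℝ × ℝ → ℝ × ℝ → ℝ}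
    (hG0 : ∀ q ∈ Q, ∀ q' ∈ Q, 0 ≤ G q q')
    (hG : ∀ q ∈ Q, ∀ q' ∈ Q, ∫⁻ y in Q, g (q, q') y = ENNReal.ofReal (G q q')) :
    ∑' F : Finset ℕ, ∫⁻ ω in indexEvent p Q F, ∑ i ∈ F, ∑ j ∈ F.erase i, α (p i ω) (p j ω) *
        ∏ k ∈ (F.erase i).erase j, g (p i ω, p j ω) (p k ω) ∂P =
      ∫⁻ q in Q, ∫⁻ q' in Q,
        α q q' * ENNReal.ofReal (Real.exp (G q q' - (volume Q).toReal)) := by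
  have hgm : Measurable fun z => ∫⁻ y in Q, g z y := hg.lintegral_prod_right'
  have hmH : ∀ n (a b : Fin n), Measurable fun x : Fin n → ℝ × ℝ =>
      α (x a) (x b) * ∏ k ∈ (Finset.univ.erase a).erase b, g (x a, x b) (x k) := fun n a b =>
    (hα.of_uncurry_comp (measurable_pi_apply a) (measurable_pi_apply b)).mul
      (Finset.measurable_prod _ fun k _ => hg.of_uncurry_comp
        ((measurable_pi_apply a).prodMk (measurable_pi_apply b)) (measurable_pi_apply k))
  rw [tsum_lintegral_indexEvent hP hQm hQ hQf
    (Ψ := fun F x => ∑ i ∈ F, ∑ j ∈ F.erase i, α (x i) (x j) *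
      ∏ k ∈ (F.erase i).erase j, g (x i, x j) (x k))
    (H := fun n x => ∑ a, ∑ b ∈ Finset.univ.erase a, α (x a) (x b) *
      ∏ k ∈ (Finset.univ.erase a).erase b, g (x a, x b) (x k))]
  · set m := volume.restrict Q with hm
    have hin : ∀ n : ℕ, Measurable fun z : (ℝ × ℝ) × (ℝ × ℝ) =>
        α z.1 z.2 * (∫⁻ y in Q, g (z.1, z.2) y) ^ n := fun n =>
      (hα.of_uncurry_comp measurable_fst measurable_snd).mul (hgm.pow_const n)
    have h1 : ∀ n : ℕ, ∫⁻ x : Fin n → ℝ × ℝ, ∑ a, ∑ b ∈ Finset.univ.erase a, α (x a) (x b) *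
        ∏ k ∈ (Finset.univ.erase a).erase b, g (x a, x b) (x k) ∂Measure.pi (fun _ => m) =
        n * (n - 1 : ℕ) *
          ∫⁻ z, α z.1 z.2 * (∫⁻ y in Q, g (z.1, z.2) y) ^ (n - 2) ∂m.prod m := by
      intro n
      rw [lintegral_finsetSum _ fun a _ => Finset.measurable_sum _ fun b _ => hmH n a b]
      have h2 : ∀ a : Fin n, ∫⁻ x : Fin n → ℝ × ℝ, ∑ b ∈ Finset.univ.erase a, α (x a) (x b) *
        ∏ k ∈ (Finset.univ.erase a).erase b, g (x a, x b) (x k) ∂Measure.pi (fun _ => m) =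
          (n - 1 : ℕ) *
            ∫⁻ z, α z.1 z.2 * (∫⁻ y in Q, g (z.1, z.2) y) ^ (n - 2) ∂m.prod m := by
        intro a
        rw [lintegral_finsetSum _ fun b _ => hmH n a b, lintegral_prod _ (hin _).aemeasurable,
          Finset.sum_congr rfl fun b hb =>
            lintegral_pi_two_point m a b (Finset.ne_of_mem_erase hb).symm hα hg,
          Finset.sum_const, Finset.card_erase_of_mem (Finset.mem_univ a)]
        simp [hm]
      simp_rw [h2]
      simp [mul_assoc]
    simp_rw [h1]
    -- Two points need `n ≥ 2`; the number `n (n - 1)` of ordered pairs shifts the exponential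
    -- series by two.
    rw [tsum_eq_zero_add' ENNReal.summable, tsum_eq_zero_add' ENNReal.summable]
    have h3 : ∀ n : ℕ, ((n + 1 + 1).factorial : ℝ≥0∞)⁻¹ * (((n + 1 + 1 : ℕ) : ℝ≥0∞) *
        ((n + 1 + 1 - 1 : ℕ) : ℝ≥0∞) *
          ∫⁻ z, α z.1 z.2 * (∫⁻ y in Q, g (z.1, z.2) y) ^ (n + 1 + 1 - 2) ∂m.prod m) =
        ∫⁻ z, (n.factorial : ℝ≥0∞)⁻¹ * (α z.1 z.2 * (∫⁻ y in Q, g (z.1, z.2) y) ^ n)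
          ∂m.prod m := by
      intro n
      rw [lintegral_const_mul _ (hin n), ← mul_assoc, ← mul_assoc, inv_factorial_succ_mul,
        Nat.add_sub_cancel, inv_factorial_succ_mul]
      rfl
    simp_rw [h3]
    simp only [Nat.cast_zero, zero_mul, mul_zero, zero_add, Nat.sub_self]
    have hin' : ∀ n : ℕ, Measurable fun z : (ℝ × ℝ) × (ℝ × ℝ) => (n.factorial : ℝ≥0∞)⁻¹ *
        (α z.1 z.2 * (∫⁻ y in Q, g (z.1, z.2) y) ^ n) := fun n => measurable_const.mul (hin n)
    rw [← lintegral_tsum fun n => (hin' n).aemeasurable,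
      ← lintegral_const_mul _ (Measurable.tsum hin')]
    have hin'' : Measurable fun z : (ℝ × ℝ) × (ℝ × ℝ) =>
        ENNReal.ofReal (Real.exp (-(volume Q).toReal)) * ∑' n : ℕ, (n.factorial : ℝ≥0∞)⁻¹ *
        (α z.1 z.2 * (∫⁻ y in Q, g (z.1, z.2) y) ^ n) :=
      measurable_const.mul (Measurable.tsum hin')
    rw [lintegral_prod _ hin''.aemeasurable]
    refine setLIntegral_congr_fun hQm fun q hq => setLIntegral_congr_fun hQm fun q' hq' => ?_
    simp only
    rw [hG q hq q' hq', ← ofReal_exp_mul_tsum (hG0 q hq q' hq'), mul_left_comm (α q q'),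
      ← ENNReal.tsum_mul_left (a := α q q')]
    congr 1
    exact tsum_congr fun n => by ring
  · exact fun n => Finset.measurable_sum _ fun a _ => Finset.measurable_sum _ fun b _ => hmH n a b
  · intro n σ x
    simp [Finset.sum_map, ← Finset.map_erase]

end

/-! ### Integrating out the edge variables -/

section

/-- A symmetric measurable function with values in `[0,1]`. -/
structure IsEdgeKernel (W : ℝ → ℝ → ℝ) : Prop where
  measurable : Measurable (Function.uncurry W)
  nonneg : ∀ x y, 0 ≤ W x y
  le_one : ∀ x y, W x y ≤ 1
  symm : ∀ x y, W x y = W y x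

/-- The number of non-loop edges from `i` to the other vertices of `F`. -/
def edgeDegree (W : ℝ → ℝ → ℝ) (x : ℕ → ℝ × ℝ) (z : Sym2 ℕ → ℝ) (F : Finset ℕ) (i : ℕ) : ℕ :=
  ((F.erase i).filter fun j => z s(i, j) < W (x i).2 (x j).2).card

/-- The mean of a variable that is `T` with probability `w` and `1` otherwise. -/
def edgeFactor (T : ℝ≥0∞) (w : ℝ) : ℝ≥0∞ := ENNReal.ofReal (1 - w) + T * ENNReal.ofReal w

lemma measurable_edgeFactor (T : ℝ≥0∞) : Measurable (edgeFactor T) := by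
  unfold edgeFactor; fun_prop

lemma edgeFactor_ofReal {τ w : ℝ} (hτ : 0 ≤ τ) (h0 : 0 ≤ w) (h1 : w ≤ 1) :
    edgeFactor (ENNReal.ofReal τ) w = ENNReal.ofReal (1 - (1 - τ) * w) := by
  rw [edgeFactor, ← ENNReal.ofReal_mul hτ, ← ENNReal.ofReal_add (by linarith) (by positivity)]
  congr 1; ring

lemma measurable_indicator_lt (T : ℝ≥0∞) (w : ℝ) :
    Measurable fun y : ℝ => if y < w then T else 1 :=
  Measurable.ite measurableSet_Iio measurable_const measurable_const

lemma lintegral_edge {P : Measure Ω} {ζ : Sym2 ℕ → Ω → ℝ}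
    (hm : ∀ e, Measurable (ζ e))
    (hu : ∀ e, P.map (ζ e) = volume.restrict (Icc (0 : ℝ) 1))
    (e : Sym2 ℕ) (T : ℝ≥0∞) {w : ℝ} (h0 : 0 ≤ w) (h1 : w ≤ 1) :
    ∫⁻ ω, (if ζ e ω < w then T else 1) ∂P = edgeFactor T w := by
  have : ∫⁻ ω, (if ζ e ω < w then T else 1) ∂P =
      ∫⁻ y, (if y < w then T else 1) ∂P.map (ζ e) :=
    (lintegral_map (measurable_indicator_lt T w) (hm e)).symm
  rw [this, hu]
  have hs : Icc (0 : ℝ) 1 = Ico 0 w ∪ Icc w 1 := (Ico_union_Icc_eq_Icc h0 h1).symm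
  have hd : Disjoint (Ico 0 w) (Icc w 1) :=
    Set.disjoint_left.2 fun x hx hx' => not_lt.2 hx'.1 hx.2
  rw [hs, lintegral_union measurableSet_Icc hd,
    setLIntegral_congr_fun (g := fun _ => T) measurableSet_Ico (fun x hx => if_pos hx.2),
    setLIntegral_congr_fun (g := fun _ => 1) measurableSet_Icc (fun x hx => if_neg (not_lt.2 hx.1))]
  simp [edgeFactor, add_comm]

lemma lintegral_prod_edges {P : Measure Ω} {ζ : Sym2 ℕ → Ω → ℝ}
    (hm : ∀ e, Measurable (ζ e))
    (hu : ∀ e, P.map (ζ e) = volume.restrict (Icc (0 : ℝ) 1)) (hi : iIndepFun ζ P)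
    (E : Finset (Sym2 ℕ)) (T : Sym2 ℕ → ℝ≥0∞) {w : Sym2 ℕ → ℝ} (h0 : ∀ e, 0 ≤ w e)
    (h1 : ∀ e, w e ≤ 1) :
    ∫⁻ ω, ∏ e ∈ E, (if ζ e ω < w e then T e else 1) ∂P = ∏ e ∈ E, edgeFactor (T e) (w e) := by
  have := lintegral_prod_eq_prod_lintegral_of_indepFun E
    (fun e ω => if ζ e ω < w e then T e else 1)
    (hi.comp (fun e y => if y < w e then T e else 1) fun e => measurable_indicator_lt _ _)
    (fun e => (measurable_indicator_lt _ _).comp (hm e))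
  rw [this]
  exact Finset.prod_congr rfl fun e _ => lintegral_edge hm hu e (T e) (h0 e) (h1 e)

/-- The edge probabilities as a function on unordered pairs. -/
def pairWeight {W : ℝ → ℝ → ℝ} (hW : IsEdgeKernel W) (x : ℕ → ℝ × ℝ) : Sym2 ℕ → ℝ :=
  Sym2.lift ⟨fun i j => W (x i).2 (x j).2, fun _ _ => hW.symm _ _⟩

lemma pairWeight_mk {W : ℝ → ℝ → ℝ} (hW : IsEdgeKernel W) (x : ℕ → ℝ × ℝ) (i j : ℕ) :
    pairWeight hW x s(i, j) = W (x i).2 (x j).2 := rfl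

lemma pairWeight_nonneg {W : ℝ → ℝ → ℝ} (hW : IsEdgeKernel W) (x : ℕ → ℝ × ℝ) (e : Sym2 ℕ) :
    0 ≤ pairWeight hW x e := by
  induction e with | _ i j => exact hW.nonneg _ _

lemma pairWeight_le_one {W : ℝ → ℝ → ℝ} (hW : IsEdgeKernel W) (x : ℕ → ℝ × ℝ) (e : Sym2 ℕ) :
    pairWeight hW x e ≤ 1 := by
  induction e with | _ i j => exact hW.le_one _ _

lemma pow_edgeDegree (W : ℝ → ℝ → ℝ) (x : ℕ → ℝ × ℝ) (z : Sym2 ℕ → ℝ) (F : Finset ℕ) (i : ℕ)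
    (T : ℝ≥0∞) : T ^ edgeDegree W x z F i =
      ∏ j ∈ F.erase i, if z s(i, j) < W (x i).2 (x j).2 then T else 1 := by
  rw [edgeDegree, Finset.prod_ite]
  simp

/-- Different neighbours `j` of `i` use different unordered pairs, hence independent variables. -/
lemma lintegral_pow_edgeDegree {P : Measure Ω} {ζ : Sym2 ℕ → Ω → ℝ}
    (hm : ∀ e, Measurable (ζ e))
    (hu : ∀ e, P.map (ζ e) = volume.restrict (Icc (0 : ℝ) 1)) (hi : iIndepFun ζ P)
    {W : ℝ → ℝ → ℝ} (hW : IsEdgeKernel W) (x : ℕ → ℝ × ℝ) (F : Finset ℕ) (i : ℕ) (T : ℝ≥0∞) :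
    ∫⁻ ω, T ^ edgeDegree W x (fun e => ζ e ω) F i ∂P =
      ∏ k ∈ F.erase i, edgeFactor T (W (x i).2 (x k).2) := by
  have hinj : Set.InjOn (fun j => s(i, j)) (F.erase i : Set ℕ) := fun _ _ _ _ h => Sym2.congr_right.1 h
  have hp : ∀ f : Sym2 ℕ → ℝ≥0∞, ∏ e ∈ (F.erase i).image (fun j => s(i, j)), f e =
      ∏ k ∈ F.erase i, f s(i, k) := fun f => Finset.prod_image hinj
  have := lintegral_prod_edges hm hu hi ((F.erase i).image fun j => s(i, j)) (fun _ => T)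
    (pairWeight_nonneg hW x) (pairWeight_le_one hW x)
  simp_rw [hp, pairWeight_mk] at this
  rw [← this]
  exact lintegral_congr fun ω => pow_edgeDegree W x _ F i T

/-- The two stars at `i` and `j` share exactly one pair, `s(i, j)`. It counts in both degrees and
carries the weight `T * T'`; all other pairs are distinct and independent. -/
lemma lintegral_pow_edgeDegree_mul {P : Measure Ω} {ζ : Sym2 ℕ → Ω → ℝ}
    (hm : ∀ e, Measurable (ζ e))
    (hu : ∀ e, P.map (ζ e) = volume.restrict (Icc (0 : ℝ) 1)) (hi : iIndepFun ζ P)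
    {W : ℝ → ℝ → ℝ} (hW : IsEdgeKernel W) (x : ℕ → ℝ × ℝ) {F : Finset ℕ} {i j : ℕ} (hij : j ≠ i)
    (hiF : i ∈ F) (hjF : j ∈ F) (T T' : ℝ≥0∞) :
    ∫⁻ ω, T ^ edgeDegree W x (fun e => ζ e ω) F i * T' ^ edgeDegree W x (fun e => ζ e ω) F j ∂P =
      edgeFactor (T * T') (W (x i).2 (x j).2) * ∏ k ∈ (F.erase i).erase j,
        (edgeFactor T (W (x i).2 (x k).2) * edgeFactor T' (W (x j).2 (x k).2)) := by
  classical
  set R := (F.erase i).erase j with hR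
  have hiR : i ∉ R := by simp [hR]
  have hjR : j ∉ R := by simp [hR]
  have hRi : F.erase i = insert j R := by
    rw [hR, Finset.insert_erase (Finset.mem_erase.2 ⟨hij, hjF⟩)]
  have hRj : F.erase j = insert i R := by
    rw [hR, Finset.erase_right_comm, Finset.insert_erase (Finset.mem_erase.2 ⟨hij.symm, hiF⟩)]
  let E : Finset (Sym2 ℕ) := insert s(i, j) (R.image (fun k => s(i, k)) ∪ R.image fun k => s(j, k))
  have hp : ∀ f : Sym2 ℕ → ℝ≥0∞, ∏ e ∈ E, f e = f s(i, j) * ∏ k ∈ R, (f s(i, k) * f s(j, k)) := by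
    intro f
    have h1 : s(i, j) ∉ R.image (fun k => s(i, k)) ∪ R.image fun k => s(j, k) := by
      simp only [Finset.mem_union, Finset.mem_image, not_or, not_exists, not_and]
      refine ⟨fun k hk h => ?_, fun k hk h => ?_⟩
      · have : k = j := Sym2.congr_right.1 h
        exact hjR (this ▸ hk)
      · rw [Sym2.eq_swap (a := i)] at h
        have : k = i := Sym2.congr_right.1 h
        exact hiR (this ▸ hk)
    have h2 : Disjoint (R.image fun k => s(i, k)) (R.image fun k => s(j, k)) := by
      rw [Finset.disjoint_left]
      intro e he he'
      obtain ⟨k, hk, rfl⟩ := Finset.mem_image.1 he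
      obtain ⟨l, hl, h⟩ := Finset.mem_image.1 he'
      rw [Sym2.eq_iff] at h
      rcases h with ⟨h, -⟩ | ⟨-, h⟩
      · exact hij h
      · exact hiR (h ▸ hl)
    rw [Finset.prod_insert h1, Finset.prod_union h2,
      Finset.prod_image (fun _ _ _ _ h => Sym2.congr_right.1 h),
      Finset.prod_image (fun _ _ _ _ h => Sym2.congr_right.1 h), Finset.prod_mul_distrib]
  -- One factor for each of the endpoints `i` and `j` of the pair; this treats the shared pair and
  -- the two stars by a single formula.
  let S : Sym2 ℕ → ℝ≥0∞ := fun e => (if i ∈ e then T else 1) * (if j ∈ e then T' else 1)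
  have hS0 : S s(i, j) = T * T' := by simp [S]
  have hSi : ∀ k ∈ R, S s(i, k) = T := fun k hk => by
    have : j ≠ k := fun h => hjR (h ▸ hk)
    simp [S, this, hij]
  have hSj : ∀ k ∈ R, S s(j, k) = T' := fun k hk => by
    have : i ≠ k := fun h => hiR (h ▸ hk)
    simp [S, this, hij.symm]
  have key := lintegral_prod_edges hm hu hi E S
    (pairWeight_nonneg hW x) (pairWeight_le_one hW x)
  refine (lintegral_congr fun ω => ?_).trans (key.trans ?_)
  · have hc : ∏ k ∈ R, ((if ζ s(i, k) ω < pairWeight hW x s(i, k) then S s(i, k) else 1) *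
          if ζ s(j, k) ω < pairWeight hW x s(j, k) then S s(j, k) else 1) =
        ∏ k ∈ R, ((if ζ s(i, k) ω < W (x i).2 (x k).2 then T else 1) *
          if ζ s(j, k) ω < W (x j).2 (x k).2 then T' else 1) :=
      Finset.prod_congr rfl fun k hk => by rw [hSi k hk, hSj k hk]; rfl
    have h0 : (if ζ s(i, j) ω < pairWeight hW x s(i, j) then S s(i, j) else 1) =
        (if ζ s(i, j) ω < W (x i).2 (x j).2 then T * T' else 1) := by rw [hS0]; rfl
    rw [hp, hc, h0, pow_edgeDegree, pow_edgeDegree, hRi, hRj, Finset.prod_insert hjR,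
      Finset.prod_insert hiR, Finset.prod_mul_distrib,
      Sym2.eq_swap (a := j) (b := i), hW.symm (x j).2 (x i).2]
    split_ifs <;> ring
  · rw [hp, hS0, pairWeight_mk]
    congr 1
    exact Finset.prod_congr rfl fun k hk => by rw [hSi k hk, hSj k hk]; rfl

lemma measurable_edgeDegree {W : ℝ → ℝ → ℝ} (hW : IsEdgeKernel W) (F : Finset ℕ) (i : ℕ) :
    Measurable fun y : (ℕ → ℝ × ℝ) × (Sym2 ℕ → ℝ) => edgeDegree W y.1 y.2 F i := by
  unfold edgeDegree
  simp_rw [Finset.card_filter]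
  refine Finset.measurable_sum _ fun j _ => Measurable.ite ?_ measurable_const measurable_const
  refine measurableSet_lt (by fun_prop) ?_
  exact hW.measurable.of_uncurry_comp (by fun_prop) (by fun_prop)

/-- Integrating out the edge variables. -/
lemma lintegral_indep_points {P : Measure Ω} [IsProbabilityMeasure P] {p : ℕ → Ω → ℝ × ℝ}
    {ζ : Sym2 ℕ → Ω → ℝ} (hG : IsKEGSource P p ζ) {Q : Set (ℝ × ℝ)} (hQ : MeasurableSet Q)
    (s : Set ℕ) {Φ : (ℕ → ℝ × ℝ) × (Sym2 ℕ → ℝ) → ℝ≥0∞} (hΦ : Measurable Φ) :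
    ∫⁻ ω in indexEvent p Q s, Φ (fun i => p i ω, fun e => ζ e ω) ∂P =
      ∫⁻ ω in indexEvent p Q s, ∫⁻ ω', Φ (fun i => p i ω, fun e => ζ e ω') ∂P ∂P := by
  have hp : Measurable fun ω i => p i ω := measurable_pi_lambda _ hG.poisson.measurable
  have hz : Measurable fun ω e => ζ e ω := measurable_pi_lambda _ hG.measurable
  have hA : MeasurableSet {x : ℕ → ℝ × ℝ | ∀ i, x i ∈ Q ↔ i ∈ s} :=
    measurableSet_indexEvent (p := fun i (x : ℕ → ℝ × ℝ) => x i) (fun i => measurable_pi_apply i)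
      hQ s
  set A := {x : ℕ → ℝ × ℝ | ∀ i, x i ∈ Q ↔ i ∈ s}
  have hpre : indexEvent p Q s = (fun ω i => p i ω) ⁻¹' A := rfl
  have hms := measurableSet_indexEvent hG.poisson.measurable hQ s
  have hΦA : Measurable fun y : (ℕ → ℝ × ℝ) × (Sym2 ℕ → ℝ) => A.indicator 1 y.1 * Φ y :=
    ((measurable_one.indicator hA).comp measurable_fst).mul hΦ
  have hmap := (indepFun_iff_map_prod_eq_prod_map_map hp.aemeasurable hz.aemeasurable).1
    hG.indep_points
  have e1 : ∫⁻ ω in indexEvent p Q s, Φ (fun i => p i ω, fun e => ζ e ω) ∂P =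
      ∫⁻ ω, A.indicator 1 (fun i => p i ω) * Φ (fun i => p i ω, fun e => ζ e ω) ∂P := by
    rw [← lintegral_indicator hms]
    refine lintegral_congr fun ω => ?_
    by_cases h : ω ∈ indexEvent p Q s
    · have h' : (fun i => p i ω) ∈ A := h
      simp [h, h']
    · have h' : (fun i => p i ω) ∉ A := h
      simp [h, h']
  have e2 : ∫⁻ ω, A.indicator 1 (fun i => p i ω) * Φ (fun i => p i ω, fun e => ζ e ω) ∂P =
      ∫⁻ y, A.indicator 1 y.1 * Φ y ∂(P.map fun ω => ((fun i => p i ω), (fun e => ζ e ω))) :=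
    (lintegral_map hΦA (hp.prodMk hz)).symm
  rw [e1, e2, hmap, lintegral_prod _ hΦA.aemeasurable, lintegral_map hΦA.lintegral_prod_right' hp,
    ← lintegral_indicator hms]
  refine lintegral_congr fun ω => ?_
  have hΦω : Measurable fun y => A.indicator 1 (fun i => p i ω) * Φ (fun i => p i ω, y) :=
    hΦA.comp measurable_prodMk_left
  rw [lintegral_map hΦω hz]
  by_cases h : ω ∈ indexEvent p Q s
  · have h' : (fun i => p i ω) ∈ A := h
    simp [h, h']
  · have h' : (fun i => p i ω) ∉ A := h
    simp [h, h']

end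

/-! ### Degree generating functions in a set of finite area -/

section

lemma Measurable.const_pow_nat {A : Type*} [MeasurableSpace A] {f : A → ℕ} (hf : Measurable f)
    (T : ℝ≥0∞) : Measurable fun a => T ^ f a :=
  (measurable_from_nat (f := fun n => T ^ n)).comp hf

open Classical in
/-- The indices of the points of `p` that lie in `Q` (if there are finitely many). -/
def boxIndex (p : ℕ → Ω → ℝ × ℝ) (Q : Set (ℝ × ℝ)) (ω : Ω) : Finset ℕ :=
  if h : {i | p i ω ∈ Q}.Finite then h.toFinset else ∅

lemma boxIndex_eq {p : ℕ → Ω → ℝ × ℝ} {Q : Set (ℝ × ℝ)} {F : Finset ℕ} {ω : Ω}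
    (h : ω ∈ indexEvent p Q F) : boxIndex p Q ω = F := by
  have hF : {i | p i ω ∈ Q} = F := by ext i; exact h i
  have hfin : {i | p i ω ∈ Q}.Finite := by rw [hF]; exact F.finite_toSet
  rw [boxIndex, dif_pos hfin]
  ext i
  simpa using h i

lemma disjoint_indexEvent (p : ℕ → Ω → ℝ × ℝ) (Q : Set (ℝ × ℝ)) :
    Pairwise (Function.onFun Disjoint fun F : Finset ℕ => indexEvent p Q F) := by
  intro F F' h
  refine Set.disjoint_left.2 fun ω h1 h2 => h ?_
  rw [← boxIndex_eq h1, boxIndex_eq h2]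

/-- With the constant functional 1 the series formula gives total mass `exp (-|Q|) * exp |Q| = 1` to
the disjoint events that the index set is a given finite set. So almost surely only finitely many
points lie in `Q`, and the default value of `boxIndex` plays no role. -/
lemma ae_mem_indexEvent {P : Measure Ω} [IsProbabilityMeasure P] {p : ℕ → Ω → ℝ × ℝ}
    (hP : IsUnitRatePoissonProcess P p) {Q : Set (ℝ × ℝ)} (hQm : MeasurableSet Q)
    (hQ : Q ⊆ Ici (0 : ℝ) ×ˢ Ici (0 : ℝ)) (hQf : volume Q < ∞) :
    ∀ᵐ ω ∂P, ω ∈ indexEvent p Q (boxIndex p Q ω) := by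
  have h := tsum_lintegral_indexEvent hP hQm hQ hQf (Ψ := fun _ _ => 1) (H := fun _ _ => 1)
    (fun _ => measurable_const) (fun _ _ _ => rfl)
  simp only [lintegral_const, one_mul, Measure.restrict_apply_univ, Measure.pi_univ,
    Finset.prod_const, Finset.card_univ, Fintype.card_fin] at h
  rw [← ENNReal.ofReal_toReal hQf.ne, ofReal_exp_mul_tsum ENNReal.toReal_nonneg,
    ENNReal.toReal_ofReal ENNReal.toReal_nonneg, sub_self, Real.exp_zero, ENNReal.ofReal_one] at h
  rw [← measure_iUnion (disjoint_indexEvent p Q)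
    fun F => measurableSet_indexEvent hP.measurable hQm _] at h
  have hm : MeasurableSet (⋃ F : Finset ℕ, indexEvent p Q F) :=
    MeasurableSet.iUnion fun F => measurableSet_indexEvent hP.measurable hQm _
  have := (prob_compl_eq_zero_iff hm).2 h
  filter_upwards [mem_ae_iff.2 this] with ω hω
  obtain ⟨F, hF⟩ := mem_iUnion.1 hω
  rwa [boxIndex_eq hF]

lemma lintegral_boxIndex {P : Measure Ω} [IsProbabilityMeasure P] {p : ℕ → Ω → ℝ × ℝ}
    (hP : IsUnitRatePoissonProcess P p) {Q : Set (ℝ × ℝ)} (hQm : MeasurableSet Q)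
    (hQ : Q ⊆ Ici (0 : ℝ) ×ˢ Ici (0 : ℝ)) (hQf : volume Q < ∞) (Ψ : Finset ℕ → Ω → ℝ≥0∞) :
    ∫⁻ ω, Ψ (boxIndex p Q ω) ω ∂P = ∑' F : Finset ℕ, ∫⁻ ω in indexEvent p Q F, Ψ F ω ∂P := by
  have hms := fun F : Finset ℕ => measurableSet_indexEvent hP.measurable hQm (F : Set ℕ)
  have h1 : ∀ F : Finset ℕ, ∫⁻ ω in indexEvent p Q F, Ψ F ω ∂P =
      ∫⁻ ω in indexEvent p Q F, Ψ (boxIndex p Q ω) ω ∂P := fun F =>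
    setLIntegral_congr_fun (hms F) fun ω hω => by rw [boxIndex_eq hω]
  simp_rw [h1]
  rw [← lintegral_iUnion hms (disjoint_indexEvent p Q), Measure.restrict_eq_self_of_ae_mem]
  filter_upwards [ae_mem_indexEvent hP hQm hQ hQf] with ω hω
  exact mem_iUnion.2 ⟨_, hω⟩

lemma measurableSet_boxIndex_eq {p : ℕ → Ω → ℝ × ℝ} (hp : ∀ i, Measurable (p i))
    {Q : Set (ℝ × ℝ)} (hQ : MeasurableSet Q) (F : Finset ℕ) :
    MeasurableSet {ω | boxIndex p Q ω = F} := by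
  have hms := fun F : Finset ℕ => measurableSet_indexEvent hp hQ (F : Set ℕ)
  -- The default value sends every infinite configuration to `∅`, which adds the complementary event
  -- in that one case.
  have hemp : {ω | boxIndex p Q ω = F} = indexEvent p Q F ∪
      (if F = ∅ then (⋃ F' : Finset ℕ, indexEvent p Q F')ᶜ else ∅) := by
    ext ω
    by_cases hfin : {i | p i ω ∈ Q}.Finite
    · have h1 : ω ∈ indexEvent p Q hfin.toFinset := fun i => by simp
      have h2 : ω ∈ ⋃ F' : Finset ℕ, indexEvent p Q F' := mem_iUnion.2 ⟨_, h1⟩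
      have h3 : ω ∉ (if F = ∅ then (⋃ F' : Finset ℕ, indexEvent p Q F')ᶜ else ∅) := by
        split_ifs
        · exact fun h => h h2
        · exact fun h => h
      simp only [mem_ofPred_eq, mem_union, h3, or_false]
      constructor
      · intro h
        rw [← h, boxIndex_eq h1]
        exact h1
      · exact boxIndex_eq
    · have h1 : ∀ F' : Finset ℕ, ω ∉ indexEvent p Q F' := fun F' h => hfin (by
        have : {i | p i ω ∈ Q} = F' := by ext i; exact h i
        rw [this]; exact F'.finite_toSet)
      have h2 : boxIndex p Q ω = ∅ := by rw [boxIndex, dif_neg hfin]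
      simp only [mem_ofPred_eq, mem_union, h1, false_or, h2]
      by_cases hF : F = ∅
      · simp [hF, h1]
      · simp [hF, Ne.symm hF]
  rw [hemp]
  refine (hms F).union ?_
  split_ifs
  · exact (MeasurableSet.iUnion hms).compl
  · exact MeasurableSet.empty

lemma measurable_boxIndex {p : ℕ → Ω → ℝ × ℝ} (hp : ∀ i, Measurable (p i))
    {Q : Set (ℝ × ℝ)} (hQ : MeasurableSet Q) {β : Type*} [MeasurableSpace β]
    {Ψ : Finset ℕ → Ω → β} (hΨ : ∀ F, Measurable (Ψ F)) :
    Measurable fun ω => Ψ (boxIndex p Q ω) ω := by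
  intro s hs
  have : (fun ω => Ψ (boxIndex p Q ω) ω) ⁻¹' s =
      ⋃ F : Finset ℕ, {ω | boxIndex p Q ω = F} ∩ Ψ F ⁻¹' s := by
    ext ω; simp
  rw [this]
  exact MeasurableSet.iUnion fun F => (measurableSet_boxIndex_eq hp hQ F).inter (hΨ F hs)

/-- The number of non-loop edges between the point `i` and the other points in `Q`. -/
def boxDegree (W : ℝ → ℝ → ℝ) (p : ℕ → Ω → ℝ × ℝ) (ζ : Sym2 ℕ → Ω → ℝ) (Q : Set (ℝ × ℝ))
    (ω : Ω) (i : ℕ) : ℕ :=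
  edgeDegree W (fun i => p i ω) (fun e => ζ e ω) (boxIndex p Q ω) i

variable {P : Measure Ω} [IsProbabilityMeasure P] {p : ℕ → Ω → ℝ × ℝ} {ζ : Sym2 ℕ → Ω → ℝ}
  {W : ℝ → ℝ → ℝ} {Q : Set (ℝ × ℝ)}

lemma IsKEGSource.measurable_pair (hG : IsKEGSource P p ζ) :
    Measurable fun ω => ((fun i => p i ω, fun e => ζ e ω) : (ℕ → ℝ × ℝ) × (Sym2 ℕ → ℝ)) :=
  (measurable_pi_lambda _ hG.poisson.measurable).prodMk (measurable_pi_lambda _ hG.measurable)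

lemma IsEdgeKernel.integrable_snd (hW : IsEdgeKernel W) (hQf : volume Q < ∞) (x : ℝ) :
    Integrable (fun y : ℝ × ℝ => W x y.2) (volume.restrict Q) := by
  have : IsFiniteMeasure (volume.restrict Q) := ⟨by simpa using hQf⟩
  refine Integrable.of_bound (C := 1) ?_ (ae_of_all _ fun y => ?_)
  · exact (hW.measurable.of_uncurry_comp measurable_const measurable_snd).aestronglyMeasurable
  · rw [Real.norm_of_nonneg (hW.nonneg _ _)]; exact hW.le_one _ _

lemma IsEdgeKernel.integrable_mul_snd (hW : IsEdgeKernel W) (hQf : volume Q < ∞) (x x' : ℝ) :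
    Integrable (fun y : ℝ × ℝ => W x y.2 * W x' y.2) (volume.restrict Q) := by
  have : IsFiniteMeasure (volume.restrict Q) := ⟨by simpa using hQf⟩
  refine Integrable.of_bound (C := 1) ?_ (ae_of_all _ fun y => ?_)
  · exact ((hW.measurable.of_uncurry_comp measurable_const measurable_snd).mul
      (hW.measurable.of_uncurry_comp measurable_const measurable_snd)).aestronglyMeasurable
  · rw [Real.norm_of_nonneg (mul_nonneg (hW.nonneg _ _) (hW.nonneg _ _))]
    exact mul_le_one₀ (hW.le_one _ _) (hW.nonneg _ _) (hW.le_one _ _)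

lemma IsKEGSource.measurable_edgeDegree (hG : IsKEGSource P p ζ) (hW : IsEdgeKernel W)
    (x : ℕ → ℝ × ℝ) (F : Finset ℕ) (i : ℕ) :
    Measurable fun ω => edgeDegree W x (fun e => ζ e ω) F i := by
  have h : Measurable fun ω => (x, fun e => ζ e ω) :=
    measurable_const.prodMk (measurable_pi_lambda _ hG.measurable)
  exact (_root_.measurable_edgeDegree hW F i).comp h

/-- Given the points, `τ ^ D_i` has mean `∏ (1 - (1 - τ) W)` over the other points, and the Mecke
formula turns this into an exponential of `-(1 - τ) ∫ W`. No bound `τ ≤ 1` is imposed: values above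
1 supply exponential moments. -/
lemma lintegral_sum_pow_boxDegree (hG : IsKEGSource P p ζ) (hW : IsEdgeKernel W)
    (hQm : MeasurableSet Q) (hQ : Q ⊆ Ici (0 : ℝ) ×ˢ Ici (0 : ℝ)) (hQf : volume Q < ∞)
    {α : ℝ × ℝ → ℝ≥0∞} (hα : Measurable α) {τ : ℝ} (hτ : 0 ≤ τ) :
    ∫⁻ ω, ∑ i ∈ boxIndex p Q ω, α (p i ω) * ENNReal.ofReal (τ ^ boxDegree W p ζ Q ω i) ∂P =
      ∫⁻ q in Q, α q * ENNReal.ofReal (Real.exp (-((1 - τ) * ∫ y in Q, W q.2 y.2))) := by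
  have hmeas : ∀ (F : Finset ℕ) (i : ℕ), Measurable fun y : (ℕ → ℝ × ℝ) × (Sym2 ℕ → ℝ) =>
      α (y.1 i) * ENNReal.ofReal τ ^ edgeDegree W y.1 y.2 F i := fun F i =>
    (hα.comp (by fun_prop)).mul ((measurable_edgeDegree hW F i).const_pow_nat _)
  have hmf : ∀ (F : Finset ℕ), ∀ i ∈ F, Measurable fun ω =>
      α (p i ω) * ∏ k ∈ F.erase i, edgeFactor (ENNReal.ofReal τ) (W (p i ω).2 (p k ω).2) :=
    fun F i _ => by
      have hp := hG.poisson.measurable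
      refine (hα.comp (hp i)).mul (Finset.measurable_prod _ fun k _ => ?_)
      exact (measurable_edgeFactor _).comp (hW.measurable.of_uncurry_comp
        (measurable_snd.comp (hp i)) (measurable_snd.comp (hp k)))
  simp_rw [ENNReal.ofReal_pow hτ]
  have h1 := lintegral_boxIndex hG.poisson hQm hQ hQf fun F ω => ∑ i ∈ F, α (p i ω) *
    ENNReal.ofReal τ ^ edgeDegree W (fun i => p i ω) (fun e => ζ e ω) F i
  refine h1.trans ?_
  have h2 : ∀ F : Finset ℕ, ∫⁻ ω in indexEvent p Q F, ∑ i ∈ F, α (p i ω) *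
      ENNReal.ofReal τ ^ edgeDegree W (fun i => p i ω) (fun e => ζ e ω) F i ∂P =
      ∫⁻ ω in indexEvent p Q F, ∑ i ∈ F, α (p i ω) *
        ∏ k ∈ F.erase i, edgeFactor (ENNReal.ofReal τ) (W (p i ω).2 (p k ω).2) ∂P := by
    intro F
    have hmeas' : ∀ i, Measurable fun ω => α (p i ω) *
        ENNReal.ofReal τ ^ edgeDegree W (fun i => p i ω) (fun e => ζ e ω) F i := fun i =>
      (hmeas F i).comp hG.measurable_pair
    rw [lintegral_finsetSum _ fun i _ => hmeas' i,
      lintegral_finsetSum' _ fun i hi => (hmf F i hi).aemeasurable]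
    refine Finset.sum_congr rfl fun i hi => ?_
    refine (lintegral_indep_points hG hQm F (hmeas F i)).trans (lintegral_congr fun ω => ?_)
    simp only
    rw [lintegral_const_mul _ ((hG.measurable_edgeDegree hW _ F i).const_pow_nat _),
      lintegral_pow_edgeDegree hG.measurable hG.uniform hG.indep hW]
  simp_rw [h2]
  rw [mecke_one hG.poisson hQm hQ hQf hα
    (g := fun q y => edgeFactor (ENNReal.ofReal τ) (W q.2 y.2))
    (G := fun q => ∫ y in Q, (1 - (1 - τ) * W q.2 y.2))]
  · refine lintegral_congr fun q => ?_
    congr 3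
    have : IsFiniteMeasure (volume.restrict Q) := ⟨by simpa using hQf⟩
    rw [integral_sub (integrable_const _) ((hW.integrable_snd hQf _).const_mul _),
      integral_const_mul]
    simp [Measure.real]
  · exact (measurable_edgeFactor _).comp (hW.measurable.of_uncurry_comp
      (by fun_prop) (by fun_prop))
  · exact fun q _ => integral_nonneg fun y => by
      have h1 := hW.nonneg q.2 y.2; have h2 := hW.le_one q.2 y.2
      simp only [Pi.zero_apply]; nlinarith
  · intro q _
    have : IsFiniteMeasure (volume.restrict Q) := ⟨by simpa using hQf⟩
    have hI : Integrable (fun y : ℝ × ℝ => 1 - (1 - τ) * W q.2 y.2) (volume.restrict Q) :=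
      (integrable_const _).sub ((hW.integrable_snd hQf _).const_mul _)
    rw [ofReal_integral_eq_lintegral_ofReal hI]
    · exact lintegral_congr fun y => edgeFactor_ofReal hτ (hW.nonneg _ _) (hW.le_one _ _)
    · exact ae_of_all _ fun y => by
        have h1 := hW.nonneg q.2 y.2; have h2 := hW.le_one q.2 y.2
        simp only [Pi.zero_apply]; nlinarith

/-- A third point `y` contributes `(1 - (1 - τ) W(q, y)) (1 - (1 - τ') W(q', y))`. Its cross term
becomes the overlap integral in the exponent, which is the only dependence through common
neighbours; the prefactor is the possible edge between the two points. -/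
lemma lintegral_sum_sum_pow_boxDegree (hG : IsKEGSource P p ζ) (hW : IsEdgeKernel W)
    (hQm : MeasurableSet Q) (hQ : Q ⊆ Ici (0 : ℝ) ×ˢ Ici (0 : ℝ)) (hQf : volume Q < ∞)
    {α : ℝ × ℝ → ℝ × ℝ → ℝ≥0∞} (hα : Measurable (Function.uncurry α)) {τ τ' : ℝ}
    (hτ : 0 ≤ τ) (hτ' : 0 ≤ τ') :
    ∫⁻ ω, ∑ i ∈ boxIndex p Q ω, ∑ j ∈ (boxIndex p Q ω).erase i, α (p i ω) (p j ω) *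
        ENNReal.ofReal (τ ^ boxDegree W p ζ Q ω i * τ' ^ boxDegree W p ζ Q ω j) ∂P =
      ∫⁻ q in Q, ∫⁻ q' in Q, α q q' * ENNReal.ofReal ((1 - (1 - τ * τ') * W q.2 q'.2) *
        Real.exp (-((1 - τ) * (∫ y in Q, W q.2 y.2) + (1 - τ') * (∫ y in Q, W q'.2 y.2) -
          (1 - τ) * (1 - τ') * ∫ y in Q, W q.2 y.2 * W q'.2 y.2))) := by
  set T := ENNReal.ofReal τ
  set T' := ENNReal.ofReal τ'
  have hmeas : ∀ (F : Finset ℕ) (i j : ℕ), Measurable fun y : (ℕ → ℝ × ℝ) × (Sym2 ℕ → ℝ) =>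
      α (y.1 i) (y.1 j) * (T ^ edgeDegree W y.1 y.2 F i * T' ^ edgeDegree W y.1 y.2 F j) :=
    fun F i j => (hα.of_uncurry_comp (by fun_prop) (by fun_prop)).mul
      (((measurable_edgeDegree hW F i).const_pow_nat _).mul
        ((measurable_edgeDegree hW F j).const_pow_nat _))
  have hmf : ∀ (F : Finset ℕ) (i j : ℕ), Measurable fun ω =>
      α (p i ω) (p j ω) * (edgeFactor (T * T') (W (p i ω).2 (p j ω).2) *
        ∏ k ∈ (F.erase i).erase j, (edgeFactor T (W (p i ω).2 (p k ω).2) *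
          edgeFactor T' (W (p j ω).2 (p k ω).2))) :=
    fun F i j => by
      have hp := hG.poisson.measurable
      have hw : ∀ i k, Measurable fun ω => W (p i ω).2 (p k ω).2 := fun i k =>
        hW.measurable.of_uncurry_comp (measurable_snd.comp (hp i)) (measurable_snd.comp (hp k))
      refine (hα.of_uncurry_comp (hp i) (hp j)).mul (((measurable_edgeFactor _).comp (hw i j)).mul
        (Finset.measurable_prod _ fun k _ => ?_))
      exact ((measurable_edgeFactor _).comp (hw i k)).mul ((measurable_edgeFactor _).comp (hw j k))
  simp_rw [ENNReal.ofReal_mul (pow_nonneg hτ _), ENNReal.ofReal_pow hτ, ENNReal.ofReal_pow hτ']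
  have h1 := lintegral_boxIndex hG.poisson hQm hQ hQf fun F ω => ∑ i ∈ F, ∑ j ∈ F.erase i,
    α (p i ω) (p j ω) * (T ^ edgeDegree W (fun i => p i ω) (fun e => ζ e ω) F i *
      T' ^ edgeDegree W (fun i => p i ω) (fun e => ζ e ω) F j)
  refine h1.trans ?_
  have h2 : ∀ F : Finset ℕ, ∫⁻ ω in indexEvent p Q F, ∑ i ∈ F, ∑ j ∈ F.erase i,
    α (p i ω) (p j ω) * (T ^ edgeDegree W (fun i => p i ω) (fun e => ζ e ω) F i *
      T' ^ edgeDegree W (fun i => p i ω) (fun e => ζ e ω) F j) ∂P =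
      ∫⁻ ω in indexEvent p Q F, ∑ i ∈ F, ∑ j ∈ F.erase i,
        (α (p i ω) (p j ω) * edgeFactor (T * T') (W (p i ω).2 (p j ω).2)) *
        ∏ k ∈ (F.erase i).erase j, (edgeFactor T (W (p i ω).2 (p k ω).2) *
          edgeFactor T' (W (p j ω).2 (p k ω).2)) ∂P := by
    intro F
    have hmeas' : ∀ i j, Measurable fun ω => α (p i ω) (p j ω) *
        (T ^ edgeDegree W (fun i => p i ω) (fun e => ζ e ω) F i *
          T' ^ edgeDegree W (fun i => p i ω) (fun e => ζ e ω) F j) := fun i j =>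
      (hmeas F i j).comp hG.measurable_pair
    simp_rw [mul_assoc (α _ _)]
    rw [lintegral_finsetSum _ fun i _ => Finset.measurable_sum _ fun j _ => hmeas' i j,
      lintegral_finsetSum _ fun i _ => Finset.measurable_sum _ fun j _ => hmf F i j]
    refine Finset.sum_congr rfl fun i hi => ?_
    rw [lintegral_finsetSum _ fun j _ => hmeas' i j,
      lintegral_finsetSum _ fun j _ => hmf F i j]
    refine Finset.sum_congr rfl fun j hj => ?_
    refine (lintegral_indep_points hG hQm F (hmeas F i j)).trans (lintegral_congr fun ω => ?_)
    simp only
    have hm' : Measurable fun ω' => T ^ edgeDegree W (fun i => p i ω) (fun e => ζ e ω') F i *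
        T' ^ edgeDegree W (fun i => p i ω) (fun e => ζ e ω') F j :=
      ((hG.measurable_edgeDegree hW _ F i).const_pow_nat _).mul
        ((hG.measurable_edgeDegree hW _ F j).const_pow_nat _)
    rw [lintegral_const_mul _ hm', lintegral_pow_edgeDegree_mul hG.measurable hG.uniform
      hG.indep hW _ (Finset.ne_of_mem_erase hj) hi (Finset.mem_of_mem_erase hj)]
  simp_rw [h2]
  have hW01 : ∀ {t x y}, 0 ≤ t → 0 ≤ 1 - (1 - t) * W x y := fun {t x y} ht => by
    have h1 := hW.nonneg x y; have h2 := hW.le_one x y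
    nlinarith
  have hint : ∀ q q' : ℝ × ℝ, Integrable (fun y : ℝ × ℝ => (1 - τ) * W q.2 y.2 +
      (1 - τ') * W q'.2 y.2 - (1 - τ) * (1 - τ') * (W q.2 y.2 * W q'.2 y.2))
      (volume.restrict Q) := fun q q' =>
    (((hW.integrable_snd hQf _).const_mul _).add ((hW.integrable_snd hQf _).const_mul _)).sub
      ((hW.integrable_mul_snd hQf _ _).const_mul _)
  have : IsFiniteMeasure (volume.restrict Q) := ⟨by simpa using hQf⟩
  rw [mecke_two hG.poisson hQm hQ hQf
    (α := fun q q' => α q q' * edgeFactor (T * T') (W q.2 q'.2))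
    (g := fun z y => edgeFactor T (W z.1.2 y.2) * edgeFactor T' (W z.2.2 y.2))
    (G := fun q q' => ∫ y in Q, (1 - ((1 - τ) * W q.2 y.2 +
      (1 - τ') * W q'.2 y.2 - (1 - τ) * (1 - τ') * (W q.2 y.2 * W q'.2 y.2))))]
  · refine lintegral_congr fun q => lintegral_congr fun q' => ?_
    rw [← ENNReal.ofReal_mul hτ, edgeFactor_ofReal (mul_nonneg hτ hτ') (hW.nonneg _ _)
      (hW.le_one _ _), ENNReal.ofReal_mul (hW01 (mul_nonneg hτ hτ')), mul_assoc]
    congr 4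
    have hadd : Integrable (fun y : ℝ × ℝ => (1 - τ) * W q.2 y.2 + (1 - τ') * W q'.2 y.2)
        (volume.restrict Q) :=
      ((hW.integrable_snd hQf _).const_mul _).add ((hW.integrable_snd hQf _).const_mul _)
    rw [integral_sub (integrable_const _) (hint q q'), integral_sub hadd
      ((hW.integrable_mul_snd hQf _ _).const_mul _), integral_add
      ((hW.integrable_snd hQf _).const_mul _) ((hW.integrable_snd hQf _).const_mul _)]
    simp [Measure.real, integral_const_mul]
  · exact (hα.of_uncurry_comp measurable_fst measurable_snd).mul
      ((measurable_edgeFactor _).comp (hW.measurable.of_uncurry_comp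
      (by fun_prop) (by fun_prop)))
  · exact ((measurable_edgeFactor _).comp (hW.measurable.of_uncurry_comp
      (by fun_prop) (by fun_prop))).mul ((measurable_edgeFactor _).comp
      (hW.measurable.of_uncurry_comp (by fun_prop) (by fun_prop)))
  · exact fun q _ q' _ => integral_nonneg fun y => by
      have h := mul_nonneg (hW01 (x := q.2) (y := y.2) hτ) (hW01 (x := q'.2) (y := y.2) hτ')
      simp only [Pi.zero_apply]; nlinarith
  · intro q _ q' _
    have hI : Integrable (fun y : ℝ × ℝ => 1 - ((1 - τ) * W q.2 y.2 +
        (1 - τ') * W q'.2 y.2 - (1 - τ) * (1 - τ') * (W q.2 y.2 * W q'.2 y.2)))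
        (volume.restrict Q) := (integrable_const _).sub (hint q q')
    rw [ofReal_integral_eq_lintegral_ofReal hI]
    · refine lintegral_congr fun y => ?_
      rw [edgeFactor_ofReal hτ (hW.nonneg _ _) (hW.le_one _ _), edgeFactor_ofReal hτ' (hW.nonneg _ _)
        (hW.le_one _ _), ← ENNReal.ofReal_mul (hW01 hτ)]
      congr 1; ring
    · exact ae_of_all _ fun y => by
        have h := mul_nonneg (hW01 (x := q.2) (y := y.2) hτ) (hW01 (x := q'.2) (y := y.2) hτ')
        simp only [Pi.zero_apply]; nlinarith

end

/-! ### Moments of degree sums in a box -/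

section

/-- The box `[0,ν] × [0,M]`. -/
def box (ν M : ℝ) : Set (ℝ × ℝ) := Icc 0 ν ×ˢ Icc 0 M

/-- The marginal of `W` restricted to `[0,M]`. -/
def truncMarginal (W : ℝ → ℝ → ℝ) (M x : ℝ) : ℝ := ∫ y in Icc 0 M, W x y

/-- The overlap of two rows of `W` on `[0,M]`. -/
def truncOverlap (W : ℝ → ℝ → ℝ) (M x x' : ℝ) : ℝ := ∫ y in Icc 0 M, W x y * W x' y

lemma measurableSet_box (ν M : ℝ) : MeasurableSet (box ν M) :=
  measurableSet_Icc.prod measurableSet_Icc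

lemma box_subset (ν M : ℝ) : box ν M ⊆ Ici (0 : ℝ) ×ˢ Ici (0 : ℝ) := fun _ hq =>
  ⟨hq.1.1, hq.2.1⟩

lemma restrict_box (ν M : ℝ) : (volume : Measure (ℝ × ℝ)).restrict (box ν M) =
    (volume.restrict (Icc 0 ν)).prod (volume.restrict (Icc 0 M)) := by
  rw [Measure.prod_restrict]; rfl

lemma volume_box_lt_top (ν M : ℝ) : volume (box ν M) < ∞ := by
  rw [box, Measure.volume_eq_prod, Measure.prod_prod, Real.volume_Icc, Real.volume_Icc]
  exact ENNReal.mul_lt_top ENNReal.ofReal_lt_top ENNReal.ofReal_lt_top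

lemma integral_box_snd {ν M : ℝ} (hν : 0 ≤ ν) (f : ℝ → ℝ) :
    ∫ y in box ν M, f y.2 = ν * ∫ y in Icc 0 M, f y := by
  rw [restrict_box, integral_fun_snd]
  simp [hν, Measure.real]

lemma lintegral_box_snd {ν M : ℝ} {f : ℝ → ℝ≥0∞} (hf : Measurable f) :
    ∫⁻ y in box ν M, f y.2 = ENNReal.ofReal ν * ∫⁻ y in Icc 0 M, f y := by
  have hm : Measurable fun y : ℝ × ℝ => f y.2 := hf.comp measurable_snd
  rw [restrict_box, lintegral_prod _ hm.aemeasurable]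
  simp [mul_comm]

variable {P : Measure Ω} [IsProbabilityMeasure P] {p : ℕ → Ω → ℝ × ℝ} {ζ : Sym2 ℕ → Ω → ℝ}
  {W : ℝ → ℝ → ℝ}

lemma IsEdgeKernel.measurable_truncMarginal (hW : IsEdgeKernel W) (M : ℝ) :
    Measurable (truncMarginal W M) :=
  (hW.measurable.stronglyMeasurable.integral_prod_right).measurable

lemma IsEdgeKernel.measurable_truncOverlap (hW : IsEdgeKernel W) (M : ℝ) :
    Measurable (Function.uncurry (truncOverlap W M)) := by
  have : Measurable fun z : (ℝ × ℝ) × ℝ => W z.1.1 z.2 * W z.1.2 z.2 :=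
    (hW.measurable.of_uncurry_comp (by fun_prop) (by fun_prop)).mul
      (hW.measurable.of_uncurry_comp (by fun_prop) (by fun_prop))
  exact (this.stronglyMeasurable.integral_prod_right (f := fun (x : ℝ × ℝ) y =>
    W x.1 y * W x.2 y)).measurable

lemma truncMarginal_nonneg (hW : IsEdgeKernel W) (M x : ℝ) : 0 ≤ truncMarginal W M x :=
  integral_nonneg fun _ => hW.nonneg _ _

lemma truncOverlap_nonneg (hW : IsEdgeKernel W) (M x x' : ℝ) : 0 ≤ truncOverlap W M x x' :=
  integral_nonneg fun _ => mul_nonneg (hW.nonneg _ _) (hW.nonneg _ _)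

lemma IsEdgeKernel.integrableOn_Icc (hW : IsEdgeKernel W) (M x : ℝ) :
    IntegrableOn (W x) (Icc 0 M) := by
  refine Integrable.of_bound (C := 1) ?_ (ae_of_all _ fun y => ?_)
  · exact (hW.measurable.of_uncurry_comp measurable_const measurable_id).aestronglyMeasurable
  · rw [Real.norm_of_nonneg (hW.nonneg _ _)]; exact hW.le_one _ _

lemma IsEdgeKernel.integrableOn_mul_Icc (hW : IsEdgeKernel W) (M x x' : ℝ) :
    IntegrableOn (fun y => W x y * W x' y) (Icc 0 M) := by
  refine Integrable.of_bound (C := 1) ?_ (ae_of_all _ fun y => ?_)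
  · exact ((hW.measurable.of_uncurry_comp measurable_const measurable_id).mul
      (hW.measurable.of_uncurry_comp measurable_const measurable_id)).aestronglyMeasurable
  · rw [Real.norm_of_nonneg (mul_nonneg (hW.nonneg _ _) (hW.nonneg _ _))]
    exact mul_le_one₀ (hW.le_one _ _) (hW.nonneg _ _) (hW.le_one _ _)

lemma truncMarginal_le (hW : IsEdgeKernel W) {M : ℝ} (hM : 0 ≤ M) (x : ℝ) :
    truncMarginal W M x ≤ M := by
  have := integral_mono (hW.integrableOn_Icc M x)
    (integrable_const (μ := volume.restrict (Icc 0 M)) (1 : ℝ)) fun _ => hW.le_one _ _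
  simpa [truncMarginal, Measure.real, hM] using this

lemma truncOverlap_le_left (hW : IsEdgeKernel W) (M x x' : ℝ) :
    truncOverlap W M x x' ≤ truncMarginal W M x :=
  integral_mono (hW.integrableOn_mul_Icc M x x') (hW.integrableOn_Icc M x) fun _ =>
    mul_le_of_le_one_right (hW.nonneg _ _) (hW.le_one _ _)

lemma truncOverlap_le_right (hW : IsEdgeKernel W) (M x x' : ℝ) :
    truncOverlap W M x x' ≤ truncMarginal W M x' :=
  integral_mono (hW.integrableOn_mul_Icc M x x') (hW.integrableOn_Icc M x') fun _ =>
    mul_le_of_le_one_left (hW.nonneg _ _) (hW.le_one _ _)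

/-- The sum of `f (x_i) (D_i)` over the points in the box. -/
def boxSum (W : ℝ → ℝ → ℝ) (p : ℕ → Ω → ℝ × ℝ) (ζ : Sym2 ℕ → Ω → ℝ) (ν M : ℝ)
    (f : ℝ → ℕ → ℝ) (ω : Ω) : ℝ :=
  ∑ i ∈ boxIndex p (box ν M) ω, f (p i ω).2 (boxDegree W p ζ (box ν M) ω i)

lemma measurable_boxSum (hG : IsKEGSource P p ζ) (hW : IsEdgeKernel W) (ν M : ℝ)
    {f : ℝ → ℕ → ℝ} (hf : ∀ n, Measurable fun x => f x n) :
    Measurable (boxSum W p ζ ν M f) := by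
  have hf' : Measurable (Function.uncurry f) := measurable_from_prod_countable_left hf
  refine measurable_boxIndex hG.poisson.measurable (measurableSet_box ν M)
    (Ψ := fun F ω => ∑ i ∈ F, f (p i ω).2
      (edgeDegree W (fun i => p i ω) (fun e => ζ e ω) F i)) fun F => ?_
  exact Finset.measurable_sum _ fun i _ => hf'.of_uncurry_comp
    (measurable_snd.comp (hG.poisson.measurable i))
    ((measurable_edgeDegree hW F i).comp hG.measurable_pair)

lemma integral_eq_of_lintegral_eq {A B : Type*} [MeasurableSpace A] [MeasurableSpace B]
    {μ : Measure A} {m : Measure B} {Y : A → ℝ} (hY : Measurable Y) (hY0 : ∀ a, 0 ≤ Y a)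
    {h : B → ℝ} (hh : Integrable h m) (hh0 : 0 ≤ᵐ[m] h) {c : ℝ} (hc : 0 ≤ c)
    (he : ∫⁻ a, ENNReal.ofReal (Y a) ∂μ = ENNReal.ofReal c * ∫⁻ b, ENNReal.ofReal (h b) ∂m) :
    Integrable Y μ ∧ ∫ a, Y a ∂μ = c * ∫ b, h b ∂m := by
  rw [← ofReal_integral_eq_lintegral_ofReal hh hh0, ← ENNReal.ofReal_mul hc] at he
  refine ⟨(lintegral_ofReal_ne_top_iff_integrable hY.aestronglyMeasurable
    (ae_of_all _ hY0)).1 (by rw [he]; exact ENNReal.ofReal_ne_top), ?_⟩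
  rw [integral_eq_lintegral_of_nonneg_ae (ae_of_all _ hY0) hY.aestronglyMeasurable, he,
    ENNReal.toReal_ofReal (mul_nonneg hc (integral_nonneg_of_ae hh0))]

lemma integrableOn_exp_truncMarginal (hW : IsEdgeKernel W) {M : ℝ} (hM : 0 ≤ M)
    {S : Set ℝ} (hSM : S ⊆ Icc 0 M) (a : ℝ) :
    IntegrableOn (fun x => Real.exp (a * truncMarginal W M x)) S := by
  have : IsFiniteMeasure (volume.restrict S) :=
    ⟨by simpa using (measure_mono hSM).trans_lt (by simp)⟩
  refine Integrable.of_bound (C := Real.exp (|a| * M)) ?_ (ae_of_all _ fun x => ?_)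
  · exact (Real.measurable_exp.comp
      ((hW.measurable_truncMarginal M).const_mul a)).aestronglyMeasurable
  · rw [Real.norm_of_nonneg (Real.exp_pos _).le, Real.exp_le_exp]
    calc a * truncMarginal W M x ≤ |a| * truncMarginal W M x :=
          mul_le_mul_of_nonneg_right (le_abs_self a) (truncMarginal_nonneg hW M x)
      _ ≤ _ := mul_le_mul_of_nonneg_left (truncMarginal_le hW hM x) (abs_nonneg a)

/-- The first moment formula. -/
lemma integral_boxSum_pow (hG : IsKEGSource P p ζ) (hW : IsEdgeKernel W) {ν M : ℝ} (hν : 0 ≤ ν)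
    (hM : 0 ≤ M) {S : Set ℝ} (hS : MeasurableSet S) (hSM : S ⊆ Icc 0 M) {τ : ℝ} (hτ : 0 ≤ τ) :
    Integrable (boxSum W p ζ ν M fun x n => S.indicator 1 x * τ ^ n) P ∧
    ∫ ω, boxSum W p ζ ν M (fun x n => S.indicator 1 x * τ ^ n) ω ∂P =
      ν * ∫ x in S, Real.exp (-((1 - τ) * (ν * truncMarginal W M x))) := by
  have hind : ∀ x, 0 ≤ S.indicator (1 : ℝ → ℝ) x := fun x => indicator_nonneg (by simp) x
  refine integral_eq_of_lintegral_eq (measurable_boxSum hG hW ν M fun n =>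
    (measurable_one.indicator hS).mul_const _)
    (fun ω => Finset.sum_nonneg fun i _ => mul_nonneg (hind _) (pow_nonneg hτ _)) ?_
    (ae_of_all _ fun x => (Real.exp_pos _).le) hν ?_
  · have := integrableOn_exp_truncMarginal hW hM hSM (-((1 - τ) * ν))
    refine this.congr (ae_of_all _ fun x => ?_)
    simp only; congr 1; ring
  · have h := lintegral_sum_pow_boxDegree hG hW (measurableSet_box ν M) (box_subset ν M)
      (volume_box_lt_top ν M) (α := fun q => S.indicator 1 q.2)
      ((measurable_one.indicator hS).comp measurable_snd) hτ
    have hl : ∀ ω, ENNReal.ofReal (boxSum W p ζ ν M (fun x n => S.indicator 1 x * τ ^ n) ω) =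
        ∑ i ∈ boxIndex p (box ν M) ω, S.indicator 1 (p i ω).2 *
          ENNReal.ofReal (τ ^ boxDegree W p ζ (box ν M) ω i) := by
      intro ω
      rw [boxSum, ENNReal.ofReal_sum_of_nonneg fun i _ => mul_nonneg (hind _) (pow_nonneg hτ _)]
      refine Finset.sum_congr rfl fun i _ => ?_
      rw [ENNReal.ofReal_mul (hind _)]
      congr 1
      by_cases hx : (p i ω).2 ∈ S <;> simp [hx]
    simp_rw [hl, h, integral_box_snd hν]
    have hm : Measurable fun x => S.indicator 1 x *
        ENNReal.ofReal (Real.exp (-((1 - τ) * (ν * truncMarginal W M x)))) := by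
      have := hW.measurable_truncMarginal M
      exact (measurable_one.indicator hS).mul (by fun_prop)
    have h2 := lintegral_box_snd (ν := ν) (M := M) hm
    refine h2.trans ?_
    congr 1
    have h3 : ∀ x, S.indicator 1 x *
        ENNReal.ofReal (Real.exp (-((1 - τ) * (ν * truncMarginal W M x)))) =
        S.indicator (fun x => ENNReal.ofReal
          (Real.exp (-((1 - τ) * (ν * truncMarginal W M x))))) x := fun x => by
      by_cases hx : x ∈ S <;> simp [hx]
    simp_rw [h3]
    rw [lintegral_indicator hS, Measure.restrict_restrict hS, inter_eq_self_of_subset_left hSM]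

/-- The sum of `f (x_i) (D_i) g (x_j) (D_j)` over pairs of distinct points in the box. -/
def boxPairSum (W : ℝ → ℝ → ℝ) (p : ℕ → Ω → ℝ × ℝ) (ζ : Sym2 ℕ → Ω → ℝ) (ν M : ℝ)
    (f g : ℝ → ℕ → ℝ) (ω : Ω) : ℝ :=
  ∑ i ∈ boxIndex p (box ν M) ω, ∑ j ∈ (boxIndex p (box ν M) ω).erase i,
    f (p i ω).2 (boxDegree W p ζ (box ν M) ω i) * g (p j ω).2 (boxDegree W p ζ (box ν M) ω j)

lemma measurable_boxPairSum (hG : IsKEGSource P p ζ) (hW : IsEdgeKernel W) (ν M : ℝ)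
    {f g : ℝ → ℕ → ℝ} (hf : ∀ n, Measurable fun x => f x n) (hg : ∀ n, Measurable fun x => g x n) :
    Measurable (boxPairSum W p ζ ν M f g) := by
  have hf' : Measurable (Function.uncurry f) := measurable_from_prod_countable_left hf
  have hg' : Measurable (Function.uncurry g) := measurable_from_prod_countable_left hg
  refine measurable_boxIndex hG.poisson.measurable (measurableSet_box ν M)
    (Ψ := fun F ω => ∑ i ∈ F, ∑ j ∈ F.erase i, f (p i ω).2
      (edgeDegree W (fun i => p i ω) (fun e => ζ e ω) F i) * g (p j ω).2
      (edgeDegree W (fun i => p i ω) (fun e => ζ e ω) F j)) fun F => ?_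
  exact Finset.measurable_sum _ fun i _ => Finset.measurable_sum _ fun j _ =>
    (hf'.of_uncurry_comp (measurable_snd.comp (hG.poisson.measurable i))
      ((measurable_edgeDegree hW F i).comp hG.measurable_pair)).mul
    (hg'.of_uncurry_comp (measurable_snd.comp (hG.poisson.measurable j))
      ((measurable_edgeDegree hW F j).comp hG.measurable_pair))

/-- The density of the second factorial moment of the degree generating functions. -/
def pairDensity (W : ℝ → ℝ → ℝ) (ν M τ τ' : ℝ) (z : ℝ × ℝ) : ℝ :=
  (1 - (1 - τ * τ') * W z.1 z.2) *
    Real.exp (-((1 - τ) * (ν * truncMarginal W M z.1) + (1 - τ') * (ν * truncMarginal W M z.2) -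
      (1 - τ) * (1 - τ') * (ν * truncOverlap W M z.1 z.2)))

lemma measurable_pairDensity (hW : IsEdgeKernel W) (ν M τ τ' : ℝ) :
    Measurable (pairDensity W ν M τ τ') := by
  have h1 := hW.measurable_truncMarginal M
  have h2 : Measurable fun z : ℝ × ℝ => truncOverlap W M z.1 z.2 := hW.measurable_truncOverlap M
  have h3 : Measurable fun z : ℝ × ℝ => W z.1 z.2 := hW.measurable
  unfold pairDensity
  fun_prop

lemma pairDensity_nonneg (hW : IsEdgeKernel W) (ν M : ℝ) {τ τ' : ℝ} (hτ : 0 ≤ τ) (hτ' : 0 ≤ τ')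
    (z : ℝ × ℝ) : 0 ≤ pairDensity W ν M τ τ' z := by
  refine mul_nonneg ?_ (Real.exp_pos _).le
  have h1 := hW.nonneg z.1 z.2; have h2 := hW.le_one z.1 z.2
  nlinarith [mul_nonneg hτ hτ']

/-- The overlap is at most the marginal, so the positive term in the exponent is absorbed by a
single negative one. -/
lemma pairDensity_le_one (hW : IsEdgeKernel W) {ν M : ℝ} (hν : 0 ≤ ν) {τ τ' : ℝ}
    (hτ' : 0 ≤ τ') (hτ1 : τ ≤ 1) (hτ1' : τ' ≤ 1) (z : ℝ × ℝ) :
    pairDensity W ν M τ τ' z ≤ 1 := by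
  have h1 := hW.nonneg z.1 z.2
  have hττ : τ * τ' ≤ 1 := mul_le_one₀ hτ1 hτ' hτ1'
  refine mul_le_one₀ ?_ (Real.exp_pos _).le (Real.exp_le_one_iff.2 ?_)
  · nlinarith
  · have h3 := truncOverlap_le_left hW M z.1 z.2
    have h4 := truncMarginal_nonneg hW M z.2
    have h5 := truncOverlap_nonneg hW M z.1 z.2
    have h6 := truncMarginal_nonneg hW M z.1
    have h7 : (1 - τ) * (1 - τ') * (ν * truncOverlap W M z.1 z.2) ≤
        (1 - τ) * (ν * truncMarginal W M z.1) := by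
      have : (1 - τ) * (1 - τ') ≤ 1 - τ := by nlinarith
      calc _ ≤ (1 - τ) * (ν * truncOverlap W M z.1 z.2) :=
            mul_le_mul_of_nonneg_right this (by positivity)
        _ ≤ _ := mul_le_mul_of_nonneg_left (mul_le_mul_of_nonneg_left h3 hν) (by linarith)
    have h8 : 0 ≤ (1 - τ') * (ν * truncMarginal W M z.2) :=
      mul_nonneg (by linarith) (by positivity)
    linarith

lemma integrableOn_pairDensity (hW : IsEdgeKernel W) {ν M : ℝ} (hν : 0 ≤ ν) {τ τ' : ℝ}
    (hτ : 0 ≤ τ) (hτ' : 0 ≤ τ') (hτ1 : τ ≤ 1) (hτ1' : τ' ≤ 1) {S : Set ℝ} (hSM : S ⊆ Icc 0 M) :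
    IntegrableOn (pairDensity W ν M τ τ') (S ×ˢ S) := by
  have : IsFiniteMeasure (volume.restrict (S ×ˢ S)) :=
    ⟨by simpa using (measure_mono (prod_mono hSM hSM)).trans_lt (volume_box_lt_top M M)⟩
  refine Integrable.of_bound (C := 1) (measurable_pairDensity hW ν M τ τ').aestronglyMeasurable
    (ae_of_all _ fun z => ?_)
  rw [Real.norm_of_nonneg (pairDensity_nonneg hW ν M hτ hτ' z)]
  exact pairDensity_le_one hW hν hτ' hτ1 hτ1' z

/-- The second moment formula. -/
lemma integral_boxPairSum_pow (hG : IsKEGSource P p ζ) (hW : IsEdgeKernel W) {ν M : ℝ}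
    (hν : 0 ≤ ν) {S : Set ℝ} (hS : MeasurableSet S) (hSM : S ⊆ Icc 0 M)
    {τ τ' : ℝ} (hτ : 0 ≤ τ) (hτ' : 0 ≤ τ') (hτ1 : τ ≤ 1) (hτ1' : τ' ≤ 1) :
    Integrable (boxPairSum W p ζ ν M (fun x n => S.indicator 1 x * τ ^ n)
      fun x n => S.indicator 1 x * τ' ^ n) P ∧
    ∫ ω, boxPairSum W p ζ ν M (fun x n => S.indicator 1 x * τ ^ n)
      (fun x n => S.indicator 1 x * τ' ^ n) ω ∂P =
      ν ^ 2 * ∫ z in S ×ˢ S, pairDensity W ν M τ τ' z := by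
  have hind : ∀ x, 0 ≤ S.indicator (1 : ℝ → ℝ) x := fun x => indicator_nonneg (by simp) x
  have hterm : ∀ ω i j, 0 ≤ (S.indicator (1 : ℝ → ℝ) (p i ω).2 *
      τ ^ boxDegree W p ζ (box ν M) ω i) * (S.indicator (1 : ℝ → ℝ) (p j ω).2 *
      τ' ^ boxDegree W p ζ (box ν M) ω j) := fun ω i j =>
    mul_nonneg (mul_nonneg (hind _) (pow_nonneg hτ _)) (mul_nonneg (hind _) (pow_nonneg hτ' _))
  refine integral_eq_of_lintegral_eq (measurable_boxPairSum hG hW ν M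
    (fun n => (measurable_one.indicator hS).mul_const _)
    (fun n => (measurable_one.indicator hS).mul_const _))
    (fun ω => Finset.sum_nonneg fun i _ => Finset.sum_nonneg fun j _ => hterm ω i j)
    (integrableOn_pairDensity hW hν hτ hτ' hτ1 hτ1' hSM)
    (ae_of_all _ fun z => pairDensity_nonneg hW ν M hτ hτ' z) (by positivity) ?_
  have hα : Measurable (Function.uncurry fun q q' : ℝ × ℝ =>
      (S.indicator (1 : ℝ → ℝ≥0∞) q.2 * S.indicator (1 : ℝ → ℝ≥0∞) q'.2)) :=
    ((measurable_one.indicator hS).comp (measurable_snd.comp measurable_fst)).mul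
      ((measurable_one.indicator hS).comp (measurable_snd.comp measurable_snd))
  have h := lintegral_sum_sum_pow_boxDegree hG hW (measurableSet_box ν M) (box_subset ν M)
    (volume_box_lt_top ν M) hα hτ hτ'
  have hoi : ∀ x, ENNReal.ofReal (S.indicator (1 : ℝ → ℝ) x) = S.indicator (1 : ℝ → ℝ≥0∞) x :=
    fun x => by by_cases hx : x ∈ S <;> simp [hx]
  have hl : ∀ ω, ENNReal.ofReal (boxPairSum W p ζ ν M (fun x n => S.indicator 1 x * τ ^ n)
      (fun x n => S.indicator 1 x * τ' ^ n) ω) =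
      ∑ i ∈ boxIndex p (box ν M) ω, ∑ j ∈ (boxIndex p (box ν M) ω).erase i,
        S.indicator 1 (p i ω).2 * S.indicator 1 (p j ω).2 *
        ENNReal.ofReal (τ ^ boxDegree W p ζ (box ν M) ω i *
          τ' ^ boxDegree W p ζ (box ν M) ω j) := by
    intro ω
    rw [boxPairSum, ENNReal.ofReal_sum_of_nonneg fun i _ => Finset.sum_nonneg fun j _ =>
      hterm ω i j]
    refine Finset.sum_congr rfl fun i _ => ?_
    rw [ENNReal.ofReal_sum_of_nonneg fun j _ => hterm ω i j]
    refine Finset.sum_congr rfl fun j _ => ?_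
    rw [mul_mul_mul_comm, ENNReal.ofReal_mul (mul_nonneg (hind _) (hind _)),
      ENNReal.ofReal_mul (hind _), hoi, hoi]
  have h4 : ∀ x, ∫ y in box ν M, W x y.2 = ν * truncMarginal W M x := fun x =>
    integral_box_snd hν (W x)
  have h5 : ∀ x x', ∫ y in box ν M, W x y.2 * W x' y.2 = ν * truncOverlap W M x x' :=
    fun x x' => integral_box_snd hν fun y => W x y * W x' y
  simp_rw [hl, h, h4, h5]
  have hm : Measurable fun z : ℝ × ℝ => S.indicator 1 z.1 * S.indicator 1 z.2 *
      ENNReal.ofReal (pairDensity W ν M τ τ' z) :=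
    (((measurable_one.indicator hS).comp measurable_fst).mul
      ((measurable_one.indicator hS).comp measurable_snd)).mul
      (measurable_pairDensity hW ν M τ τ').ennreal_ofReal
  have e1 : ∀ q : ℝ × ℝ, ∫⁻ q' in box ν M, S.indicator 1 q.2 * S.indicator 1 q'.2 *
      ENNReal.ofReal (pairDensity W ν M τ τ' (q.2, q'.2)) = ENNReal.ofReal ν *
      ∫⁻ x' in Icc 0 M, S.indicator 1 q.2 * S.indicator 1 x' *
        ENNReal.ofReal (pairDensity W ν M τ τ' (q.2, x')) := fun q =>
    lintegral_box_snd (f := fun x' => S.indicator 1 q.2 * S.indicator 1 x' *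
        ENNReal.ofReal (pairDensity W ν M τ τ' (q.2, x'))) (hm.comp measurable_prodMk_left)
  refine (lintegral_congr e1).trans ?_
  have hm2 : Measurable fun x => ENNReal.ofReal ν *
      ∫⁻ x' in Icc 0 M, S.indicator 1 x * S.indicator 1 x' *
        ENNReal.ofReal (pairDensity W ν M τ τ' (x, x')) :=
    (hm.lintegral_prod_right').const_mul _
  rw [lintegral_box_snd hm2, lintegral_const_mul _ hm.lintegral_prod_right', ← mul_assoc,
    ← ENNReal.ofReal_mul hν, ← sq]
  congr 1
  have hp := lintegral_prod (μ := volume.restrict (Icc 0 M)) (ν := volume.restrict (Icc 0 M)) _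
    hm.aemeasurable
  rw [← hp, Measure.prod_restrict, ← Measure.volume_eq_prod]
  have h3 : ∀ z : ℝ × ℝ, S.indicator 1 z.1 * S.indicator 1 z.2 *
      ENNReal.ofReal (pairDensity W ν M τ τ' z) =
      (S ×ˢ S).indicator (fun z => ENNReal.ofReal (pairDensity W ν M τ τ' z)) z := fun z => by
    by_cases hx : z.1 ∈ S <;> by_cases hx' : z.2 ∈ S <;> simp [hx, hx']
  simp_rw [h3]
  rw [lintegral_indicator (hS.prod hS), Measure.restrict_restrict (hS.prod hS),
    inter_eq_self_of_subset_left (prod_mono hSM hSM)]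

end

/-! ### Variance of discounted sums -/

section

variable {P : Measure Ω} [IsProbabilityMeasure P] {p : ℕ → Ω → ℝ × ℝ} {ζ : Sym2 ℕ → Ω → ℝ}
  {W : ℝ → ℝ → ℝ}

/-- The weight `1_S(x) (1 - s ^ n)`. -/
def discount (S : Set ℝ) (s x : ℝ) (n : ℕ) : ℝ := S.indicator 1 x * (1 - s ^ n)

lemma indicator_one_nonneg (S : Set ℝ) (x : ℝ) : 0 ≤ S.indicator (1 : ℝ → ℝ) x :=
  indicator_nonneg (by simp) x

lemma indicator_one_le_one (S : Set ℝ) (x : ℝ) : S.indicator (1 : ℝ → ℝ) x ≤ 1 :=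
  indicator_le_self' (by simp) x

lemma discount_nonneg (S : Set ℝ) {s : ℝ} (hs : 0 ≤ s) (hs1 : s ≤ 1) (x : ℝ) (n : ℕ) :
    0 ≤ discount S s x n :=
  mul_nonneg (indicator_one_nonneg S x) (sub_nonneg.2 (pow_le_one₀ hs hs1))

lemma discount_le_one (S : Set ℝ) {s : ℝ} (hs : 0 ≤ s) (hs1 : s ≤ 1) (x : ℝ) (n : ℕ) :
    discount S s x n ≤ 1 :=
  mul_le_one₀ (indicator_one_le_one S x) (sub_nonneg.2 (pow_le_one₀ hs hs1))
    (sub_le_self _ (pow_nonneg hs n))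

/-- The generating function at 1 minus the one at `s`. All moments of discounts come from such
combinations, and a point of degree 0 contributes nothing, which keeps the sums of order `νB`
however large the box is. -/
lemma boxSum_discount (W : ℝ → ℝ → ℝ) (p : ℕ → Ω → ℝ × ℝ) (ζ : Sym2 ℕ → Ω → ℝ) (ν M : ℝ)
    (S : Set ℝ) (s : ℝ) (ω : Ω) : boxSum W p ζ ν M (discount S s) ω =
      boxSum W p ζ ν M (fun x n => S.indicator 1 x * 1 ^ n) ω -
        boxSum W p ζ ν M (fun x n => S.indicator 1 x * s ^ n) ω := by
  simp only [boxSum, discount, ← Finset.sum_sub_distrib]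
  exact Finset.sum_congr rfl fun i _ => by ring

lemma boxPairSum_discount (W : ℝ → ℝ → ℝ) (p : ℕ → Ω → ℝ × ℝ) (ζ : Sym2 ℕ → Ω → ℝ) (ν M : ℝ)
    (S : Set ℝ) (s : ℝ) (ω : Ω) : boxPairSum W p ζ ν M (discount S s) (discount S s) ω =
      boxPairSum W p ζ ν M (fun x n => S.indicator 1 x * 1 ^ n)
        (fun x n => S.indicator 1 x * 1 ^ n) ω -
      boxPairSum W p ζ ν M (fun x n => S.indicator 1 x * 1 ^ n)
        (fun x n => S.indicator 1 x * s ^ n) ω -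
      boxPairSum W p ζ ν M (fun x n => S.indicator 1 x * s ^ n)
        (fun x n => S.indicator 1 x * 1 ^ n) ω +
      boxPairSum W p ζ ν M (fun x n => S.indicator 1 x * s ^ n)
        (fun x n => S.indicator 1 x * s ^ n) ω := by
  simp only [boxPairSum, discount, ← Finset.sum_sub_distrib, ← Finset.sum_add_distrib]
  exact Finset.sum_congr rfl fun i _ => Finset.sum_congr rfl fun j _ => by ring

/-- The diagonal part of the square is at most the sum itself, because discounts lie in `[0,1]`. -/
lemma sq_boxSum_discount_le (W : ℝ → ℝ → ℝ) (p : ℕ → Ω → ℝ × ℝ) (ζ : Sym2 ℕ → Ω → ℝ) (ν M : ℝ)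
    (S : Set ℝ) {s : ℝ} (hs : 0 ≤ s) (hs1 : s ≤ 1) (ω : Ω) :
    boxSum W p ζ ν M (discount S s) ω ^ 2 ≤ boxSum W p ζ ν M (discount S s) ω +
      boxPairSum W p ζ ν M (discount S s) (discount S s) ω := by
  rw [sq, boxSum, boxPairSum, Finset.sum_mul_sum, ← Finset.sum_add_distrib]
  refine Finset.sum_le_sum fun i hi => ?_
  rw [← Finset.add_sum_erase _ _ hi]
  have h0 := discount_nonneg S hs hs1 (p i ω).2 (boxDegree W p ζ (box ν M) ω i)
  have h1 := discount_le_one S hs hs1 (p i ω).2 (boxDegree W p ζ (box ν M) ω i)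
  gcongr
  nlinarith

/-- The mean of the discounted sums. -/
def discountMean (W : ℝ → ℝ → ℝ) (ν M : ℝ) (S : Set ℝ) (s : ℝ) : ℝ :=
  ∫ x in S, (1 - Real.exp (-((1 - s) * (ν * truncMarginal W M x))))

lemma integral_boxSum_discount (hG : IsKEGSource P p ζ) (hW : IsEdgeKernel W) {ν M : ℝ}
    (hν : 0 ≤ ν) (hM : 0 ≤ M) {S : Set ℝ} (hS : MeasurableSet S) (hSM : S ⊆ Icc 0 M) {s : ℝ}
    (hs : 0 ≤ s) :
    Integrable (boxSum W p ζ ν M (discount S s)) P ∧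
    ∫ ω, boxSum W p ζ ν M (discount S s) ω ∂P = ν * discountMean W ν M S s := by
  have h1 := integral_boxSum_pow hG hW hν hM hS hSM zero_le_one
  have h2 := integral_boxSum_pow hG hW hν hM hS hSM hs
  rw [funext (boxSum_discount W p ζ ν M S s)]
  refine ⟨h1.1.sub h2.1, ?_⟩
  rw [integral_sub h1.1 h2.1, h1.2, h2.2, ← mul_sub, discountMean]
  have e1 := integrableOn_exp_truncMarginal hW hM hSM (-((1 - 1) * ν))
  have e2 := integrableOn_exp_truncMarginal hW hM hSM (-((1 - s) * ν))
  simp only [neg_mul, mul_assoc] at e1 e2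
  rw [← integral_sub e1 e2]
  simp

/-- From `e^κ - 1 ≤ κ e^κ` and `κ ≤ (a + b) / 2`. Half of the decay survives in each variable, so
the bound integrates as a product. -/
lemma exp_mul_exp_sub_one_le {a b κ : ℝ} (h0 : 0 ≤ κ) (ha : κ ≤ a) (hb : κ ≤ b) :
    Real.exp (-a - b) * (Real.exp κ - 1) ≤ κ * Real.exp (-(a / 2)) * Real.exp (-(b / 2)) := by
  have h1 : Real.exp κ - 1 ≤ κ * Real.exp κ := by
    have := Real.add_one_le_exp (-κ)
    have h2 : Real.exp (-κ) * Real.exp κ = 1 := by rw [← Real.exp_add]; simp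
    nlinarith [Real.exp_pos κ]
  calc Real.exp (-a - b) * (Real.exp κ - 1) ≤ Real.exp (-a - b) * (κ * Real.exp κ) :=
        mul_le_mul_of_nonneg_left h1 (Real.exp_pos _).le
    _ = κ * Real.exp (-a - b + κ) := by rw [Real.exp_add]; ring
    _ ≤ κ * Real.exp (-(a / 2) + -(b / 2)) :=
        mul_le_mul_of_nonneg_left (Real.exp_le_exp.2 (by linarith)) h0
    _ = _ := by rw [Real.exp_add]; ring

/-- Equivalent to `a / 2 ≤ sinh (a / 2)`. It converts the halved decay back into the integrand of
`degreeMass`. -/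
lemma mul_exp_neg_half_le {a : ℝ} (ha : 0 ≤ a) :
    a * Real.exp (-(a / 2)) ≤ 1 - Real.exp (-a) := by
  have h : a ≤ Real.exp (a / 2) - Real.exp (-(a / 2)) := by
    have := Real.self_le_sinh_iff.2 (show 0 ≤ a / 2 by linarith)
    rw [Real.sinh_eq] at this
    linarith
  calc a * Real.exp (-(a / 2)) ≤
        (Real.exp (a / 2) - Real.exp (-(a / 2))) * Real.exp (-(a / 2)) :=
        mul_le_mul_of_nonneg_right h (Real.exp_pos _).le
    _ = _ := by
        rw [sub_mul, ← Real.exp_add, ← Real.exp_add]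
        congr 1
        · simp
        · congr 1; ring

/-- The correlation term of two points due to their common neighbours. -/
def correlation (W : ℝ → ℝ → ℝ) (ν M s : ℝ) (z : ℝ × ℝ) : ℝ :=
  Real.exp (-((1 - s) * (ν * truncMarginal W M z.1)) - (1 - s) * (ν * truncMarginal W M z.2)) *
    (Real.exp ((1 - s) ^ 2 * (ν * truncOverlap W M z.1 z.2)) - 1)

/-- Without edge between the two points and without common neighbours the combination factorises
into the product of the two mean discounts. The two mixed terms lose at most `W` each from the
possible edge, the last term loses nothing, and the overlap exponent `κ` produces the correlation.
-/
lemma pairDensity_combination_le (hW : IsEdgeKernel W) (ν M : ℝ) {s : ℝ} (hs : 0 ≤ s)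
    (hs1 : s ≤ 1) (hν : 0 ≤ ν) (z : ℝ × ℝ) :
    pairDensity W ν M 1 1 z - pairDensity W ν M 1 s z - pairDensity W ν M s 1 z +
      pairDensity W ν M s s z ≤
    (1 - Real.exp (-((1 - s) * (ν * truncMarginal W M z.1)))) *
      (1 - Real.exp (-((1 - s) * (ν * truncMarginal W M z.2)))) + 2 * W z.1 z.2 +
      correlation W ν M s z := by
  simp only [pairDensity, correlation]
  set a := (1 - s) * (ν * truncMarginal W M z.1) with ha
  set b := (1 - s) * (ν * truncMarginal W M z.2) with hb
  set w := W z.1 z.2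
  have hw0 : 0 ≤ w := hW.nonneg _ _
  have ha0 : 0 ≤ a := mul_nonneg (by linarith) (mul_nonneg hν (truncMarginal_nonneg hW _ _))
  have hb0 : 0 ≤ b := mul_nonneg (by linarith) (mul_nonneg hν (truncMarginal_nonneg hW _ _))
  set κ := (1 - s) ^ 2 * (ν * truncOverlap W M z.1 z.2) with hκ
  have e1 : (1 - 1) * (ν * truncMarginal W M z.1) + (1 - 1) * (ν * truncMarginal W M z.2) -
      (1 - 1) * (1 - 1) * (ν * truncOverlap W M z.1 z.2) = 0 := by ring
  have e2 : (1 - 1) * (ν * truncMarginal W M z.1) + b -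
      (1 - 1) * (1 - s) * (ν * truncOverlap W M z.1 z.2) = b := by ring
  have e3 : a + (1 - 1) * (ν * truncMarginal W M z.2) -
      (1 - s) * (1 - 1) * (ν * truncOverlap W M z.1 z.2) = a := by ring
  have e4 : -(a + b - (1 - s) * (1 - s) * (ν * truncOverlap W M z.1 z.2)) = (-a - b) + κ := by
    rw [hκ]; ring
  rw [e1, e2, e3, e4, Real.exp_add (-a - b) κ]
  have hsub : Real.exp (-a - b) = Real.exp (-a) * Real.exp (-b) := by
    rw [← Real.exp_add]; congr 1
  have h1 : Real.exp (-a) ≤ 1 := Real.exp_le_one_iff.2 (by linarith)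
  have h2 : Real.exp (-b) ≤ 1 := Real.exp_le_one_iff.2 (by linarith)
  have h3 : (1 - (1 - s * s) * w) * (Real.exp (-a - b) * Real.exp κ) ≤
      Real.exp (-a - b) * Real.exp κ := by
    have : 0 ≤ (1 - s * s) * w := mul_nonneg (by nlinarith) hw0
    have h4 : 0 ≤ Real.exp (-a - b) * Real.exp κ := by positivity
    nlinarith
  have h5 : (1 - s) * w * Real.exp (-a) ≤ w := by
    have := mul_le_mul (show (1 - s) * w ≤ w by nlinarith) h1 (Real.exp_pos _).le hw0
    linarith
  have h6 : (1 - s) * w * Real.exp (-b) ≤ w := by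
    have := mul_le_mul (show (1 - s) * w ≤ w by nlinarith) h2 (Real.exp_pos _).le hw0
    linarith
  simp only [neg_zero, Real.exp_zero, mul_one, one_mul, sub_self, zero_mul, sub_zero]
  rw [hsub] at h3 ⊢
  nlinarith

lemma measurable_correlation (hW : IsEdgeKernel W) (ν M s : ℝ) :
    Measurable (correlation W ν M s) := by
  have h1 := hW.measurable_truncMarginal M
  have h2 : Measurable fun z : ℝ × ℝ => truncOverlap W M z.1 z.2 := hW.measurable_truncOverlap M
  unfold correlation
  fun_prop

lemma overlap_le_left (hW : IsEdgeKernel W) {ν M s : ℝ} (hν : 0 ≤ ν) (hs : 0 ≤ s) (hs1 : s ≤ 1)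
    (x x' : ℝ) : (1 - s) ^ 2 * (ν * truncOverlap W M x x') ≤
      (1 - s) * (ν * truncMarginal W M x) := by
  have h := mul_le_mul_of_nonneg_left (truncOverlap_le_left hW M x x') hν
  have h0 := mul_nonneg hν (truncOverlap_nonneg hW M x x')
  calc (1 - s) ^ 2 * (ν * truncOverlap W M x x') ≤ (1 - s) * (ν * truncOverlap W M x x') :=
        mul_le_mul_of_nonneg_right (by nlinarith) h0
    _ ≤ _ := mul_le_mul_of_nonneg_left h (by linarith)

lemma overlap_le_right (hW : IsEdgeKernel W) {ν M s : ℝ} (hν : 0 ≤ ν) (hs : 0 ≤ s) (hs1 : s ≤ 1)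
    (x x' : ℝ) : (1 - s) ^ 2 * (ν * truncOverlap W M x x') ≤
      (1 - s) * (ν * truncMarginal W M x') := by
  have h := mul_le_mul_of_nonneg_left (truncOverlap_le_right hW M x x') hν
  have h0 := mul_nonneg hν (truncOverlap_nonneg hW M x x')
  calc (1 - s) ^ 2 * (ν * truncOverlap W M x x') ≤ (1 - s) * (ν * truncOverlap W M x x') :=
        mul_le_mul_of_nonneg_right (by nlinarith) h0
    _ ≤ _ := mul_le_mul_of_nonneg_left h (by linarith)

lemma correlation_nonneg (hW : IsEdgeKernel W) {ν M s : ℝ} (hν : 0 ≤ ν) (z : ℝ × ℝ) :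
    0 ≤ correlation W ν M s z := by
  refine mul_nonneg (Real.exp_pos _).le (sub_nonneg.2 (Real.one_le_exp_iff.2 ?_))
  exact mul_nonneg (sq_nonneg _) (mul_nonneg hν (truncOverlap_nonneg hW M _ _))

lemma correlation_le_one (hW : IsEdgeKernel W) {ν M s : ℝ} (hν : 0 ≤ ν) (hs : 0 ≤ s)
    (hs1 : s ≤ 1) (z : ℝ × ℝ) : correlation W ν M s z ≤ 1 := by
  have h1 := overlap_le_left (M := M) hW hν hs hs1 z.1 z.2
  have h2 : 0 ≤ (1 - s) * (ν * truncMarginal W M z.2) :=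
    mul_nonneg (by linarith) (mul_nonneg hν (truncMarginal_nonneg hW _ _))
  rw [correlation, mul_sub, ← Real.exp_add, mul_one]
  have : Real.exp (-((1 - s) * (ν * truncMarginal W M z.1)) -
      (1 - s) * (ν * truncMarginal W M z.2) +
      (1 - s) ^ 2 * (ν * truncOverlap W M z.1 z.2)) ≤ 1 := Real.exp_le_one_iff.2 (by linarith)
  linarith [Real.exp_pos (-((1 - s) * (ν * truncMarginal W M z.1)) -
      (1 - s) * (ν * truncMarginal W M z.2))]

/-- Separates the two points except for the overlap, which is the quantity controlled by the
hypothesis on `W`. -/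
lemma correlation_le (hW : IsEdgeKernel W) {ν M s : ℝ} (hν : 0 ≤ ν) (hs : 0 ≤ s)
    (hs1 : s ≤ 1) (z : ℝ × ℝ) : correlation W ν M s z ≤
      (1 - s) ^ 2 * (ν * truncOverlap W M z.1 z.2) *
        Real.exp (-((1 - s) * (ν * truncMarginal W M z.1) / 2)) *
        Real.exp (-((1 - s) * (ν * truncMarginal W M z.2) / 2)) :=
  exp_mul_exp_sub_one_le
    (mul_nonneg (sq_nonneg _) (mul_nonneg hν (truncOverlap_nonneg hW M _ _)))
    (overlap_le_left hW hν hs hs1 _ _) (overlap_le_right hW hν hs hs1 _ _)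

lemma integral_sub_sub_add {α : Type*} [MeasurableSpace α] {m : Measure α} {f g h k : α → ℝ}
    (hf : Integrable f m) (hg : Integrable g m) (hh : Integrable h m) (hk : Integrable k m) :
    Integrable (fun x => f x - g x - h x + k x) m ∧ ∫ x, (f x - g x - h x + k x) ∂m =
      ∫ x, f x ∂m - ∫ x, g x ∂m - ∫ x, h x ∂m + ∫ x, k x ∂m := by
  have i1 : Integrable (fun x => f x - g x) m := hf.sub hg
  have i2 : Integrable (fun x => f x - g x - h x) m := i1.sub hh
  exact ⟨i2.add hk, by rw [integral_add i2 hk, integral_sub i1 hh, integral_sub hf hg]⟩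

/-- A variance bound for discounted sums. -/
lemma variance_boxSum_discount_le (hG : IsKEGSource P p ζ) (hW : IsEdgeKernel W) {ν M : ℝ}
    (hν : 0 ≤ ν) (hM : 0 ≤ M) {S : Set ℝ} (hS : MeasurableSet S) (hSM : S ⊆ Icc 0 M) {s : ℝ}
    (hs : 0 ≤ s) (hs1 : s ≤ 1) :
    Integrable (fun ω => (boxSum W p ζ ν M (discount S s) ω - ν * discountMean W ν M S s) ^ 2) P ∧
    ∫ ω, (boxSum W p ζ ν M (discount S s) ω - ν * discountMean W ν M S s) ^ 2 ∂P ≤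
      ν * discountMean W ν M S s +
        ν ^ 2 * ∫ z in S ×ˢ S, (2 * W z.1 z.2 + correlation W ν M s z) := by
  obtain ⟨hXi, hXe⟩ := integral_boxSum_discount hG hW hν hM hS hSM hs
  set X := boxSum W p ζ ν M (discount S s)
  set m := ν * discountMean W ν M S s with hm
  set Z := boxPairSum W p ζ ν M (discount S s) (discount S s)
  obtain ⟨i11, v11⟩ := integral_boxPairSum_pow hG hW hν hS hSM zero_le_one zero_le_one le_rfl le_rfl
  obtain ⟨i1s, v1s⟩ := integral_boxPairSum_pow hG hW hν hS hSM zero_le_one hs le_rfl hs1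
  obtain ⟨is1, vs1⟩ := integral_boxPairSum_pow hG hW hν hS hSM hs zero_le_one hs1 le_rfl
  obtain ⟨iss, vss⟩ := integral_boxPairSum_pow hG hW hν hS hSM hs hs hs1 hs1
  have j11 := integrableOn_pairDensity hW hν zero_le_one zero_le_one le_rfl le_rfl hSM
  have j1s := integrableOn_pairDensity hW hν zero_le_one hs le_rfl hs1 hSM
  have js1 := integrableOn_pairDensity hW hν hs zero_le_one hs1 le_rfl hSM
  have jss := integrableOn_pairDensity hW hν hs hs hs1 hs1 hSM
  have hZ : Z = fun ω => _ := funext (boxPairSum_discount W p ζ ν M S s)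
  have hZ4 := integral_sub_sub_add i11 i1s is1 iss
  have hJ4 := integral_sub_sub_add j11 j1s js1 jss
  have hZi : Integrable Z P := by
    rw [hZ]; exact hZ4.1
  have hZe : ∫ ω, Z ω ∂P = ν ^ 2 * ∫ z in S ×ˢ S, (pairDensity W ν M 1 1 z -
      pairDensity W ν M 1 s z - pairDensity W ν M s 1 z + pairDensity W ν M s s z) := by
    rw [hJ4.2, hZ]
    refine hZ4.2.trans ?_
    rw [v11, v1s, vs1, vss]
    ring
  have hX2i : Integrable (fun ω => X ω ^ 2) P := by
    refine (hXi.add hZi).mono' (hXi.aestronglyMeasurable.pow 2) (ae_of_all _ fun ω => ?_)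
    rw [Real.norm_of_nonneg (sq_nonneg _)]
    exact sq_boxSum_discount_le W p ζ ν M S hs hs1 ω
  have hexp : (fun ω => (X ω - m) ^ 2) = fun ω => X ω ^ 2 - 2 * m * X ω + m ^ 2 := by
    funext ω; ring
  have hi1 : Integrable (fun ω => X ω ^ 2 - 2 * m * X ω) P := hX2i.sub (hXi.const_mul _)
  rw [hexp]
  refine ⟨hi1.add (integrable_const _), ?_⟩
  rw [integral_add hi1 (integrable_const _), integral_sub hX2i (hXi.const_mul _),
    integral_const_mul, hXe]
  have hX2 : ∫ ω, X ω ^ 2 ∂P ≤ m + ∫ ω, Z ω ∂P := by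
    rw [← hXe, ← integral_add hXi hZi]
    exact integral_mono hX2i (hXi.add hZi) (sq_boxSum_discount_le W p ζ ν M S hs hs1)
  have hfin : IsFiniteMeasure (volume.restrict (S ×ˢ S)) :=
    ⟨by simpa using (measure_mono (prod_mono hSM hSM)).trans_lt (volume_box_lt_top M M)⟩
  have kW : IntegrableOn (fun z : ℝ × ℝ => 2 * W z.1 z.2) (S ×ˢ S) := by
    refine Integrable.const_mul (Integrable.of_bound (C := 1) ?_ (ae_of_all _ fun z => ?_)) 2
    · exact (show Measurable fun z : ℝ × ℝ => W z.1 z.2 from hW.measurable).aestronglyMeasurable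
    · rw [Real.norm_of_nonneg (hW.nonneg _ _)]; exact hW.le_one _ _
  have kC : IntegrableOn (correlation W ν M s) (S ×ˢ S) := by
    refine Integrable.of_bound (C := 1) (measurable_correlation hW ν M s).aestronglyMeasurable
      (ae_of_all _ fun z => ?_)
    rw [Real.norm_of_nonneg (correlation_nonneg hW hν z)]
    exact correlation_le_one hW hν hs hs1 z
  set u : ℝ → ℝ := fun x => 1 - Real.exp (-((1 - s) * (ν * truncMarginal W M x))) with hu
  have kU : IntegrableOn (fun z : ℝ × ℝ => u z.1 * u z.2) (S ×ˢ S) := by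
    have hum : Measurable u := by
      have := hW.measurable_truncMarginal M
      fun_prop
    have hu0 : ∀ x, 0 ≤ u x ∧ u x ≤ 1 := fun x => by
      have : 0 ≤ (1 - s) * (ν * truncMarginal W M x) :=
        mul_nonneg (by linarith) (mul_nonneg hν (truncMarginal_nonneg hW _ _))
      refine ⟨sub_nonneg.2 (Real.exp_le_one_iff.2 (by linarith)), ?_⟩
      simp only [hu]
      linarith [Real.exp_pos (-((1 - s) * (ν * truncMarginal W M x)))]
    refine Integrable.of_bound (C := 1) (by fun_prop) (ae_of_all _ fun z => ?_)
    rw [Real.norm_of_nonneg (mul_nonneg (hu0 _).1 (hu0 _).1)]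
    exact mul_le_one₀ (hu0 _).2 (hu0 _).1 (hu0 _).2
  -- Written over `S ×ˢ S`, the squared mean cancels the product term of the pair densities; only
  -- edge and correlation terms remain in the variance.
  have hm2 : m ^ 2 = ν ^ 2 * ∫ z in S ×ˢ S, u z.1 * u z.2 := by
    rw [Measure.volume_eq_prod, setIntegral_prod_mul u u S S, hm, discountMean]
    ring
  have hZle : ∫ ω, Z ω ∂P ≤ m ^ 2 +
      ν ^ 2 * ∫ z in S ×ˢ S, (2 * W z.1 z.2 + correlation W ν M s z) := by
    have kWC : IntegrableOn (fun z => 2 * W z.1 z.2 + correlation W ν M s z) (S ×ˢ S) :=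
      kW.add kC
    rw [hZe, hm2, ← mul_add, ← integral_add kU kWC]
    refine mul_le_mul_of_nonneg_left (integral_mono hJ4.1 (kU.add kWC) fun z => ?_) (sq_nonneg _)
    have := pairDensity_combination_le hW ν M hs hs1 hν z
    simp only [hu]
    linarith
  simp only [integral_const, probReal_univ, one_smul]
  nlinarith

end

/-! ### Regular kernels: truncation errors, growth of the mean, correlations -/

section

variable {P : Measure Ω} [IsProbabilityMeasure P] {p : ℕ → Ω → ℝ × ℝ} {ζ : Sym2 ℕ → Ω → ℝ}
  {W : ℝ → ℝ → ℝ}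

/-- An integrable edge kernel with positive, decreasing and regularly decaying marginal, and with
approximately uncorrelated rows. -/
structure IsRegularKernel (W : ℝ → ℝ → ℝ) : Prop extends IsEdgeKernel W where
  integrableOn : IntegrableOn (Function.uncurry W) (Ici (0 : ℝ) ×ˢ Ici (0 : ℝ))
  integrable_row : ∀ x ≥ 0, IntegrableOn (W x) (Ici 0)
  marginal_pos : ∀ x ≥ 0, 0 < marginal W x
  antitone : AntitoneOn (marginal W) (Ici 0)
  regular : ∃ χ > 0, AntitoneOn (fun x => x * marginal W x) (Ioi χ)
  overlap : ∃ C > 0, ∃ T > 0, ∀ l ≥ 0, ∀ w > T,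
      ∫ x in Ici (0 : ℝ), W l x * W w x ≤ C * marginal W l * marginal W w

/-- The mass of the marginal beyond `M`. -/
def tailMass (W : ℝ → ℝ → ℝ) (M : ℝ) : ℝ := ∫ x in Ioi M, marginal W x

/-- `∫ (1 - e^{-ν μ(x)}) dx`. -/
def degreeMass (W : ℝ → ℝ → ℝ) (ν : ℝ) : ℝ :=
  ∫ x in Ici (0 : ℝ), (1 - Real.exp (-(ν * marginal W x)))

lemma one_sub_exp_neg_nonneg {a : ℝ} (ha : 0 ≤ a) : 0 ≤ 1 - Real.exp (-a) :=
  sub_nonneg.2 (Real.exp_le_one_iff.2 (by linarith))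

lemma one_sub_exp_neg_le (a : ℝ) : 1 - Real.exp (-a) ≤ a := by
  linarith [Real.add_one_le_exp (-a)]

lemma one_sub_exp_neg_mono {a b : ℝ} (h : a ≤ b) : 1 - Real.exp (-a) ≤ 1 - Real.exp (-b) :=
  sub_le_sub_left (Real.exp_le_exp.2 (neg_le_neg h)) 1

lemma exp_neg_sub_exp_neg_le {a b : ℝ} (ha : 0 ≤ a) (h : a ≤ b) :
    Real.exp (-a) - Real.exp (-b) ≤ b - a := by
  have h1 : Real.exp (-b) = Real.exp (-a) * Real.exp (-(b - a)) := by
    rw [← Real.exp_add]; congr 1; ring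
  have h2 := one_sub_exp_neg_le (b - a)
  have h3 : Real.exp (-a) ≤ 1 := Real.exp_le_one_iff.2 (by linarith)
  rw [h1]
  nlinarith [Real.exp_pos (-a), one_sub_exp_neg_nonneg (sub_nonneg.2 h)]

namespace IsRegularKernel

variable (hW : IsRegularKernel W)
include hW

lemma integrable_prod : Integrable (Function.uncurry W)
    ((volume.restrict (Ici (0 : ℝ))).prod (volume.restrict (Ici (0 : ℝ)))) := by
  rw [Measure.prod_restrict, ← Measure.volume_eq_prod]
  exact hW.integrableOn

lemma marginal_nonneg (x : ℝ) : 0 ≤ marginal W x := integral_nonneg fun _ => hW.nonneg _ _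

lemma measurable_marginal : Measurable (marginal W) :=
  (hW.measurable.stronglyMeasurable.integral_prod_right).measurable

lemma integrableOn_marginal : IntegrableOn (marginal W) (Ici 0) :=
  hW.integrable_prod.integral_prod_left

lemma tailMass_nonneg (M : ℝ) : 0 ≤ tailMass W M := integral_nonneg hW.marginal_nonneg

lemma tendsto_tailMass : Tendsto (tailMass W) atTop (𝓝 0) := tendsto_integral_Ioi_zero tendsto_id

lemma truncMarginal_le_marginal (M : ℝ) {x : ℝ} (hx : 0 ≤ x) :
    truncMarginal W M x ≤ marginal W x :=
  setIntegral_mono_set (hW.integrable_row x hx) (ae_of_all _ fun _ => hW.nonneg _ _)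
    (Icc_subset_Ici_self.eventuallyLE)

lemma truncOverlap_le_overlap (M : ℝ) {x : ℝ} (hx : 0 ≤ x) (x' : ℝ) :
    truncOverlap W M x x' ≤ ∫ y in Ici (0 : ℝ), W x y * W x' y := by
  refine setIntegral_mono_set ?_ (ae_of_all _ fun _ => mul_nonneg (hW.nonneg _ _) (hW.nonneg _ _))
    (Icc_subset_Ici_self.eventuallyLE)
  refine (hW.integrable_row x hx).mono' ?_ (ae_of_all _ fun y => ?_)
  · exact ((hW.measurable.of_uncurry_comp measurable_const measurable_id).mul
      (hW.measurable.of_uncurry_comp measurable_const measurable_id)).aestronglyMeasurable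
  · rw [Real.norm_of_nonneg (mul_nonneg (hW.nonneg _ _) (hW.nonneg _ _))]
    exact mul_le_of_le_one_right (hW.nonneg _ _) (hW.le_one _ _)

lemma integrableOn_truncMarginal (M : ℝ) : IntegrableOn (truncMarginal W M) (Ici 0) := by
  refine hW.integrableOn_marginal.mono'
    (hW.toIsEdgeKernel.measurable_truncMarginal M).aestronglyMeasurable ?_
  filter_upwards [ae_restrict_mem measurableSet_Ici] with x hx
  rw [Real.norm_of_nonneg (truncMarginal_nonneg hW.toIsEdgeKernel M x)]
  exact hW.truncMarginal_le_marginal M hx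

/-- The deficit is the mass of `W` on `S × (M, ∞)`. Fubini and the symmetry of `W` bound it by the
marginal integrated over `(M, ∞)`. -/
lemma integral_marginal_sub_truncMarginal_le {M : ℝ} (hM : 0 ≤ M) {S : Set ℝ}
    (hSM : S ⊆ Icc 0 M) :
    ∫ x in S, (marginal W x - truncMarginal W M x) ≤ tailMass W M := by
  have hi : IntegrableOn (fun x => marginal W x - truncMarginal W M x) (Icc 0 M) :=
    (hW.integrableOn_marginal.sub (hW.integrableOn_truncMarginal M)).mono_set Icc_subset_Ici_self
  have h0 : ∀ x ∈ Icc 0 M, marginal W x - truncMarginal W M x = ∫ y in Ioi M, W x y := by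
    intro x hx
    rw [marginal, truncMarginal, ← Icc_union_Ioi_eq_Ici hM, setIntegral_union _ measurableSet_Ioi]
    · ring
    · exact (hW.integrable_row x hx.1).mono_set Icc_subset_Ici_self
    · exact (hW.integrable_row x hx.1).mono_set fun y hy => hM.trans (le_of_lt hy)
    · exact Set.disjoint_left.2 fun y h1 h2 => not_lt.2 h1.2 h2
  calc ∫ x in S, (marginal W x - truncMarginal W M x)
      ≤ ∫ x in Icc 0 M, (marginal W x - truncMarginal W M x) := by
        refine setIntegral_mono_set hi ?_ hSM.eventuallyLE
        filter_upwards [ae_restrict_mem measurableSet_Icc] with x hx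
        exact sub_nonneg.2 (hW.truncMarginal_le_marginal M hx.1)
    _ = ∫ x in Icc 0 M, ∫ y in Ioi M, W x y := setIntegral_congr_fun measurableSet_Icc h0
    _ = ∫ y in Ioi M, ∫ x in Icc 0 M, W x y := by
        refine integral_integral_swap (f := W) ?_
        rw [Measure.prod_restrict, ← Measure.volume_eq_prod]
        exact hW.integrableOn.mono_set (prod_mono Icc_subset_Ici_self fun y hy =>
          hM.trans (le_of_lt hy))
    _ ≤ tailMass W M := by
        have e : ∀ y, ∫ x in Icc 0 M, W x y = truncMarginal W M y := fun y =>
          integral_congr_ae (ae_of_all _ fun x => hW.symm x y)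
        simp_rw [e]
        have hs : Ioi M ⊆ Ici (0 : ℝ) := fun y hy => hM.trans (le_of_lt hy)
        exact setIntegral_mono_on ((hW.integrableOn_truncMarginal M).mono_set hs)
          (hW.integrableOn_marginal.mono_set hs) measurableSet_Ioi fun y hy =>
          hW.truncMarginal_le_marginal M (hs hy)

lemma integrableOn_one_sub_exp {c : ℝ} (hc : 0 ≤ c) :
    IntegrableOn (fun x => 1 - Real.exp (-(c * marginal W x))) (Ici 0) := by
  have hm := hW.measurable_marginal
  refine (hW.integrableOn_marginal.const_mul c).mono' (by fun_prop) (ae_of_all _ fun x => ?_)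
  have h := mul_nonneg hc (hW.marginal_nonneg x)
  rw [Real.norm_of_nonneg (one_sub_exp_neg_nonneg h)]
  exact one_sub_exp_neg_le _

lemma integrableOn_one_sub_exp_trunc {c : ℝ} (hc : 0 ≤ c) (M : ℝ) :
    IntegrableOn (fun x => 1 - Real.exp (-(c * truncMarginal W M x))) (Ici 0) := by
  have hm := hW.toIsEdgeKernel.measurable_truncMarginal M
  refine ((hW.integrableOn_truncMarginal M).const_mul c).mono' (by fun_prop)
    (ae_of_all _ fun x => ?_)
  have h := mul_nonneg hc (truncMarginal_nonneg hW.toIsEdgeKernel M x)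
  rw [Real.norm_of_nonneg (one_sub_exp_neg_nonneg h)]
  exact one_sub_exp_neg_le _

lemma degreeMass_nonneg {ν : ℝ} (hν : 0 ≤ ν) : 0 ≤ degreeMass W ν :=
  integral_nonneg fun x => one_sub_exp_neg_nonneg (mul_nonneg hν (hW.marginal_nonneg x))

/-- Since μ is decreasing and positive, `ν μ ≥ 1` on all of `[0, L]` once ν is large, and there the
integrand is at least `1 - 1/e ≥ 1/2`. -/
lemma tendsto_degreeMass : Tendsto (degreeMass W) atTop atTop := by
  rw [tendsto_atTop]
  intro b
  set L := 2 * max b 0 with hL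
  have hL0 : 0 ≤ L := by positivity
  have hpos := hW.marginal_pos L hL0
  filter_upwards [eventually_ge_atTop (1 / marginal W L)] with ν hν
  have hν0 : 0 ≤ ν := (by positivity : (0 : ℝ) ≤ 1 / marginal W L).trans hν
  have h1 : 1 ≤ ν * marginal W L := by
    rwa [div_le_iff₀ hpos] at hν
  have he : Real.exp (-1) ≤ 1 / 2 := by
    have := Real.exp_one_gt_d9
    rw [Real.exp_neg, inv_le_comm₀ (Real.exp_pos 1) (by norm_num)]
    linarith
  have h2 : ∫ _ in Icc 0 L, (1 / 2 : ℝ) ≤ degreeMass W ν := by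
    refine (setIntegral_mono_on (integrable_const _) ((hW.integrableOn_one_sub_exp hν0).mono_set
      Icc_subset_Ici_self) measurableSet_Icc fun x hx => ?_).trans
      (setIntegral_mono_set (hW.integrableOn_one_sub_exp hν0) (ae_of_all _ fun x =>
        one_sub_exp_neg_nonneg (mul_nonneg hν0 (hW.marginal_nonneg x)))
        Icc_subset_Ici_self.eventuallyLE)
    have h3 := hW.antitone (show x ∈ Ici 0 from hx.1) (show L ∈ Ici 0 from hL0) hx.2
    have h4 := one_sub_exp_neg_mono (h1.trans (mul_le_mul_of_nonneg_left h3 hν0))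
    linarith
  simp only [setIntegral_const, Measure.real, Real.volume_Icc, sub_zero,
    ENNReal.toReal_ofReal hL0, smul_eq_mul] at h2
  have := le_max_left b 0
  linarith

lemma discountMean_le {ν M : ℝ} (hν : 0 ≤ ν) {S : Set ℝ} (hS : MeasurableSet S)
    (hSM : S ⊆ Icc 0 M) {s : ℝ} (hs : 0 ≤ s) (hs1 : s ≤ 1) :
    discountMean W ν M S s ≤ degreeMass W ν := by
  have h0 : S ⊆ Ici 0 := hSM.trans Icc_subset_Ici_self
  have e : ∀ x, (1 - s) * (ν * truncMarginal W M x) = (1 - s) * ν * truncMarginal W M x :=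
    fun x => by ring
  have hc : 0 ≤ (1 - s) * ν := mul_nonneg (by linarith) hν
  refine (setIntegral_mono_on ?_ ((hW.integrableOn_one_sub_exp hν).mono_set h0) hS
    fun x hx => one_sub_exp_neg_mono ?_).trans (setIntegral_mono_set
      (hW.integrableOn_one_sub_exp hν) (ae_of_all _ fun x =>
        one_sub_exp_neg_nonneg (mul_nonneg hν (hW.marginal_nonneg x))) h0.eventuallyLE)
  · simp_rw [e]
    exact (hW.integrableOn_one_sub_exp_trunc hc M).mono_set h0
  · have h1 := hW.truncMarginal_le_marginal M (h0 hx)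
    have h2 := mul_le_mul_of_nonneg_left h1 hν
    have h3 := mul_nonneg hν (truncMarginal_nonneg hW.toIsEdgeKernel M x)
    nlinarith

/-- Comparison of the means of the discounted sums with their values without truncation. -/
lemma abs_discountMean_sub_le {ν M : ℝ} (hν : 0 ≤ ν) (hM : 0 ≤ M) {S : Set ℝ}
    (hS : MeasurableSet S) (hS0 : S ⊆ Ici 0) {s : ℝ} (hs : 0 ≤ s) (hs1 : s ≤ 1) :
    |discountMean W ν M (S ∩ Icc 0 M) s -
      ∫ x in S, (1 - Real.exp (-((1 - s) * (ν * marginal W x))))| ≤ 2 * (ν * tailMass W M) := by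
  have hc : 0 ≤ (1 - s) * ν := mul_nonneg (by linarith) hν
  have i1 : IntegrableOn (fun x => 1 - Real.exp (-((1 - s) * (ν * marginal W x)))) (Ici 0) := by
    simp_rw [← mul_assoc]; exact hW.integrableOn_one_sub_exp hc
  have i2 : IntegrableOn (fun x => 1 - Real.exp (-((1 - s) * (ν * truncMarginal W M x))))
      (Ici 0) := by
    simp_rw [← mul_assoc]; exact hW.integrableOn_one_sub_exp_trunc hc M
  have hpos : ∀ x, 0 ≤ (1 - s) * (ν * marginal W x) := fun x =>
    mul_nonneg (by linarith) (mul_nonneg hν (hW.marginal_nonneg x))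
  have hs1' : S ∩ Icc 0 M ⊆ Ici 0 := inter_subset_left.trans hS0
  have hs2' : S ∩ Ioi M ⊆ Ici 0 := inter_subset_left.trans hS0
  -- The two units of `ν * tailMass W M` in the bound are the part of `S` beyond `M`, and the
  -- replacement of μ by its truncation on the rest.
  have hsplit : ∫ x in S, (1 - Real.exp (-((1 - s) * (ν * marginal W x)))) =
      (∫ x in S ∩ Icc 0 M, (1 - Real.exp (-((1 - s) * (ν * marginal W x))))) +
      ∫ x in S ∩ Ioi M, (1 - Real.exp (-((1 - s) * (ν * marginal W x)))) := by
    rw [← setIntegral_union _ (hS.inter measurableSet_Ioi) (i1.mono_set hs1') (i1.mono_set hs2'),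
      ← inter_union_distrib_left, Icc_union_Ioi_eq_Ici hM, inter_eq_left.2 hS0]
    exact Set.disjoint_left.2 fun y h1 h2 => not_lt.2 h1.2.2 h2.2
  have hA : 0 ≤ ∫ x in S ∩ Ioi M, (1 - Real.exp (-((1 - s) * (ν * marginal W x)))) :=
    integral_nonneg fun x => one_sub_exp_neg_nonneg (hpos x)
  have hB : ∫ x in S ∩ Ioi M, (1 - Real.exp (-((1 - s) * (ν * marginal W x)))) ≤
      ν * tailMass W M := by
    have hIoi : Ioi M ⊆ Ici (0 : ℝ) := fun y hy => hM.trans (le_of_lt hy)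
    rw [tailMass, ← integral_const_mul]
    refine (setIntegral_mono_set (i1.mono_set hIoi) (ae_of_all _ fun x =>
      one_sub_exp_neg_nonneg (hpos x)) (inter_subset_right.eventuallyLE)).trans
      (integral_mono (i1.mono_set hIoi)
        ((hW.integrableOn_marginal.mono_set hIoi).const_mul ν) fun x => ?_)
    have := one_sub_exp_neg_le ((1 - s) * (ν * marginal W x))
    have h3 := mul_nonneg hν (hW.marginal_nonneg x)
    simp only
    nlinarith
  have hD : |discountMean W ν M (S ∩ Icc 0 M) s -
      ∫ x in S ∩ Icc 0 M, (1 - Real.exp (-((1 - s) * (ν * marginal W x))))| ≤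
      ν * tailMass W M := by
    rw [discountMean, ← integral_sub (i2.mono_set hs1') (i1.mono_set hs1')]
    have h1 := hW.integral_marginal_sub_truncMarginal_le hM (S := S ∩ Icc 0 M) inter_subset_right
    refine (abs_integral_le_integral_abs).trans ?_
    refine le_trans ?_ (mul_le_mul_of_nonneg_left h1 hν)
    rw [← integral_const_mul]
    refine setIntegral_mono_on ((i2.mono_set hs1').sub (i1.mono_set hs1')).abs
      (((hW.integrableOn_marginal.sub (hW.integrableOn_truncMarginal M)).mono_set hs1').const_mul ν)
      (hS.inter measurableSet_Icc) fun x hx => ?_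
    have h2 := hW.truncMarginal_le_marginal M (hs1' hx)
    have h3 := mul_nonneg hν (truncMarginal_nonneg hW.toIsEdgeKernel M x)
    have h4 := mul_le_mul_of_nonneg_left h2 hν
    have h5 : 0 ≤ (1 - s) * (ν * truncMarginal W M x) := mul_nonneg (by linarith) h3
    have h6 := mul_le_mul_of_nonneg_left h4 (show 0 ≤ 1 - s by linarith)
    have h7 := exp_neg_sub_exp_neg_le h5 h6
    have h8 := one_sub_exp_neg_mono h6
    rw [abs_le]
    constructor <;> nlinarith
  rw [hsplit]
  rw [abs_le] at hD ⊢
  constructor <;> linarith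

/-- The integral of the correlation term. -/
lemma integral_correlation_le {C T : ℝ} (hC : 0 < C) (hT : 0 < T)
    (hCT : ∀ l ≥ 0, ∀ w > T,
      ∫ x in Ici (0 : ℝ), W l x * W w x ≤ C * marginal W l * marginal W w)
    {ν M : ℝ} (hν : 0 < ν) (hM : 0 ≤ M) {S : Set ℝ} (hS : MeasurableSet S)
    (hSM : S ⊆ Icc 0 M) {s : ℝ} (hs : 0 ≤ s) (hs1 : s ≤ 1) :
    ∫ z in S ×ˢ S, correlation W ν M s z ≤
      T ^ 2 + C / ν * (degreeMass W ν + ν * tailMass W M) ^ 2 := by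
  have h0 : S ⊆ Ici 0 := hSM.trans Icc_subset_Ici_self
  have hE := hW.toIsEdgeKernel
  set c := 1 - s with hc
  have hc0 : 0 ≤ c := by linarith
  have hc1 : c ≤ 1 := by linarith
  set u : ℝ → ℝ := fun x => c * (ν * marginal W x) *
    Real.exp (-(c * (ν * truncMarginal W M x) / 2)) with hu
  have hum : Measurable u := by
    have h1 := hW.measurable_marginal
    have h2 := hE.measurable_truncMarginal M
    fun_prop
  have hu0 : ∀ x, 0 ≤ u x := fun x => mul_nonneg
    (mul_nonneg hc0 (mul_nonneg hν.le (hW.marginal_nonneg x))) (Real.exp_pos _).le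
  -- With `a = c ν μ_M`, where `μ_M` is the truncated marginal, `u = a e^{-a/2} + (c ν μ - a)
  -- e^{-a/2}`. The first summand is at most `1 - e^{-νμ}` by `mul_exp_neg_half_le`, the second at
  -- most the truncation error.
  set g : ℝ → ℝ := fun x => ν * (marginal W x - truncMarginal W M x) +
    (1 - Real.exp (-(ν * marginal W x))) with hg
  have hgi : IntegrableOn g (Ici 0) :=
    ((hW.integrableOn_marginal.sub (hW.integrableOn_truncMarginal M)).const_mul ν).add
      (hW.integrableOn_one_sub_exp hν.le)
  have hug : ∀ x ∈ S, u x ≤ g x := by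
    intro x hx
    have h2 := mul_le_mul_of_nonneg_left (hW.truncMarginal_le_marginal M (h0 hx)) hν.le
    have h3 := mul_nonneg hν.le (truncMarginal_nonneg hE M x)
    set a := c * (ν * truncMarginal W M x) with ha
    have ha0 : 0 ≤ a := mul_nonneg hc0 h3
    have h4 := mul_exp_neg_half_le ha0
    have h5 : a ≤ ν * marginal W x := by nlinarith
    have h6 := one_sub_exp_neg_mono h5
    have h7 : Real.exp (-(a / 2)) ≤ 1 := Real.exp_le_one_iff.2 (by linarith)
    have h8 : c * (ν * marginal W x) - a ≤ ν * (marginal W x - truncMarginal W M x) := by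
      rw [ha]; nlinarith
    have h9 : 0 ≤ c * (ν * marginal W x) - a := by rw [ha]; nlinarith
    have h10 := mul_le_of_le_one_right h9 h7
    simp only [hu, hg]
    nlinarith
  have hui : IntegrableOn u S := by
    refine (hgi.mono_set h0).mono' hum.aestronglyMeasurable ?_
    filter_upwards [ae_restrict_mem hS] with x hx
    rw [Real.norm_of_nonneg (hu0 x)]
    exact hug x hx
  have hU : ∫ x in S, u x ≤ degreeMass W ν + ν * tailMass W M := by
    have e1 : IntegrableOn (fun x => marginal W x - truncMarginal W M x) S :=
      (hW.integrableOn_marginal.sub (hW.integrableOn_truncMarginal M)).mono_set h0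
    refine (setIntegral_mono_on hui (hgi.mono_set h0) hS hug).trans ?_
    simp only [hg]
    rw [integral_add (e1.const_mul ν) ((hW.integrableOn_one_sub_exp hν.le).mono_set h0),
      integral_const_mul, add_comm]
    refine add_le_add (setIntegral_mono_set (hW.integrableOn_one_sub_exp hν.le)
      (ae_of_all _ fun x => one_sub_exp_neg_nonneg (mul_nonneg hν.le (hW.marginal_nonneg x)))
      h0.eventuallyLE)
      (mul_le_mul_of_nonneg_left (hW.integral_marginal_sub_truncMarginal_le hM hSM) hν.le)
  have hU0 : 0 ≤ ∫ x in S, u x := integral_nonneg hu0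
  have hpt : ∀ z ∈ S ×ˢ S, correlation W ν M s z ≤
      (Icc 0 T).indicator 1 z.1 * (Icc 0 T).indicator 1 z.2 + C / ν * (u z.1 * u z.2) := by
    rintro ⟨x, x'⟩ ⟨hx, hx'⟩
    have hx0 := h0 hx
    have hx0' := h0 hx'
    have hind : ∀ x, 0 ≤ (Icc 0 T).indicator (1 : ℝ → ℝ) x := indicator_one_nonneg _
    simp only at hx hx' ⊢
    -- The overlap bound is available as soon as one of the two coordinates exceeds `T`, by
    -- symmetry. On the remaining square `[0,T]²` the trivial bound 1 costs `T ^ 2`.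
    have key : ∀ (h : truncOverlap W M x x' ≤ C * marginal W x * marginal W x'),
        correlation W ν M s (x, x') ≤ C / ν * (u x * u x') := by
      intro h
      refine (correlation_le hE hν.le hs hs1 (x, x')).trans ?_
      have e1 : C / ν * (u x * u x') = c ^ 2 * (ν * (C * marginal W x * marginal W x')) *
          Real.exp (-(c * (ν * truncMarginal W M x) / 2)) *
          Real.exp (-(c * (ν * truncMarginal W M x') / 2)) := by
        simp only [hu]; field_simp
      rw [e1]
      simp only
      gcongr
    by_cases hxT : T < x
    · have := key ((hW.truncOverlap_le_overlap M hx0 x').trans (by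
        have := hCT x' hx0' x hxT
        calc _ = ∫ y in Ici (0 : ℝ), W x' y * W x y := by simp_rw [mul_comm]
          _ ≤ _ := this
          _ = _ := by ring))
      have h1 := mul_nonneg (hind x) (hind x')
      linarith
    by_cases hxT' : T < x'
    · have := key ((hW.truncOverlap_le_overlap M hx0 x').trans (hCT x hx0 x' hxT'))
      have h1 := mul_nonneg (hind x) (hind x')
      linarith
    · have e1 : x ∈ Icc 0 T := ⟨hx0, not_lt.1 hxT⟩
      have e2 : x' ∈ Icc 0 T := ⟨hx0', not_lt.1 hxT'⟩
      rw [indicator_of_mem e1, indicator_of_mem e2]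
      have h1 := correlation_le_one hE hν.le hs hs1 (x, x') (M := M)
      have h2 : 0 ≤ C / ν * (u x * u x') :=
        mul_nonneg (by positivity) (mul_nonneg (hu0 x) (hu0 x'))
      simp only [Pi.one_apply, mul_one]
      linarith
  have hfin : IsFiniteMeasure (volume.restrict (S ×ˢ S)) :=
    ⟨by simpa using (measure_mono (prod_mono hSM hSM)).trans_lt (volume_box_lt_top M M)⟩
  have hfin1 : IsFiniteMeasure (volume.restrict S) :=
    ⟨by simpa using (measure_mono hSM).trans_lt (by simp)⟩
  have kC : IntegrableOn (correlation W ν M s) (S ×ˢ S) := by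
    refine Integrable.of_bound (C := 1) (measurable_correlation hE ν M s).aestronglyMeasurable
      (ae_of_all _ fun z => ?_)
    rw [Real.norm_of_nonneg (correlation_nonneg hE hν.le z)]
    exact correlation_le_one hE hν.le hs hs1 z
  have i1 : IntegrableOn ((Icc 0 T).indicator (1 : ℝ → ℝ)) S :=
    (integrable_const (1 : ℝ)).indicator measurableSet_Icc
  have k1 : IntegrableOn (fun z : ℝ × ℝ => (Icc 0 T).indicator (1 : ℝ → ℝ) z.1 *
      (Icc 0 T).indicator 1 z.2) (S ×ˢ S) := by
    rw [IntegrableOn, Measure.volume_eq_prod, ← Measure.prod_restrict]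
    exact i1.mul_prod i1
  have k2 : IntegrableOn (fun z : ℝ × ℝ => u z.1 * u z.2) (S ×ˢ S) := by
    rw [IntegrableOn, Measure.volume_eq_prod, ← Measure.prod_restrict]
    exact hui.mul_prod hui
  have k12 : IntegrableOn (fun z : ℝ × ℝ => (Icc 0 T).indicator (1 : ℝ → ℝ) z.1 *
      (Icc 0 T).indicator 1 z.2 + C / ν * (u z.1 * u z.2)) (S ×ˢ S) := k1.add (k2.const_mul _)
  refine (setIntegral_mono_on kC k12 (hS.prod hS) hpt).trans ?_
  have e1 := setIntegral_prod_mul (μ := volume) (ν := volume)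
    ((Icc 0 T).indicator (1 : ℝ → ℝ)) ((Icc 0 T).indicator 1) S S
  have e2 := setIntegral_prod_mul (μ := volume) (ν := volume) u u S S
  rw [← Measure.volume_eq_prod] at e1 e2
  have e3 : ∫ x in S, (Icc 0 T).indicator (1 : ℝ → ℝ) x ≤ T := by
    rw [integral_indicator measurableSet_Icc, Measure.restrict_restrict measurableSet_Icc]
    simp only [Pi.one_apply, integral_const, smul_eq_mul, mul_one, Measure.real,
      Measure.restrict_apply_univ]
    refine ENNReal.toReal_le_of_le_ofReal hT.le ((measure_mono inter_subset_left).trans ?_)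
    simp
  have e4 : 0 ≤ ∫ x in S, (Icc 0 T).indicator (1 : ℝ → ℝ) x :=
    integral_nonneg fun x => indicator_one_nonneg _ x
  rw [integral_add k1 (k2.const_mul _), integral_const_mul, e1, e2, ← sq, ← sq]
  have hCν : 0 ≤ C / ν := by positivity
  gcongr

end IsRegularKernel

end

/-! ### Concentration of discounted sums and of counts above a fixed level -/

section

variable {P : Measure Ω} [IsProbabilityMeasure P] {p : ℕ → Ω → ℝ × ℝ} {ζ : Sym2 ℕ → Ω → ℝ}
  {W : ℝ → ℝ → ℝ}

/-- Chebyshev's inequality for the discounted sums, uniformly in the set and the discount. -/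
lemma eventually_boxSum_discount_concentrated (hG : IsKEGSource P p ζ) (hW : IsRegularKernel W)
    {η : ℝ} (hη : 0 < η) : ∀ᶠ ν in atTop, ∀ M ≥ 0, ν * tailMass W M ≤ 1 →
      ∀ S, MeasurableSet S → S ⊆ Ici 0 → ∀ s, 0 ≤ s → s ≤ 1 →
      P {ω | η * (ν * degreeMass W ν) ≤ |boxSum W p ζ ν M (discount (S ∩ Icc 0 M) s) ω -
        ν * ∫ x in S, (1 - Real.exp (-((1 - s) * (ν * marginal W x))))|} ≤ ENNReal.ofReal η := by
  obtain ⟨C, hC, T, hT, hCT⟩ := hW.overlap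
  set I := ∫ z in Ici (0 : ℝ) ×ˢ Ici (0 : ℝ), W z.1 z.2 with hI
  have hI0 : 0 ≤ I := integral_nonneg fun _ => hW.nonneg _ _
  have hB := hW.tendsto_degreeMass
  -- Each of the three parts of the variance (diagonal; direct edges together with the square
  -- `[0,T]²`; overlap) is made at most `η³/16` times `(νB)²`. The constant 64 allows for `(B + ν *
  -- tailMass)² ≤ 4 B²`. The bound `4 / η` on `B` makes the truncation error `2ν` of the mean at
  -- most half of the allowed deviation.
  filter_upwards [eventually_ge_atTop 1, eventually_ge_atTop (64 * C / η ^ 3),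
    hB.eventually_ge_atTop 1, hB.eventually_ge_atTop (4 / η),
    hB.eventually_ge_atTop (16 / η ^ 3),
    hB.eventually_ge_atTop (16 * (2 * I + T ^ 2) / η ^ 3)] with ν h1 h2 h3 h4 h5 h6
  intro M hM hδ S hS hS0 s hs hs1
  set B := degreeMass W ν
  have hν0 : 0 < ν := by linarith
  have hE := hW.toIsEdgeKernel
  have hS' := hS.inter (measurableSet_Icc (a := 0) (b := M))
  have hSM : S ∩ Icc 0 M ⊆ Icc 0 M := inter_subset_right
  have hmean := hW.abs_discountMean_sub_le hν0.le hM hS hS0 hs hs1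
  obtain ⟨hXi, hXv⟩ := variance_boxSum_discount_le hG hE hν0.le hM hS' hSM hs hs1
  set X := boxSum W p ζ ν M (discount (S ∩ Icc 0 M) s)
  set m := discountMean W ν M (S ∩ Icc 0 M) s
  set m' := ∫ x in S, (1 - Real.exp (-((1 - s) * (ν * marginal W x))))
  have hm : m ≤ B := hW.discountMean_le hν0.le hS' hSM hs hs1
  have hcorr := hW.integral_correlation_le hC hT hCT hν0 hM hS' hSM hs hs1
  have hsub : (S ∩ Icc 0 M) ×ˢ (S ∩ Icc 0 M) ⊆ Ici (0 : ℝ) ×ˢ Ici (0 : ℝ) :=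
    prod_mono (inter_subset_left.trans hS0) (inter_subset_left.trans hS0)
  have hIW : ∫ z in (S ∩ Icc 0 M) ×ˢ (S ∩ Icc 0 M), W z.1 z.2 ≤ I :=
    setIntegral_mono_set hW.integrableOn (ae_of_all _ fun z => hW.nonneg z.1 z.2)
      hsub.eventuallyLE
  have hfin : IsFiniteMeasure (volume.restrict ((S ∩ Icc 0 M) ×ˢ (S ∩ Icc 0 M))) :=
    ⟨by simpa using (measure_mono (prod_mono hSM hSM)).trans_lt (volume_box_lt_top M M)⟩
  have kC : IntegrableOn (correlation W ν M s) ((S ∩ Icc 0 M) ×ˢ (S ∩ Icc 0 M)) := by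
    refine Integrable.of_bound (C := 1) (measurable_correlation hE ν M s).aestronglyMeasurable
      (ae_of_all _ fun z => ?_)
    rw [Real.norm_of_nonneg (correlation_nonneg hE hν0.le z)]
    exact correlation_le_one hE hν0.le hs hs1 z
  have kW : IntegrableOn (fun z : ℝ × ℝ => W z.1 z.2) ((S ∩ Icc 0 M) ×ˢ (S ∩ Icc 0 M)) :=
    hW.integrableOn.mono_set hsub
  rw [integral_add (kW.const_mul 2) kC, integral_const_mul] at hXv
  have hτ := mul_nonneg hν0.le (hW.tailMass_nonneg M)
  have hBt : (B + ν * tailMass W M) ^ 2 ≤ 4 * B ^ 2 := by nlinarith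
  have hv : ∫ ω, (X ω - ν * m) ^ 2 ∂P ≤ η ^ 3 / 4 * (ν * B) ^ 2 := by
    have hη3 : 0 < η ^ 3 := by positivity
    rw [div_le_iff₀ hη3] at h2 h5 h6
    have e1 : ν * m ≤ η ^ 3 / 16 * (ν * B) ^ 2 := by
      have a1 : ν * m ≤ ν * B := mul_le_mul_of_nonneg_left hm hν0.le
      have a2 : 1 ≤ η ^ 3 / 16 * B := by linarith
      have a3 : 1 ≤ η ^ 3 / 16 * (ν * B) := by nlinarith
      have a4 : 0 ≤ ν * B := by positivity
      nlinarith
    have e2 : 2 * I + T ^ 2 ≤ η ^ 3 / 16 * B ^ 2 := by nlinarith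
    have e3 : C / ν * (B + ν * tailMass W M) ^ 2 ≤ η ^ 3 / 16 * B ^ 2 := by
      have a1 : C / ν ≤ η ^ 3 / 64 := by rw [div_le_iff₀ hν0]; linarith
      calc C / ν * (B + ν * tailMass W M) ^ 2 ≤ η ^ 3 / 64 * (4 * B ^ 2) := by gcongr
        _ = _ := by ring
    have e4 : 2 * (∫ z in (S ∩ Icc 0 M) ×ˢ (S ∩ Icc 0 M), W z.1 z.2) +
        ∫ z in (S ∩ Icc 0 M) ×ˢ (S ∩ Icc 0 M), correlation W ν M s z ≤ η ^ 3 / 8 * B ^ 2 := by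
      linarith
    have e5 := mul_le_mul_of_nonneg_left e4 (sq_nonneg ν)
    have e6 : 0 ≤ η ^ 3 * (ν * B) ^ 2 := by positivity
    have e7 : ν ^ 2 * (η ^ 3 / 8 * B ^ 2) = η ^ 3 / 8 * (ν * B) ^ 2 := by ring
    linarith
  have hνB : 0 < ν * B := by positivity
  have hsubset : {ω | η * (ν * B) ≤ |X ω - ν * m'|} ⊆
      {ω | (η / 2 * (ν * B)) ^ 2 ≤ (X ω - ν * m) ^ 2} := by
    intro ω hω
    simp only [mem_ofPred_eq] at hω ⊢
    rw [← sq_abs (X ω - ν * m)]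
    refine pow_le_pow_left₀ (by positivity) ?_ 2
    have a1 : |ν * m - ν * m'| ≤ 2 * ν := by
      rw [← mul_sub, abs_mul, abs_of_pos hν0]
      nlinarith
    have a2 : |X ω - ν * m'| ≤ |X ω - ν * m| + |ν * m - ν * m'| := abs_sub_le _ _ _
    have a3 : 4 ≤ B * η := by rwa [div_le_iff₀ hη] at h4
    nlinarith
  refine (measure_mono hsubset).trans ?_
  -- Chebyshev at the distance `(η / 2) νB`: the variance bound `η³/4 (νB)²` is exactly `η` times
  -- the squared distance.
  have hmk := mul_meas_ge_le_integral_of_nonneg (ae_of_all _ fun ω => sq_nonneg (X ω - ν * m))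
    hXi ((η / 2 * (ν * B)) ^ 2)
  rw [← ENNReal.ofReal_toReal (measure_ne_top P _)]
  refine ENNReal.ofReal_le_ofReal ?_
  have hq : 0 < (η / 2 * (ν * B)) ^ 2 := by positivity
  have := hmk.trans hv
  have e : η ^ 3 / 4 * (ν * B) ^ 2 = (η / 2 * (ν * B)) ^ 2 * η := by ring
  rw [e] at this
  exact le_of_mul_le_mul_left this hq

/-- The Poisson weights. -/
def poissonWeight (a : ℝ) (n : ℕ) : ℝ := Real.exp (-a) * a ^ n / n.factorial

/-- `P(Poisson(a) > K)`. -/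
def poissonTail (K : ℕ) (a : ℝ) : ℝ := 1 - ∑ n ∈ Finset.range (K + 1), poissonWeight a n

/-- The integral of `P(Poisson(ν μ(x)) > K)`. -/
def tailIntegral (W : ℝ → ℝ → ℝ) (ν : ℝ) (K : ℕ) : ℝ :=
  ∫ x in Ici (0 : ℝ), poissonTail K (ν * marginal W x)

/-- The indicator of `K < n`. -/
def above (K n : ℕ) : ℝ := if K < n then 1 else 0

lemma above_nonneg (K n : ℕ) : 0 ≤ above K n := by unfold above; split_ifs <;> simp

lemma above_le_one (K n : ℕ) : above K n ≤ 1 := by unfold above; split_ifs <;> simp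

lemma poissonWeight_nonneg {a : ℝ} (ha : 0 ≤ a) (n : ℕ) : 0 ≤ poissonWeight a n := by
  unfold poissonWeight; positivity

lemma HasSum.of_forall_eq {f g : ℕ → ℝ} {a : ℝ} (h : HasSum f a) (hfg : ∀ n, g n = f n) :
    HasSum g a := by rwa [funext hfg]

/-- The Poisson generating function is the very exponential that appears in the moment formulas. For
this reason the degrees behave like Poisson variables of mean `ν μ(x)`. -/
lemma hasSum_poissonWeight_mul_pow (a τ : ℝ) :
    HasSum (fun n => poissonWeight a n * τ ^ n) (Real.exp (-((1 - τ) * a))) := by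
  have h := (NormedSpace.expSeries_div_hasSum_exp (a * τ)).mul_left (Real.exp (-a))
  rw [← Real.exp_eq_exp_ℝ, ← Real.exp_add] at h
  have e : -a + a * τ = -((1 - τ) * a) := by ring
  rw [e] at h
  refine h.of_forall_eq fun n => ?_
  rw [poissonWeight, mul_pow]; ring

lemma hasSum_poissonWeight (a : ℝ) : HasSum (poissonWeight a) 1 := by
  simpa using hasSum_poissonWeight_mul_pow a 1

lemma hasSum_poissonWeight_mul_above (a : ℝ) (K : ℕ) :
    HasSum (fun n => poissonWeight a n * above K n) (poissonTail K a) := by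
  have h1 := hasSum_poissonWeight a
  have h2 : HasSum (fun n => if n ∈ Finset.range (K + 1) then poissonWeight a n else 0)
      (∑ n ∈ Finset.range (K + 1), poissonWeight a n) := by
    have : HasSum (fun n => if n ∈ Finset.range (K + 1) then poissonWeight a n else 0)
        (∑ n ∈ Finset.range (K + 1), if n ∈ Finset.range (K + 1) then poissonWeight a n else 0) :=
      hasSum_sum_of_ne_finset_zero fun n hn => by simp [hn]
    rwa [Finset.sum_congr rfl fun n hn => if_pos hn] at this
  refine (h1.sub h2).of_forall_eq fun n => ?_
  simp only [above, Finset.mem_range]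
  by_cases h : K < n
  · rw [if_pos h, if_neg (by omega)]; ring
  · rw [if_neg h, if_pos (by omega)]; ring

/-- A pointwise approximation of the indicator in `n`, averaged over Poisson weights. The same
pointwise estimate is also summed over the random degrees, so count and prediction are approximated
in parallel. -/
lemma abs_poissonTail_sub_le {a : ℝ} (ha : 0 ≤ a) {K : ℕ} {g R : ℕ → ℝ} {G H : ℝ}
    (hg : HasSum (fun n => poissonWeight a n * g n) G)
    (hR : HasSum (fun n => poissonWeight a n * R n) H)
    (h : ∀ n, |above K n - g n| ≤ R n) : |poissonTail K a - G| ≤ H := by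
  have h1 := (hasSum_poissonWeight_mul_above a K).sub hg
  rw [abs_le]
  constructor
  · refine hasSum_le (fun n => ?_) hR.neg h1
    have := mul_le_mul_of_nonneg_left (abs_le.1 (h n)).1 (poissonWeight_nonneg ha n)
    linarith
  · refine hasSum_le (fun n => ?_) h1 hR
    have := mul_le_mul_of_nonneg_left (abs_le.1 (h n)).2 (poissonWeight_nonneg ha n)
    linarith

lemma poissonTail_zero (a : ℝ) : poissonTail 0 a = 1 - Real.exp (-a) := by
  simp [poissonTail, poissonWeight]

lemma tailIntegral_zero (W : ℝ → ℝ → ℝ) (ν : ℝ) : tailIntegral W ν 0 = degreeMass W ν := by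
  simp [tailIntegral, degreeMass, poissonTail_zero]

lemma poissonTail_nonneg {a : ℝ} (ha : 0 ≤ a) (K : ℕ) : 0 ≤ poissonTail K a :=
  (hasSum_poissonWeight_mul_above a K).nonneg fun n =>
    mul_nonneg (poissonWeight_nonneg ha n) (above_nonneg K n)

lemma above_anti {K L : ℕ} (h : K ≤ L) (n : ℕ) : above L n ≤ above K n := by
  unfold above; split_ifs <;> first | omega | simp

lemma poissonTail_le {a : ℝ} (ha : 0 ≤ a) (K : ℕ) : poissonTail K a ≤ 1 - Real.exp (-a) := by
  rw [← poissonTail_zero]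
  exact hasSum_le (fun n => mul_le_mul_of_nonneg_left (above_anti (Nat.zero_le K) n)
    (poissonWeight_nonneg ha n)) (hasSum_poissonWeight_mul_above a K)
    (hasSum_poissonWeight_mul_above a 0)

lemma measurable_poissonTail (K : ℕ) : Measurable (poissonTail K) := by
  unfold poissonTail poissonWeight; fun_prop

lemma IsRegularKernel.integrableOn_poissonTail (hW : IsRegularKernel W) {ν : ℝ} (hν : 0 ≤ ν)
    (K : ℕ) : IntegrableOn (fun x => poissonTail K (ν * marginal W x)) (Ici 0) := by
  refine (hW.integrableOn_one_sub_exp hν).mono'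
    ((measurable_poissonTail K).comp (hW.measurable_marginal.const_mul ν)).aestronglyMeasurable
    (ae_of_all _ fun x => ?_)
  have h := mul_nonneg hν (hW.marginal_nonneg x)
  rw [Real.norm_of_nonneg (poissonTail_nonneg h K)]
  exact poissonTail_le h K

lemma IsRegularKernel.tailIntegral_nonneg (hW : IsRegularKernel W) {ν : ℝ} (hν : 0 ≤ ν)
    (K : ℕ) : 0 ≤ tailIntegral W ν K :=
  integral_nonneg fun x => poissonTail_nonneg (mul_nonneg hν (hW.marginal_nonneg x)) K

lemma IsRegularKernel.tailIntegral_le (hW : IsRegularKernel W) {ν : ℝ} (hν : 0 ≤ ν)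
    (K : ℕ) : tailIntegral W ν K ≤ degreeMass W ν :=
  integral_mono (hW.integrableOn_poissonTail hν K) (hW.integrableOn_one_sub_exp hν) fun x =>
    poissonTail_le (mul_nonneg hν (hW.marginal_nonneg x)) K

/-- The event that the degree count deviates from its Poisson prediction. -/
def deviationEvent (W : ℝ → ℝ → ℝ) (p : ℕ → Ω → ℝ × ℝ) (ζ : Sym2 ℕ → Ω → ℝ) (ν M : ℝ) (K : ℕ)
    (ε : ℝ) : Set Ω :=
  {ω | ε * (ν * degreeMass W ν) ≤
    |boxSum W p ζ ν M (fun _ n => above K n) ω - ν * tailIntegral W ν K|}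

/-- Weierstrass approximation of the indicator of `K < n` by polynomials in `2 ^ (-n)`. -/
lemma exists_polynomial_above (K : ℕ) {ε : ℝ} (hε : 0 < ε) : ∃ r : Polynomial ℝ, ∀ n : ℕ,
    |above K n - (1 - (1 / 2 : ℝ) ^ n) * r.eval ((1 / 2 : ℝ) ^ n)| ≤
      ε * (1 - (1 / 2 : ℝ) ^ n) := by
  -- At `y = 2^{-n}` the numerator is 0 for `n ≤ K` and 1 for `n > K`, linear in between. Dividing
  -- by `1 - y` makes the final error proportional to `1 - 2^{-n}`, hence zero at degree 0. The
  -- lower bound `1/2` removes the pole at `y = 1` and is inactive where the numerator is 1.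
  set φ : ℝ → ℝ := fun y => max 0 (min 1 (((1 / 2 : ℝ) ^ K - y) * 2 ^ (K + 1))) /
    max (1 - y) (1 / 2) with hφ
  have hcont : Continuous φ := by
    refine Continuous.div (by fun_prop) (by fun_prop) fun y => ?_
    exact (lt_of_lt_of_le (by norm_num) (le_max_right (1 - y) (1 / 2 : ℝ))).ne'
  obtain ⟨r, hr⟩ := exists_polynomial_near_of_continuousOn 0 1 φ hcont.continuousOn ε hε
  refine ⟨r, fun n => ?_⟩
  set y : ℝ := (1 / 2) ^ n with hy
  have hy0 : 0 < y := by positivity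
  have hy1 : y ≤ 1 := pow_le_one₀ (by norm_num) (by norm_num)
  have h1 := (hr y ⟨hy0.le, hy1⟩).le
  have hab : above K n = (1 - y) * φ y := by
    have hK : ((1 / 2 : ℝ) ^ K) * 2 ^ (K + 1) = 2 := by
      rw [pow_succ, ← mul_assoc, ← mul_pow]; norm_num
    by_cases h : K < n
    · have h2 : y ≤ (1 / 2 : ℝ) ^ (K + 1) := pow_le_pow_of_le_one (by norm_num) (by norm_num) h
      have h3 : y ≤ 1 / 2 := h2.trans (by
        rw [pow_succ]
        have : (1 / 2 : ℝ) ^ K ≤ 1 := pow_le_one₀ (by norm_num) (by norm_num)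
        linarith)
      have h4 : y * 2 ^ (K + 1) ≤ 1 := by
        calc y * 2 ^ (K + 1) ≤ (1 / 2 : ℝ) ^ (K + 1) * 2 ^ (K + 1) := by gcongr
          _ = 1 := by rw [← mul_pow]; norm_num
      have h5 : 1 ≤ ((1 / 2 : ℝ) ^ K - y) * 2 ^ (K + 1) := by rw [sub_mul, hK]; linarith
      simp only [above, if_pos h, hφ]
      rw [min_eq_left h5, max_eq_right zero_le_one, max_eq_left (by linarith)]
      field_simp [show 1 - y ≠ 0 by linarith]
    · have h2 : (1 / 2 : ℝ) ^ K ≤ y := pow_le_pow_of_le_one (by norm_num) (by norm_num) (by omega)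
      have h5 : ((1 / 2 : ℝ) ^ K - y) * 2 ^ (K + 1) ≤ 0 :=
        mul_nonpos_of_nonpos_of_nonneg (by linarith) (by positivity)
      simp only [above, if_neg h, hφ]
      rw [min_eq_right (by linarith), max_eq_left h5, zero_div, mul_zero]
  rw [hab, ← mul_sub, abs_mul, abs_of_nonneg (show 0 ≤ 1 - y by linarith), mul_comm ε, abs_sub_comm]
  exact mul_le_mul_of_nonneg_left h1 (by linarith)

/-- `(1 - y) y^m = (1 - y^{m+1}) - (1 - y^m)`: the approximant is a combination of discounts with
the parameters `2^{-m}`. -/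
lemma one_sub_mul_eval (r : Polynomial ℝ) (n : ℕ) :
    (1 - (1 / 2 : ℝ) ^ n) * r.eval ((1 / 2 : ℝ) ^ n) =
      ∑ m ∈ Finset.range (r.natDegree + 1), r.coeff m *
        ((1 - ((1 / 2 : ℝ) ^ (m + 1)) ^ n) - (1 - ((1 / 2 : ℝ) ^ m) ^ n)) := by
  rw [Polynomial.eval_eq_sum_range, Finset.mul_sum]
  refine Finset.sum_congr rfl fun m _ => ?_
  rw [← pow_mul, ← pow_mul, ← pow_mul, add_mul, mul_comm n m, one_mul, pow_add]
  ring

lemma abs_boxSum_sub_le {ν M : ℝ} {f g R : ℝ → ℕ → ℝ} (ω : Ω)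
    (h : ∀ x ∈ Icc 0 M, ∀ n, |f x n - g x n| ≤ R x n)
    (hω : ω ∈ indexEvent p (box ν M) (boxIndex p (box ν M) ω)) :
    |boxSum W p ζ ν M f ω - boxSum W p ζ ν M g ω| ≤ boxSum W p ζ ν M R ω := by
  simp only [boxSum, ← Finset.sum_sub_distrib]
  refine (Finset.abs_sum_le_sum_abs _ _).trans (Finset.sum_le_sum fun i hi => h _ ?_ _)
  exact ((hω i).2 hi).2

/-- Concentration of the count of degrees above a fixed level. -/
lemma eventually_deviationEvent_le_fixed (hG : IsKEGSource P p ζ) (hW : IsRegularKernel W)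
    (K : ℕ) {ε : ℝ} (hε : 0 < ε) : ∀ᶠ ν in atTop, ∀ M ≥ 0, ν * tailMass W M ≤ 1 →
      P (deviationEvent W p ζ ν M K ε) ≤ ENNReal.ofReal ε := by
  obtain ⟨r, hr⟩ := exists_polynomial_above K (show 0 < ε / 8 by positivity)
  set d := r.natDegree + 1 with hd
  set R := ∑ m ∈ Finset.range d, |r.coeff m| with hR
  have hR0 : 0 ≤ R := Finset.sum_nonneg fun _ _ => abs_nonneg _
  -- The second entry absorbs the coefficients: an error `η νB` in each discounted sum changes the
  -- combination by at most `(ε/4) νB`. The third pays for the union of the `d + 1` exceptional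
  -- events, and `η ≤ 1` gives `X 1 ≤ 2νB`.
  set η := min 1 (min (ε / (8 * (R + 1))) (ε / (2 * (d + 1)))) with hη
  have hη0 : 0 < η := by positivity
  have hη1 : η ≤ 1 := min_le_left _ _
  have hη2 : η * (8 * (R + 1)) ≤ ε := by
    rw [← le_div_iff₀ (by positivity)]; exact (min_le_right _ _).trans (min_le_left _ _)
  have hη3 : η * (2 * (d + 1)) ≤ ε := by
    rw [← le_div_iff₀ (by positivity)]; exact (min_le_right _ _).trans (min_le_right _ _)
  filter_upwards [eventually_boxSum_discount_concentrated hG hW hη0, eventually_gt_atTop 0,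
    hW.tendsto_degreeMass.eventually_gt_atTop 0] with ν hν hν0 hB0
  intro M hM hδ
  set B := degreeMass W ν with hBdef
  have hνB : 0 < ν * B := by positivity
  set X : ℕ → Ω → ℝ := fun m => boxSum W p ζ ν M (discount (Ici 0 ∩ Icc 0 M) ((1 / 2) ^ m))
    with hX
  set E : ℕ → ℝ := fun m => ν * ∫ x in Ici (0 : ℝ),
    (1 - Real.exp (-((1 - (1 / 2 : ℝ) ^ m) * (ν * marginal W x)))) with hEdef
  have hp0 : ∀ m, (0 : ℝ) ≤ (1 / 2) ^ m := fun m => by positivity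
  have hp1 : ∀ m, ((1 : ℝ) / 2) ^ m ≤ 1 := fun m => pow_le_one₀ (by norm_num) (by norm_num)
  have hbad : ∀ m, P {ω | η * (ν * B) ≤ |X m ω - E m|} ≤ ENNReal.ofReal η := fun m =>
    hν M hM hδ _ measurableSet_Ici subset_rfl _ (hp0 m) (hp1 m)
  have hlam : ∀ x, 0 ≤ ν * marginal W x := fun x => mul_nonneg hν0.le (hW.marginal_nonneg x)
  have hint : ∀ m, IntegrableOn (fun x =>
      1 - Real.exp (-((1 - (1 / 2 : ℝ) ^ m) * (ν * marginal W x)))) (Ici 0) := fun m => by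
    simp_rw [← mul_assoc]
    exact hW.integrableOn_one_sub_exp (mul_nonneg (by linarith [hp1 m]) hν0.le)
  have hE1 : E 1 ≤ ν * B := by
    refine mul_le_mul_of_nonneg_left (integral_mono (hint 1)
      (hW.integrableOn_one_sub_exp hν0.le) fun x => one_sub_exp_neg_mono ?_) hν0.le
    have := hlam x
    nlinarith
  -- The deterministic half: averaging the polynomial approximant over Poisson weights and
  -- integrating over `x` gives exactly the same combination of the means `E m`.
  have hdet : |ν * tailIntegral W ν K - ∑ m ∈ Finset.range d, r.coeff m * (E (m + 1) - E m)| ≤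
      ε / 8 * E 1 := by
    have hpt : ∀ x, |poissonTail K (ν * marginal W x) - ∑ m ∈ Finset.range d, r.coeff m *
        ((1 - Real.exp (-((1 - (1 / 2 : ℝ) ^ (m + 1)) * (ν * marginal W x)))) -
          (1 - Real.exp (-((1 - (1 / 2 : ℝ) ^ m) * (ν * marginal W x)))))| ≤
        ε / 8 * (1 - Real.exp (-((1 - (1 / 2 : ℝ) ^ 1) * (ν * marginal W x)))) := by
      intro x
      have hs : ∀ m : ℕ, HasSum (fun n => poissonWeight (ν * marginal W x) n *
          (1 - ((1 / 2 : ℝ) ^ m) ^ n))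
          (1 - Real.exp (-((1 - (1 / 2 : ℝ) ^ m) * (ν * marginal W x)))) := fun m =>
        ((hasSum_poissonWeight _).sub (hasSum_poissonWeight_mul_pow _ ((1 / 2) ^ m))).of_forall_eq
          fun n => by ring
      refine abs_poissonTail_sub_le (hlam x) (g := fun n => ∑ m ∈ Finset.range d, r.coeff m *
        ((1 - ((1 / 2 : ℝ) ^ (m + 1)) ^ n) - (1 - ((1 / 2 : ℝ) ^ m) ^ n)))
        (R := fun n => ε / 8 * (1 - ((1 / 2 : ℝ) ^ 1) ^ n)) ?_ ?_ fun n => ?_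
      · refine (hasSum_sum fun m _ => ((hs (m + 1)).sub (hs m)).mul_left (r.coeff m)).of_forall_eq
          fun n => ?_
        rw [Finset.mul_sum]
        exact Finset.sum_congr rfl fun m _ => by ring
      · exact ((hs 1).mul_left (ε / 8)).of_forall_eq fun n => by ring
      · have := hr n
        rw [one_sub_mul_eval] at this
        simpa using this
    have hI : ∀ m, IntegrableOn (fun x => r.coeff m *
        ((1 - Real.exp (-((1 - (1 / 2 : ℝ) ^ (m + 1)) * (ν * marginal W x)))) -
          (1 - Real.exp (-((1 - (1 / 2 : ℝ) ^ m) * (ν * marginal W x)))))) (Ici 0) := fun m =>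
      ((hint (m + 1)).sub (hint m)).const_mul _
    have e1 : ∑ m ∈ Finset.range d, r.coeff m * (E (m + 1) - E m) =
        ν * ∫ x in Ici (0 : ℝ), ∑ m ∈ Finset.range d, r.coeff m *
        ((1 - Real.exp (-((1 - (1 / 2 : ℝ) ^ (m + 1)) * (ν * marginal W x)))) -
          (1 - Real.exp (-((1 - (1 / 2 : ℝ) ^ m) * (ν * marginal W x))))) := by
      rw [integral_finsetSum _ fun m _ => hI m, Finset.mul_sum]
      refine Finset.sum_congr rfl fun m _ => ?_
      rw [integral_const_mul, integral_sub (hint _) (hint _)]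
      simp only [hEdef]
      ring
    rw [e1, tailIntegral, ← mul_sub, abs_mul, abs_of_pos hν0, hEdef]
    simp only
    rw [mul_left_comm]
    refine mul_le_mul_of_nonneg_left ?_ hν0.le
    rw [← integral_sub (hW.integrableOn_poissonTail hν0.le K)
      (integrable_finsetSum _ fun m _ => hI m), ← integral_const_mul]
    refine abs_integral_le_integral_abs.trans (integral_mono ?_ ((hint 1).const_mul _) hpt)
    exact ((hW.integrableOn_poissonTail hν0.le K).sub
      (integrable_finsetSum _ fun m _ => hI m)).abs
  have hgood : ∀ᵐ ω ∂P, (∀ m ∈ Finset.range (d + 1), |X m ω - E m| < η * (ν * B)) →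
      |boxSum W p ζ ν M (fun _ n => above K n) ω - ν * tailIntegral W ν K| <
        ε * (ν * B) := by
    filter_upwards [ae_mem_indexEvent hG.poisson (measurableSet_box ν M) (box_subset ν M)
      (volume_box_lt_top ν M)] with ω hω h
    have h1 : |boxSum W p ζ ν M (fun _ n => above K n) ω -
        ∑ m ∈ Finset.range d, r.coeff m * (X (m + 1) ω - X m ω)| ≤ ε / 8 * X 1 ω := by
      have e1 : ∑ m ∈ Finset.range d, r.coeff m * (X (m + 1) ω - X m ω) =
          boxSum W p ζ ν M (fun x n => ∑ m ∈ Finset.range d, r.coeff m *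
            (discount (Ici 0 ∩ Icc 0 M) ((1 / 2) ^ (m + 1)) x n -
              discount (Ici 0 ∩ Icc 0 M) ((1 / 2) ^ m) x n)) ω := by
        simp only [hX, boxSum]
        rw [Finset.sum_comm]
        refine Finset.sum_congr rfl fun m _ => ?_
        rw [← Finset.sum_sub_distrib, Finset.mul_sum]
      have e2 : ε / 8 * X 1 ω = boxSum W p ζ ν M (fun x n => ε / 8 *
          discount (Ici 0 ∩ Icc 0 M) ((1 / 2) ^ 1) x n) ω := by
        simp only [hX, boxSum, Finset.mul_sum]
      rw [e1, e2]
      refine abs_boxSum_sub_le ω (fun x hx n => ?_) hω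
      have hx' : x ∈ Ici 0 ∩ Icc 0 M := ⟨hx.1, hx⟩
      have := hr n
      rw [one_sub_mul_eval] at this
      simpa [discount, indicator_of_mem hx'] using this
    have hm1 := h 1 (by simp [hd])
    have h2 : |∑ m ∈ Finset.range d, r.coeff m * (X (m + 1) ω - X m ω) -
        ∑ m ∈ Finset.range d, r.coeff m * (E (m + 1) - E m)| ≤ R * (2 * (η * (ν * B))) := by
      rw [← Finset.sum_sub_distrib, hR, Finset.sum_mul]
      refine (Finset.abs_sum_le_sum_abs _ _).trans (Finset.sum_le_sum fun m hm => ?_)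
      rw [← mul_sub, abs_mul]
      refine mul_le_mul_of_nonneg_left ?_ (abs_nonneg _)
      rw [Finset.mem_range] at hm
      have a1 := h m (Finset.mem_range.2 (by omega))
      have a2 := h (m + 1) (Finset.mem_range.2 (by omega))
      rw [abs_lt] at a1 a2
      rw [abs_le]
      constructor <;> linarith
    rw [abs_lt] at hm1
    rw [abs_le] at h1 h2 hdet
    have hk1 : R * (2 * (η * (ν * B))) ≤ ε / 4 * (ν * B) := by nlinarith
    have hk2 : ε / 8 * X 1 ω ≤ ε / 4 * (ν * B) := by
      have : X 1 ω ≤ 2 * (ν * B) := by nlinarith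
      nlinarith
    have hk3 : ε / 8 * E 1 ≤ ε / 8 * (ν * B) := by gcongr
    have hk4 : 0 < ε * (ν * B) := by positivity
    rw [abs_lt]
    constructor <;> linarith
  have hsub : deviationEvent W p ζ ν M K ε ≤ᵐ[P]
      (⋃ m ∈ Finset.range (d + 1), {ω | η * (ν * B) ≤ |X m ω - E m|} : Set Ω) := by
    filter_upwards [hgood] with ω hω hdev
    by_contra hcon
    have hcon' : ω ∉ ⋃ m ∈ Finset.range (d + 1), {ω | η * (ν * B) ≤ |X m ω - E m|} := hcon
    refine absurd (hω fun m hm => ?_) (not_lt.2 hdev)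
    by_contra hlt
    exact hcon' (mem_biUnion hm (not_lt.1 hlt))
  refine (measure_mono_ae hsub).trans ((measure_biUnion_finset_le _ _).trans ?_)
  refine (Finset.sum_le_sum fun m _ => hbad m).trans ?_
  rw [Finset.sum_const, Finset.card_range, nsmul_eq_mul, ← ENNReal.ofReal_natCast,
    ← ENNReal.ofReal_mul (Nat.cast_nonneg _)]
  refine ENNReal.ofReal_le_ofReal ?_
  push_cast
  nlinarith

end

/-! ### Large levels: high, middle and low points -/

section

variable {P : Measure Ω} [IsProbabilityMeasure P] {p : ℕ → Ω → ℝ × ℝ} {ζ : Sym2 ℕ → Ω → ℝ}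
  {W : ℝ → ℝ → ℝ}

/-- The points whose mean degree is at least `c`. -/
def highSet (W : ℝ → ℝ → ℝ) (ν c : ℝ) : Set ℝ := {x | 0 ≤ x ∧ c ≤ ν * marginal W x}

/-- The points whose mean degree is at most `c`. -/
def lowSet (W : ℝ → ℝ → ℝ) (ν c : ℝ) : Set ℝ := {x | 0 ≤ x ∧ ν * marginal W x ≤ c}

/-- The points whose mean degree is strictly between `a` and `b`. -/
def midSet (W : ℝ → ℝ → ℝ) (ν a b : ℝ) : Set ℝ :=
  {x | 0 ≤ x ∧ a < ν * marginal W x ∧ ν * marginal W x < b}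

lemma exp_neg_one_le_half : Real.exp (-1) ≤ 1 / 2 := by
  have := Real.exp_one_gt_d9
  rw [Real.exp_neg, inv_le_comm₀ (Real.exp_pos 1) (by norm_num)]
  linarith

/-- For `n > K` the error is `2^{-n} ≤ 2^{-K-1}`, while `1 - 2^{-n} ≥ 1/2`. For `n ≤ K` it is at
most `1 ≤ t^{K-n}`, an exponential weight with small mean when the Poisson mean is at least `tK`. -/
lemma abs_above_sub_le {t : ℝ} (ht : 1 < t) {K : ℕ} (n : ℕ) :
    |above K n - (1 - (1 / 2 : ℝ) ^ n)| ≤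
      t ^ K * (1 / t) ^ n + 2 * (1 / 2) ^ K * (1 - (1 / 2 : ℝ) ^ n) := by
  have h0 : 0 < (1 / 2 : ℝ) ^ n := by positivity
  have h1 : (1 / 2 : ℝ) ^ n ≤ 1 := pow_le_one₀ (by norm_num) (by norm_num)
  have hK : 0 < (1 / 2 : ℝ) ^ K := by positivity
  have ht0 : 0 < t ^ K * (1 / t) ^ n := by positivity
  by_cases h : K < n
  · have h2 : (1 / 2 : ℝ) ^ n ≤ (1 / 2 : ℝ) ^ (K + 1) :=
      pow_le_pow_of_le_one (by norm_num) (by norm_num) h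
    rw [pow_succ] at h2
    have h3 : (1 / 2 : ℝ) ^ K ≤ 1 := pow_le_one₀ (by norm_num) (by norm_num)
    rw [above, if_pos h, sub_sub_cancel, abs_of_pos h0]
    nlinarith
  · have h2 : 1 ≤ t ^ K * (1 / t) ^ n := by
      rw [one_div, inv_pow, ← div_eq_mul_inv, one_le_div (by positivity)]
      exact pow_le_pow_right₀ ht.le (not_lt.1 h)
    rw [above, if_neg h, zero_sub, abs_neg, abs_of_nonneg (by linarith)]
    nlinarith

/-- Exponential Markov bound with 1 subtracted, so that it vanishes at `n = 0` and can be integrated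
over the infinitely long range of low points. -/
lemma above_le_div {t : ℝ} (ht : 1 < t) {K : ℕ} (hK : 1 ≤ K) (n : ℕ) :
    above K n ≤ (t ^ n - 1) / (t ^ K - 1) := by
  have h1 : 1 < t ^ K := one_lt_pow₀ ht (by omega)
  have h2 : 1 ≤ t ^ n := one_le_pow₀ ht.le
  unfold above
  split_ifs with h
  · rw [one_le_div (by linarith)]
    have := pow_le_pow_right₀ ht.le h.le
    linarith
  · exact div_nonneg (by linarith) (by linarith)

/-- Lower Chernoff bound for a Poisson mean `l ≥ tK`. Here `l ≥ 1`, so the factor `2 (1 - e^{-l})`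
is at least 1; it is inserted to make the bound integrable against `degreeMass`. -/
lemma pow_mul_exp_le {t : ℝ} (ht : 1 < t) {K : ℕ} (hK : 1 ≤ K) {l : ℝ} (hl : t * K ≤ l) :
    t ^ K * Real.exp (-((1 - 1 / t) * l)) ≤
      2 * (t * Real.exp (-(t - 1))) ^ K * (1 - Real.exp (-l)) := by
  have hK' : (1 : ℝ) ≤ K := by exact_mod_cast hK
  have ht0 : 0 < t := by linarith
  have h1 : (t - 1) * K ≤ (1 - 1 / t) * l := by
    have e : (t - 1) * K = (1 - 1 / t) * (t * K) := by field_simp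
    rw [e]
    refine mul_le_mul_of_nonneg_left hl (sub_nonneg.2 ?_)
    rw [div_le_one ht0]; exact ht.le
  have h2 : Real.exp (-((1 - 1 / t) * l)) ≤ Real.exp (-(t - 1)) ^ K := by
    rw [← Real.exp_nat_mul]
    exact Real.exp_le_exp.2 (by linarith)
  have h3 : 1 ≤ l := by nlinarith
  have h4 := one_sub_exp_neg_mono h3
  have h5 := exp_neg_one_le_half
  rw [mul_pow]
  have h6 : t ^ K * Real.exp (-((1 - 1 / t) * l)) ≤ t ^ K * Real.exp (-(t - 1)) ^ K :=
    mul_le_mul_of_nonneg_left h2 (by positivity)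
  have h7 : 0 ≤ t ^ K * Real.exp (-(t - 1)) ^ K := by positivity
  nlinarith

/-- With `a = (t - 1) l` the left side is `e^a (1 - e^{-a})`. The first factor is controlled by `l ≤
K / t`, the second by `a ≤ l`, which is where `t ≤ 2` enters. -/
lemma exp_sub_one_le {t : ℝ} (ht : 1 < t) (ht2 : t ≤ 2) {K : ℕ} {l : ℝ} (hl0 : 0 ≤ l)
    (hl : l ≤ K / t) :
    Real.exp (-((1 - t) * l)) - 1 ≤ Real.exp (1 - 1 / t) ^ K * (1 - Real.exp (-l)) := by
  have ht0 : 0 < t := by linarith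
  set a := (t - 1) * l with ha
  have ha0 : 0 ≤ a := mul_nonneg (by linarith) hl0
  have e : Real.exp (-((1 - t) * l)) - 1 = Real.exp a * (1 - Real.exp (-a)) := by
    rw [mul_sub, ← Real.exp_add, ha]; simp; ring
  have h1 : Real.exp a ≤ Real.exp (1 - 1 / t) ^ K := by
    rw [← Real.exp_nat_mul]
    refine Real.exp_le_exp.2 ?_
    have : (t - 1) * l ≤ (t - 1) * (K / t) := mul_le_mul_of_nonneg_left hl (by linarith)
    have e2 : (t - 1) * (K / t) = K * (1 - 1 / t) := by field_simp
    linarith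
  have h2 : 1 - Real.exp (-a) ≤ 1 - Real.exp (-l) := one_sub_exp_neg_mono (by nlinarith)
  rw [e]
  exact mul_le_mul h1 h2 (one_sub_exp_neg_nonneg ha0) (by positivity)

/-- The relative error outside the middle range. -/
def outerError (t : ℝ) (K : ℕ) : ℝ :=
  2 * (t * Real.exp (-(t - 1))) ^ K + 2 * (1 / 2) ^ K + Real.exp (1 - 1 / t) ^ K / (t ^ K - 1)

/-- Three geometric decays: `t e^{-(t-1)} < 1` and `e^{1-1/t} / t < 1` are both the strict
inequality `1 + x < e^x`, at `x = t - 1` and at `x = 1/t - 1`. -/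
lemma tendsto_outerError {t : ℝ} (ht : 1 < t) : Tendsto (outerError t) atTop (𝓝 0) := by
  have ht0 : 0 < t := by linarith
  have h1 : t * Real.exp (-(t - 1)) < 1 := by
    have := Real.add_one_lt_exp (show t - 1 ≠ 0 by linarith)
    rw [Real.exp_neg, ← div_eq_mul_inv, div_lt_one (Real.exp_pos _)]
    linarith
  have h2 : Real.exp (1 - 1 / t) / t < 1 := by
    have hne : -(1 - 1 / t) ≠ 0 := by
      have : 1 / t < 1 := by rw [div_lt_one ht0]; exact ht
      linarith
    have := Real.add_one_lt_exp hne
    rw [div_lt_one ht0]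
    rw [Real.exp_neg] at this
    have h3 : 1 / t < (Real.exp (1 - 1 / t))⁻¹ := by linarith
    rw [one_div, inv_lt_inv₀ ht0 (Real.exp_pos _)] at h3
    simpa using h3
  have a1 := (tendsto_pow_atTop_nhds_zero_of_lt_one (by positivity) h1).const_mul 2
  have a2 := (tendsto_pow_atTop_nhds_zero_of_lt_one (r := (1 / 2 : ℝ)) (by norm_num)
    (by norm_num)).const_mul 2
  have a3 := (tendsto_pow_atTop_nhds_zero_of_lt_one (by positivity) h2).const_mul 2
  have a4 : Tendsto (fun K : ℕ => Real.exp (1 - 1 / t) ^ K / (t ^ K - 1)) atTop (𝓝 0) := by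
    rw [mul_zero] at a3
    refine squeeze_zero' ?_ ?_ a3
    · filter_upwards with K
      exact div_nonneg (by positivity) (by linarith [one_le_pow₀ (n := K) ht.le])
    · filter_upwards [(tendsto_pow_atTop_atTop_of_one_lt ht).eventually_ge_atTop 2] with K hK
      rw [div_pow, ← mul_div_assoc, div_le_div_iff₀ (by linarith) (by positivity)]
      have : 0 < Real.exp (1 - 1 / t) ^ K := by positivity
      nlinarith
  have := (a1.add a2).add a4
  rw [show (2 * 0 + 2 * 0 + 0 : ℝ) = 0 by norm_num] at this
  exact this

namespace IsRegularKernel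

variable (hW : IsRegularKernel W)
include hW

lemma measurableSet_highSet (ν c : ℝ) : MeasurableSet (highSet W ν c) :=
  measurableSet_Ici.inter
    (measurableSet_le measurable_const (hW.measurable_marginal.const_mul ν))

lemma measurableSet_lowSet (ν c : ℝ) : MeasurableSet (lowSet W ν c) :=
  measurableSet_Ici.inter
    (measurableSet_le (hW.measurable_marginal.const_mul ν) measurable_const)

lemma measurableSet_midSet (ν a b : ℝ) : MeasurableSet (midSet W ν a b) :=
  measurableSet_Ici.inter
    ((measurableSet_lt measurable_const (hW.measurable_marginal.const_mul ν)).inter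
    (measurableSet_lt (hW.measurable_marginal.const_mul ν) measurable_const))

/-- By regularity of the marginal the middle range is short. -/
lemma volume_midSet_le {χ : ℝ} (hχ : 0 < χ)
    (hreg : AntitoneOn (fun x => x * marginal W x) (Ioi χ)) {ν : ℝ} (hν : 0 < ν) {t : ℝ}
    (ht : 1 < t) (ht2 : t ≤ 2) {K : ℕ} (hK : 1 ≤ K) :
    volume (midSet W ν (K / t) (t * K)) ≤
      ENNReal.ofReal (χ + 9 * (t - 1) * degreeMass W ν) := by
  have hB0 := hW.degreeMass_nonneg hν.le
  have hK' : (1 : ℝ) ≤ K := by exact_mod_cast hK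
  have ht0 : 0 < t := by linarith
  set S := midSet W ν (K / t) (t * K) ∩ Ioi χ with hS
  have hcover : midSet W ν (K / t) (t * K) ⊆ Icc 0 χ ∪ S := fun x hx => by
    by_cases h : x ≤ χ
    · exact Or.inl ⟨hx.1, h⟩
    · exact Or.inr ⟨hx, not_le.1 h⟩
  have hSvol : volume S ≤ ENNReal.ofReal (9 * (t - 1) * degreeMass W ν) := by
    rcases S.eq_empty_or_nonempty with hemp | ⟨x₀, hx₀⟩
    · rw [hemp, measure_empty]; exact zero_le
    · have hbdd : BddBelow S := ⟨χ, fun x hx => hx.2.le⟩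
      -- Between the two ends of the range `ν μ` drops by a factor less than `t²`. As `x μ(x)`
      -- decreases, `x` can then grow at most by that factor.
      have hratio : ∀ x ∈ S, ∀ y ∈ S, y ≤ t ^ 2 * x := by
        intro x hx y hy
        have hx0 : 0 < x := hχ.trans hx.2
        rcases le_total y x with h | h
        · exact h.trans (le_mul_of_one_le_left hx0.le (one_le_pow₀ ht.le))
        · have h1 : y * marginal W y ≤ x * marginal W x := hreg hx.2 hy.2 h
          have h2 : K / t < ν * marginal W y := hy.1.2.1
          have h3 : ν * marginal W x < t * K := hx.1.2.2
          rw [div_lt_iff₀ ht0] at h2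
          have h4 : y * (ν * marginal W y) ≤ x * (ν * marginal W x) := by nlinarith
          have h5 : 0 < y := hx0.trans_le h
          have h6 : y * K ≤ t ^ 2 * x * K := by
            calc y * K ≤ y * (ν * marginal W y * t) := by gcongr
              _ = t * (y * (ν * marginal W y)) := by ring
              _ ≤ t * (x * (ν * marginal W x)) := by gcongr
              _ ≤ t * (x * (t * K)) := by gcongr
              _ = _ := by ring
          exact le_of_mul_le_mul_right h6 (by linarith)
      have hx00 : 0 ≤ x₀ := hx₀.1.1
      -- On `[0, x₀]` the mean degree is at least `K / t ≥ 1/2`, so the integrand of `degreeMass` is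
      -- at least `1 - e^{-1/2} ≥ 1/3`.
      have hlow : x₀ ≤ 3 * degreeMass W ν := by
        have h1 : ∫ _ in Icc 0 x₀, (1 / 3 : ℝ) ≤ degreeMass W ν := by
          refine (setIntegral_mono_on (integrable_const _)
            ((hW.integrableOn_one_sub_exp hν.le).mono_set Icc_subset_Ici_self)
            measurableSet_Icc fun x hx => ?_).trans
            (setIntegral_mono_set (hW.integrableOn_one_sub_exp hν.le) (ae_of_all _ fun x =>
              one_sub_exp_neg_nonneg (mul_nonneg hν.le (hW.marginal_nonneg x)))
              Icc_subset_Ici_self.eventuallyLE)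
          have h3 := hW.antitone (show x ∈ Ici 0 from hx.1) (show x₀ ∈ Ici 0 from hx00) hx.2
          have h2 : K / t < ν * marginal W x₀ := hx₀.1.2.1
          have h4 : (1 / 2 : ℝ) ≤ K / t := by
            rw [div_le_div_iff₀ (by norm_num) ht0]; linarith
          have h5 := one_sub_exp_neg_mono
            (h4.trans (h2.le.trans (mul_le_mul_of_nonneg_left h3 hν.le)))
          have h6 : Real.exp (-(1 / 2)) ≤ 2 / 3 := by
            have := Real.add_one_le_exp (1 / 2 : ℝ)
            rw [Real.exp_neg, inv_le_comm₀ (Real.exp_pos _) (by norm_num)]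
            linarith
          linarith
        simp only [setIntegral_const, Measure.real, Real.volume_Icc, sub_zero,
          ENNReal.toReal_ofReal hx00, smul_eq_mul] at h1
        linarith
      -- The range lies in `[a, t² a]` with `a ≤ 3B`, and `t² - 1 ≤ 3 (t - 1)`; this is the origin
      -- of the constant 9.
      set a := sInf S
      have ha : a ≤ x₀ := csInf_le hbdd hx₀
      have hsub : S ⊆ Icc a (t ^ 2 * a) := fun y hy => by
        refine ⟨csInf_le hbdd hy, ?_⟩
        have h1 : y / t ^ 2 ≤ a := le_csInf ⟨x₀, hx₀⟩ fun x hx => by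
          rw [div_le_iff₀ (by positivity)]
          linarith [hratio x hx y hy]
        rw [div_le_iff₀ (by positivity)] at h1
        linarith
      refine (measure_mono hsub).trans ?_
      rw [Real.volume_Icc]
      refine ENNReal.ofReal_le_ofReal ?_
      have h1 : a ≤ 3 * degreeMass W ν := ha.trans hlow
      have h2 : t ^ 2 - 1 ≤ 3 * (t - 1) := by nlinarith
      have h3 : 0 ≤ t ^ 2 - 1 := by nlinarith
      calc t ^ 2 * a - a = (t ^ 2 - 1) * a := by ring
        _ ≤ (t ^ 2 - 1) * (3 * degreeMass W ν) := by gcongr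
        _ ≤ 3 * (t - 1) * (3 * degreeMass W ν) := by gcongr
        _ = _ := by ring
  refine (measure_mono hcover).trans ((measure_union_le _ _).trans ?_)
  rw [ENNReal.ofReal_add hχ.le (mul_nonneg (by linarith) hB0)]
  refine add_le_add ?_ hSvol
  simp

/-- The deterministic counterpart of the approximation by high points. -/
lemma abs_tailIntegral_sub_le {χ : ℝ} (hχ : 0 < χ)
    (hreg : AntitoneOn (fun x => x * marginal W x) (Ioi χ)) {ν : ℝ} (hν : 0 < ν) {t : ℝ}
    (ht : 1 < t) (ht2 : t ≤ 2) {K : ℕ} (hK : 1 ≤ K) :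
    |tailIntegral W ν K - ∫ x in highSet W ν (t * K),
      (1 - Real.exp (-((1 - 1 / 2) * (ν * marginal W x))))| ≤
      χ + 9 * (t - 1) * degreeMass W ν + outerError t K * degreeMass W ν := by
  have ht0 : 0 < t := by linarith
  have hB0 := hW.degreeMass_nonneg hν.le
  have hlam : ∀ x, 0 ≤ ν * marginal W x := fun x => mul_nonneg hν.le (hW.marginal_nonneg x)
  set H := highSet W ν (t * K) with hH
  set Mid := midSet W ν (K / t) (t * K) with hMid
  have hHm : MeasurableSet H := hW.measurableSet_highSet _ _
  have hMm : MeasurableSet Mid := hW.measurableSet_midSet _ _ _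
  have hvol := hW.volume_midSet_le hχ hreg hν ht ht2 hK
  have hH0 : H ⊆ Ici 0 := fun x hx => hx.1
  have hM0 : Mid ⊆ Ici 0 := fun x hx => hx.1
  have hint : IntegrableOn (fun x => 1 - Real.exp (-((1 - 1 / 2) * (ν * marginal W x))))
      (Ici 0) := by
    simp_rw [← mul_assoc]
    exact hW.integrableOn_one_sub_exp (mul_nonneg (by norm_num) hν.le)
  set u : ℝ → ℝ := H.indicator fun x => 1 - Real.exp (-((1 - 1 / 2) * (ν * marginal W x))) with hu
  have hui : IntegrableOn u (Ici 0) := hint.indicator hHm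
  have hmi : IntegrableOn (Mid.indicator (1 : ℝ → ℝ)) (Ici 0) := by
    refine IntegrableOn.integrable_indicator (f := 1) ?_ hMm |>.integrableOn
    exact (integrableOn_const (C := (1 : ℝ)) (hvol.trans_lt ENNReal.ofReal_lt_top).ne)
  -- High points: the tail is close to the mean discount. Middle points: the trivial bound 1. Low
  -- points: exponential Markov. Every error outside the middle range carries the integrable factor
  -- `1 - e^{-νμ}`.
  have hpt : ∀ x ∈ Ici (0 : ℝ), |poissonTail K (ν * marginal W x) - u x| ≤
      Mid.indicator 1 x + outerError t K * (1 - Real.exp (-(ν * marginal W x))) := by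
    intro x hx
    set l := ν * marginal W x with hl
    have hl0 : 0 ≤ l := hlam x
    have hs := hasSum_poissonWeight l
    have hp := hasSum_poissonWeight_mul_pow l
    have h1l := one_sub_exp_neg_nonneg hl0
    have hK1 : 1 < t ^ K := one_lt_pow₀ ht (by omega)
    have hκ1 : 0 ≤ 2 * (t * Real.exp (-(t - 1))) ^ K * (1 - Real.exp (-l)) :=
      mul_nonneg (by positivity) h1l
    have hκ2 : 0 ≤ Real.exp (1 - 1 / t) ^ K / (t ^ K - 1) * (1 - Real.exp (-l)) :=
      mul_nonneg (div_nonneg (by positivity) (by linarith)) h1l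
    have hκ3 : 0 ≤ 2 * (1 / 2 : ℝ) ^ K * (1 - Real.exp (-l)) :=
      mul_nonneg (by positivity) h1l
    have hexp : outerError t K * (1 - Real.exp (-l)) =
        2 * (t * Real.exp (-(t - 1))) ^ K * (1 - Real.exp (-l)) +
        2 * (1 / 2) ^ K * (1 - Real.exp (-l)) +
        Real.exp (1 - 1 / t) ^ K / (t ^ K - 1) * (1 - Real.exp (-l)) := by
      rw [outerError]; ring
    rw [hexp]
    have hind : 0 ≤ Mid.indicator (1 : ℝ → ℝ) x := indicator_one_nonneg _ x
    by_cases hxH : x ∈ H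
    · have h1 := abs_poissonTail_sub_le hl0 (K := K)
        (g := fun n => 1 - (1 / 2 : ℝ) ^ n)
        (R := fun n => t ^ K * (1 / t) ^ n + 2 * (1 / 2) ^ K * (1 - (1 / 2 : ℝ) ^ n))
        ((hs.sub (hp (1 / 2))).of_forall_eq fun n => by ring)
        ((((hp (1 / t)).mul_left (t ^ K)).add
          ((hs.sub (hp (1 / 2))).mul_left (2 * (1 / 2) ^ K))).of_forall_eq fun n => by ring)
        (abs_above_sub_le ht)
      have h2 := pow_mul_exp_le ht hK hxH.2
      have h3 : 2 * (1 / 2 : ℝ) ^ K * (1 - Real.exp (-((1 - 1 / 2) * l))) ≤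
          2 * (1 / 2 : ℝ) ^ K * (1 - Real.exp (-l)) :=
        mul_le_mul_of_nonneg_left (one_sub_exp_neg_mono (by linarith)) (by positivity)
      simp only [hu, indicator_of_mem hxH]
      linarith
    · simp only [hu, indicator_of_notMem hxH, sub_zero]
      rw [abs_of_nonneg (poissonTail_nonneg hl0 K)]
      by_cases hxM : x ∈ Mid
      · have h1 := poissonTail_le hl0 K
        rw [indicator_of_mem hxM]
        simp only [Pi.one_apply]
        linarith [Real.exp_pos (-l)]
      · have hxL : l ≤ K / t := by
          by_contra hc
          exact hxM ⟨hx, not_le.1 hc, not_le.1 fun h => hxH ⟨hx, h⟩⟩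
        have h1 := hasSum_le (f := fun n => poissonWeight l n * above K n)
          (g := fun n => poissonWeight l n * ((t ^ n - 1) / (t ^ K - 1)))
          (fun n => mul_le_mul_of_nonneg_left (above_le_div ht hK n) (poissonWeight_nonneg hl0 n))
          (hasSum_poissonWeight_mul_above l K)
          ((((hp t).sub hs).div_const (t ^ K - 1)).of_forall_eq fun n => by ring)
        have h2 := exp_sub_one_le ht ht2 hl0 hxL
        have h3 := div_le_div_of_nonneg_right h2 (show 0 ≤ t ^ K - 1 by linarith)
        have e : Real.exp (1 - 1 / t) ^ K * (1 - Real.exp (-l)) / (t ^ K - 1) =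
            Real.exp (1 - 1 / t) ^ K / (t ^ K - 1) * (1 - Real.exp (-l)) := by ring
        linarith
  have e1 : ∫ x in H, (1 - Real.exp (-((1 - 1 / 2) * (ν * marginal W x)))) =
      ∫ x in Ici (0 : ℝ), u x := by
    rw [hu, integral_indicator hHm, Measure.restrict_restrict hHm, inter_eq_left.2 hH0]
  have hri : IntegrableOn (fun x => Mid.indicator (1 : ℝ → ℝ) x +
      outerError t K * (1 - Real.exp (-(ν * marginal W x)))) (Ici 0) :=
    hmi.add ((hW.integrableOn_one_sub_exp hν.le).const_mul _)
  have hti := hW.integrableOn_poissonTail hν.le K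
  rw [e1, tailIntegral, ← integral_sub hti hui]
  refine abs_integral_le_integral_abs.trans
    ((setIntegral_mono_on (hti.sub hui).abs hri measurableSet_Ici hpt).trans ?_)
  rw [integral_add hmi ((hW.integrableOn_one_sub_exp hν.le).const_mul _), integral_const_mul]
  refine add_le_add ?_ le_rfl
  rw [integral_indicator hMm, Measure.restrict_restrict hMm, inter_eq_left.2 hM0]
  simp only [Pi.one_apply, integral_const, smul_eq_mul, mul_one, Measure.real,
    Measure.restrict_apply_univ]
  exact ENNReal.toReal_le_of_le_ofReal
    (add_nonneg hχ.le (mul_nonneg (by linarith) hB0)) hvol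

end IsRegularKernel

end

/-! ### Large levels: concentration -/

section

variable {P : Measure Ω} [IsProbabilityMeasure P] {p : ℕ → Ω → ℝ × ℝ} {ζ : Sym2 ℕ → Ω → ℝ}
  {W : ℝ → ℝ → ℝ}

/-- The error in approximating the indicator of `K < n` by the discounted indicator of the
high points. -/
def remainder (W : ℝ → ℝ → ℝ) (ν M t : ℝ) (K : ℕ) (x : ℝ) (n : ℕ) : ℝ :=
  (midSet W ν (K / t) (t * K) ∩ Icc 0 M).indicator 1 x * 1 ^ n +
    t ^ K * ((highSet W ν (t * K) ∩ Icc 0 M).indicator 1 x * (1 / t) ^ n) +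
    2 * (1 / 2) ^ K * discount (highSet W ν (t * K) ∩ Icc 0 M) (1 / 2) x n +
    (t ^ K - 1)⁻¹ * ((lowSet W ν (K / t) ∩ Icc 0 M).indicator 1 x * t ^ n -
      (lowSet W ν (K / t) ∩ Icc 0 M).indicator 1 x * 1 ^ n)

lemma remainder_nonneg (ν M : ℝ) {t : ℝ} (ht : 1 < t) (K : ℕ) (x : ℝ) (n : ℕ) :
    0 ≤ remainder W ν M t K x n := by
  have h1 := indicator_one_nonneg (midSet W ν (K / t) (t * K) ∩ Icc 0 M) x
  have h2 := indicator_one_nonneg (highSet W ν (t * K) ∩ Icc 0 M) x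
  have h3 := indicator_one_nonneg (lowSet W ν (K / t) ∩ Icc 0 M) x
  have h4 := discount_nonneg (highSet W ν (t * K) ∩ Icc 0 M) (s := 1 / 2) (by norm_num)
    (by norm_num) x n
  have h5 := one_le_pow₀ (n := K) ht.le
  have h6 := one_le_pow₀ (n := n) ht.le
  have h7 : 0 ≤ (lowSet W ν (K / t) ∩ Icc 0 M).indicator 1 x * t ^ n -
      (lowSet W ν (K / t) ∩ Icc 0 M).indicator 1 x * 1 ^ n := by
    rw [one_pow, ← mul_sub]; exact mul_nonneg h3 (by linarith)
  have h8 : 0 ≤ (t ^ K - 1)⁻¹ := inv_nonneg.2 (by linarith)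
  have ht0 : 0 < t := by linarith
  unfold remainder
  positivity

/-- High, middle and low points exhaust the box, and each of them is served by its own terms of the
remainder: `abs_above_sub_le`, the bound 1, and `above_le_div`. -/
lemma abs_above_sub_discount_le {ν M t : ℝ} (ht : 1 < t) {K : ℕ} (hK : 1 ≤ K) {x : ℝ}
    (hx : x ∈ Icc 0 M) (n : ℕ) :
    |above K n - discount (highSet W ν (t * K) ∩ Icc 0 M) (1 / 2) x n| ≤
      remainder W ν M t K x n := by
  have ht0 : 0 < t := by linarith
  have hK1 : 1 < t ^ K := one_lt_pow₀ ht (by omega)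
  have htn := one_le_pow₀ (n := n) ht.le
  have hl : 0 ≤ (t ^ K - 1)⁻¹ * ((lowSet W ν (K / t) ∩ Icc 0 M).indicator 1 x * t ^ n -
      (lowSet W ν (K / t) ∩ Icc 0 M).indicator 1 x * 1 ^ n) := by
    rw [one_pow, ← mul_sub]
    exact mul_nonneg (inv_nonneg.2 (by linarith))
      (mul_nonneg (indicator_one_nonneg _ x) (by linarith))
  have hm := indicator_one_nonneg (midSet W ν (K / t) (t * K) ∩ Icc 0 M) x
  unfold remainder
  by_cases hxH : x ∈ highSet W ν (t * K)
  · have := abs_above_sub_le ht (K := K) n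
    rw [discount, indicator_of_mem (show x ∈ highSet W ν (t * K) ∩ Icc 0 M from ⟨hxH, hx⟩)]
    simp only [Pi.one_apply, one_mul, one_pow, mul_one] at hl ⊢
    linarith
  · have hn : x ∉ highSet W ν (t * K) ∩ Icc 0 M := fun h => hxH h.1
    rw [discount, indicator_of_notMem hn]
    simp only [zero_mul, mul_zero, sub_zero, add_zero, one_pow, mul_one]
    rw [abs_of_nonneg (above_nonneg K n)]
    by_cases hxM : x ∈ midSet W ν (K / t) (t * K)
    · rw [indicator_of_mem (show x ∈ midSet W ν (K / t) (t * K) ∩ Icc 0 M from ⟨hxM, hx⟩)]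
      simp only [one_pow, mul_one] at hl
      have := above_le_one K n
      simp only [Pi.one_apply]
      linarith
    · have hxL : x ∈ lowSet W ν (K / t) := by
        refine ⟨hx.1, ?_⟩
        by_contra hc
        exact hxM ⟨hx.1, not_le.1 hc, not_le.1 fun h => hxH ⟨hx.1, h⟩⟩
      rw [indicator_of_mem (show x ∈ lowSet W ν (K / t) ∩ Icc 0 M from ⟨hxL, hx⟩)]
      have := above_le_div ht hK n
      rw [div_eq_inv_mul] at this
      simp only [Pi.one_apply, one_mul]
      linarith

/-- No concentration is needed for the remainder, since it is nonnegative and its mean is already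
small compared with `νB`. Every term is a generating function, with parameters `1`, `1/t`, `1/2` and
`t`. -/
lemma integral_boxSum_remainder_le (hG : IsKEGSource P p ζ) (hW : IsRegularKernel W) {χ : ℝ}
    (hχ : 0 < χ) (hreg : AntitoneOn (fun x => x * marginal W x) (Ioi χ)) {ν M : ℝ} (hν : 0 < ν)
    (hM : 0 ≤ M) {t : ℝ} (ht : 1 < t) (ht2 : t ≤ 2) {K : ℕ} (hK : 1 ≤ K) :
    Integrable (boxSum W p ζ ν M (remainder W ν M t K)) P ∧
    ∫ ω, boxSum W p ζ ν M (remainder W ν M t K) ω ∂P ≤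
      ν * (χ + 9 * (t - 1) * degreeMass W ν + outerError t K * degreeMass W ν +
        t ^ K * (ν * tailMass W M)) := by
  have hE := hW.toIsEdgeKernel
  have ht0 : 0 < t := by linarith
  have hK1 : 1 < t ^ K := one_lt_pow₀ ht (by omega)
  have hB0 := hW.degreeMass_nonneg hν.le
  set S1 := midSet W ν (K / t) (t * K) ∩ Icc 0 M with hS1
  set S2 := highSet W ν (t * K) ∩ Icc 0 M with hS2
  set S3 := lowSet W ν (K / t) ∩ Icc 0 M with hS3
  have m1 : MeasurableSet S1 := (hW.measurableSet_midSet _ _ _).inter measurableSet_Icc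
  have m2 : MeasurableSet S2 := (hW.measurableSet_highSet _ _).inter measurableSet_Icc
  have m3 : MeasurableSet S3 := (hW.measurableSet_lowSet _ _).inter measurableSet_Icc
  have s1 : S1 ⊆ Icc 0 M := inter_subset_right
  have s2 : S2 ⊆ Icc 0 M := inter_subset_right
  have s3 : S3 ⊆ Icc 0 M := inter_subset_right
  have s20 : S2 ⊆ Ici 0 := s2.trans Icc_subset_Ici_self
  have s30 : S3 ⊆ Ici 0 := s3.trans Icc_subset_Ici_self
  obtain ⟨i1, e1⟩ := integral_boxSum_pow hG hE hν.le hM m1 s1 zero_le_one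
  obtain ⟨i2, e2⟩ := integral_boxSum_pow hG hE hν.le hM m2 s2 (show 0 ≤ 1 / t by positivity)
  obtain ⟨i3, e3⟩ := integral_boxSum_discount hG hE hν.le hM m2 s2
    (show (0 : ℝ) ≤ 1 / 2 by norm_num)
  obtain ⟨i4, e4⟩ := integral_boxSum_pow hG hE hν.le hM m3 s3 ht0.le
  obtain ⟨i5, e5⟩ := integral_boxSum_pow hG hE hν.le hM m3 s3 zero_le_one
  have hsplit : boxSum W p ζ ν M (remainder W ν M t K) = fun ω =>
      boxSum W p ζ ν M (fun x n => S1.indicator 1 x * 1 ^ n) ω +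
      t ^ K * boxSum W p ζ ν M (fun x n => S2.indicator 1 x * (1 / t) ^ n) ω +
      2 * (1 / 2) ^ K * boxSum W p ζ ν M (discount S2 (1 / 2)) ω +
      (t ^ K - 1)⁻¹ * (boxSum W p ζ ν M (fun x n => S3.indicator 1 x * t ^ n) ω -
        boxSum W p ζ ν M (fun x n => S3.indicator 1 x * 1 ^ n) ω) := by
    funext ω
    simp only [boxSum, remainder, Finset.sum_add_distrib, Finset.mul_sum, Finset.sum_sub_distrib,
      mul_sub, ← hS1, ← hS2, ← hS3]
  have j12 : Integrable (fun ω => boxSum W p ζ ν M (fun x n => S1.indicator 1 x * 1 ^ n) ω +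
      t ^ K * boxSum W p ζ ν M (fun x n => S2.indicator 1 x * (1 / t) ^ n) ω) P :=
    i1.add (i2.const_mul _)
  have j123 : Integrable (fun ω => boxSum W p ζ ν M (fun x n => S1.indicator 1 x * 1 ^ n) ω +
      t ^ K * boxSum W p ζ ν M (fun x n => S2.indicator 1 x * (1 / t) ^ n) ω +
      2 * (1 / 2) ^ K * boxSum W p ζ ν M (discount S2 (1 / 2)) ω) P := j12.add (i3.const_mul _)
  have j45 : Integrable (fun ω => (t ^ K - 1)⁻¹ *
      (boxSum W p ζ ν M (fun x n => S3.indicator 1 x * t ^ n) ω -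
        boxSum W p ζ ν M (fun x n => S3.indicator 1 x * 1 ^ n) ω)) P := (i4.sub i5).const_mul _
  rw [hsplit]
  refine ⟨j123.add j45, ?_⟩
  rw [integral_add j123 j45, integral_add j12 (i3.const_mul _), integral_add i1 (i2.const_mul _),
    integral_const_mul, integral_const_mul, integral_const_mul, integral_sub i4 i5, e1, e2, e3, e4,
    e5]
  have b1 : ∫ x in S1, Real.exp (-((1 - 1) * (ν * truncMarginal W M x))) ≤
      χ + 9 * (t - 1) * degreeMass W ν := by
    simp only [sub_self, zero_mul, neg_zero, Real.exp_zero, integral_const, smul_eq_mul, mul_one,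
      Measure.real, Measure.restrict_apply_univ]
    exact ENNReal.toReal_le_of_le_ofReal (add_nonneg hχ.le (mul_nonneg (by linarith) hB0))
      ((measure_mono inter_subset_left).trans (hW.volume_midSet_le hχ hreg hν ht ht2 hK))
  have hint := hW.integrableOn_one_sub_exp hν.le
  have hdiff : IntegrableOn (fun x => marginal W x - truncMarginal W M x) (Ici 0) :=
    hW.integrableOn_marginal.sub (hW.integrableOn_truncMarginal M)
  have hle : ∀ S ⊆ Ici (0 : ℝ), ∫ x in S, (1 - Real.exp (-(ν * marginal W x))) ≤
      degreeMass W ν := fun S hS =>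
    setIntegral_mono_set hint (ae_of_all _ fun x =>
      one_sub_exp_neg_nonneg (mul_nonneg hν.le (hW.marginal_nonneg x))) hS.eventuallyLE
  -- Truncation lowers the mean degree, which hurts the lower tail bound. The loss is multiplied by
  -- `t ^ K ≤ 2 ^ K`, and this is why `M` has to satisfy `2 ^ K * (ν * tailMass W M) ≤ 1`.
  have b2 : t ^ K * ∫ x in S2, Real.exp (-((1 - 1 / t) * (ν * truncMarginal W M x))) ≤
      2 * (t * Real.exp (-(t - 1))) ^ K * degreeMass W ν + t ^ K * (ν * tailMass W M) := by
    have hI1 := integrableOn_exp_truncMarginal hE hM s2 (-((1 - 1 / t) * ν))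
    simp only [neg_mul, mul_assoc] at hI1
    have hI2 : IntegrableOn (fun x => 2 * (t * Real.exp (-(t - 1))) ^ K *
        (1 - Real.exp (-(ν * marginal W x))) +
        t ^ K * (ν * (marginal W x - truncMarginal W M x))) S2 :=
      ((hint.mono_set s20).const_mul _).add (((hdiff.mono_set s20).const_mul ν).const_mul (t ^ K))
    rw [← integral_const_mul]
    refine (setIntegral_mono_on (hI1.const_mul _) hI2 m2 fun x hx => ?_).trans ?_
    · have h1 := pow_mul_exp_le ht hK hx.1.2
      have hc0 : 0 ≤ 1 - 1 / t := by
        rw [sub_nonneg, div_le_one ht0]; exact ht.le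
      have hc1 : 1 - 1 / t ≤ 1 := by
        have : 0 < 1 / t := by positivity
        linarith
      have h2 := mul_nonneg hν.le (truncMarginal_nonneg hE M x)
      have h3 := mul_le_mul_of_nonneg_left (hW.truncMarginal_le_marginal M (s20 hx)) hν.le
      have h4 := exp_neg_sub_exp_neg_le (mul_nonneg hc0 h2) (mul_le_mul_of_nonneg_left h3 hc0)
      have h5 : Real.exp (-((1 - 1 / t) * (ν * truncMarginal W M x))) ≤
          Real.exp (-((1 - 1 / t) * (ν * marginal W x))) +
            ν * (marginal W x - truncMarginal W M x) := by nlinarith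
      have h6 := mul_le_mul_of_nonneg_left h5 (show 0 ≤ t ^ K by positivity)
      linarith
    · rw [integral_add ((hint.mono_set s20).const_mul _)
        (((hdiff.mono_set s20).const_mul ν).const_mul (t ^ K)), integral_const_mul,
        integral_const_mul, integral_const_mul]
      refine add_le_add (mul_le_mul_of_nonneg_left (hle S2 s20) (by positivity)) ?_
      refine mul_le_mul_of_nonneg_left (mul_le_mul_of_nonneg_left ?_ hν.le) (by positivity)
      exact hW.integral_marginal_sub_truncMarginal_le hM s2
  have b3 : 2 * (1 / 2 : ℝ) ^ K * discountMean W ν M S2 (1 / 2) ≤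
      2 * (1 / 2 : ℝ) ^ K * degreeMass W ν :=
    mul_le_mul_of_nonneg_left (hW.discountMean_le hν.le m2 s2 (by norm_num) (by norm_num))
      (by positivity)
  -- For low points truncation only helps: a smaller mean makes an upper tail smaller.
  have b4 : (t ^ K - 1)⁻¹ * ((∫ x in S3, Real.exp (-((1 - t) * (ν * truncMarginal W M x)))) -
      ∫ x in S3, Real.exp (-((1 - 1) * (ν * truncMarginal W M x)))) ≤
      Real.exp (1 - 1 / t) ^ K / (t ^ K - 1) * degreeMass W ν := by
    have hI1 := integrableOn_exp_truncMarginal hE hM s3 (-((1 - t) * ν))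
    have hI2 := integrableOn_exp_truncMarginal hE hM s3 (-((1 - 1) * ν))
    simp only [neg_mul, mul_assoc] at hI1 hI2
    rw [← integral_sub hI1 hI2, div_eq_inv_mul, mul_assoc]
    refine mul_le_mul_of_nonneg_left ?_ (inv_nonneg.2 (by linarith))
    refine le_trans ?_ (mul_le_mul_of_nonneg_left (hle S3 s30) (by positivity))
    rw [← integral_const_mul]
    refine setIntegral_mono_on (hI1.sub hI2) ((hint.mono_set s30).const_mul _) m3 fun x hx => ?_
    have h2 := mul_nonneg hν.le (truncMarginal_nonneg hE M x)
    have h3 := mul_le_mul_of_nonneg_left (hW.truncMarginal_le_marginal M (s30 hx)) hν.le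
    have h4 := exp_sub_one_le ht ht2 h2 (h3.trans hx.1.2)
    simp only [sub_self, zero_mul, neg_zero, Real.exp_zero]
    refine h4.trans (mul_le_mul_of_nonneg_left (one_sub_exp_neg_mono h3) (by positivity))
  have hsum := add_le_add (add_le_add (add_le_add b1 b2) b3) b4
  have := mul_le_mul_of_nonneg_left hsum hν.le
  refine le_trans (le_of_eq ?_) (this.trans (le_of_eq ?_))
  · ring
  · rw [outerError]; ring

/-- Concentration of the count of degrees above a level, uniformly in large levels. -/
lemma eventually_deviationEvent_le_large (hG : IsKEGSource P p ζ) (hW : IsRegularKernel W)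
    {ε : ℝ} (hε : 0 < ε) : ∃ K₀ : ℕ, ∀ᶠ ν in atTop, ∀ K ≥ K₀, ∀ M ≥ 0,
      2 ^ K * (ν * tailMass W M) ≤ 1 →
      P (deviationEvent W p ζ ν M K ε) ≤ ENNReal.ofReal ε := by
  obtain ⟨χ, hχ, hreg⟩ := hW.regular
  -- The mean remainder over `ν` has four parts, each at most `η B`: `χ`, the middle range (`t` is
  -- chosen with `9 (t - 1) = η`), the outer error and the truncation. Thus `4η ≤ ε²/6` feeds
  -- Markov's inequality at the level `(ε/3) νB`, and `3η ≤ ε/8` the deterministic comparison.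
  set η := min ε (min (ε ^ 2) 1) / 24 with hη
  have hη0 : 0 < η := by positivity
  have hη1 : η ≤ ε / 24 := div_le_div_of_nonneg_right (min_le_left _ _) (by norm_num)
  have hη2 : η ≤ ε ^ 2 / 24 := div_le_div_of_nonneg_right ((min_le_right _ _).trans (min_le_left _ _)) (by norm_num)
  have hη3 : η ≤ 1 / 24 :=
    div_le_div_of_nonneg_right ((min_le_right _ _).trans (min_le_right _ _)) (by norm_num)
  set t := 1 + η / 9 with ht
  have ht1 : 1 < t := by rw [ht]; linarith [div_pos hη0 (show (0 : ℝ) < 9 by norm_num)]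
  have ht2 : t ≤ 2 := by rw [ht]; linarith
  have ht9 : 9 * (t - 1) = η := by rw [ht]; ring
  obtain ⟨K₁, hK₁⟩ := eventually_atTop.1 ((tendsto_outerError ht1).eventually_le_const hη0)
  refine ⟨max 1 K₁, ?_⟩
  filter_upwards [eventually_boxSum_discount_concentrated hG hW (show 0 < ε / 3 by positivity),
    eventually_gt_atTop 0, hW.tendsto_degreeMass.eventually_gt_atTop 0,
    hW.tendsto_degreeMass.eventually_ge_atTop (χ / η),
    hW.tendsto_degreeMass.eventually_ge_atTop (1 / η)] with ν hν hν0 hB0 hBχ hB1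
  intro K hK M hM hδ
  have hK1 : 1 ≤ K := (le_max_left _ _).trans hK
  have hout := hK₁ K ((le_max_right _ _).trans hK)
  set B := degreeMass W ν with hBdef
  rw [div_le_iff₀ hη0] at hBχ hB1
  have hνB : 0 < ν * B := by positivity
  have hτ : 0 ≤ ν * tailMass W M := mul_nonneg hν0.le (hW.tailMass_nonneg M)
  have hδ1 : ν * tailMass W M ≤ 1 := by
    have : (1 : ℝ) ≤ 2 ^ K := one_le_pow₀ (by norm_num)
    nlinarith
  have hδt : t ^ K * (ν * tailMass W M) ≤ 1 :=
    (mul_le_mul_of_nonneg_right (pow_le_pow_left₀ (by linarith) ht2 K) hτ).trans hδ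
  have hdet := hW.abs_tailIntegral_sub_le hχ hreg hν0 ht1 ht2 hK1
  obtain ⟨hRi, hRe⟩ := integral_boxSum_remainder_le hG hW hχ hreg hν0 hM ht1 ht2 hK1
  rw [ht9] at hdet hRe
  have hconc := hν M hM hδ1 (highSet W ν (t * K)) (hW.measurableSet_highSet _ _)
    (fun x hx => hx.1) (1 / 2) (by norm_num) (by norm_num)
  set X := boxSum W p ζ ν M (discount (highSet W ν (t * K) ∩ Icc 0 M) (1 / 2))
  set E := ∫ x in highSet W ν (t * K), (1 - Real.exp (-((1 - 1 / 2) * (ν * marginal W x))))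
  set R := boxSum W p ζ ν M (remainder W ν M t K) with hR
  have hoB : outerError t K * B ≤ η * B := by gcongr
  have hRe' : ∫ ω, R ω ∂P ≤ ε / 3 * (ν * B) * (ε / 2) := by
    refine hRe.trans ?_
    have h1 : χ + η * B + outerError t K * B + t ^ K * (ν * tailMass W M) ≤ ε ^ 2 / 6 * B := by
      nlinarith
    calc _ ≤ ν * (ε ^ 2 / 6 * B) := mul_le_mul_of_nonneg_left h1 hν0.le
      _ = _ := by ring
  have hR0 : ∀ ω, 0 ≤ R ω := fun ω =>
    Finset.sum_nonneg fun i _ => remainder_nonneg ν M ht1 K _ _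
  have hmarkov : P {ω | ε / 3 * (ν * B) ≤ R ω} ≤ ENNReal.ofReal (ε / 2) := by
    rw [← ENNReal.ofReal_toReal (measure_ne_top P _)]
    refine ENNReal.ofReal_le_ofReal ?_
    exact le_of_mul_le_mul_left ((mul_meas_ge_le_integral_of_nonneg (ae_of_all _ hR0) hRi
      (ε / 3 * (ν * B))).trans hRe') (by positivity)
  have hdet' : |ν * tailIntegral W ν K - ν * E| ≤ ε / 8 * (ν * B) := by
    rw [← mul_sub, abs_mul, abs_of_pos hν0]
    have h1 : χ + η * B + outerError t K * B ≤ ε / 8 * B := by nlinarith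
    calc _ ≤ ν * (ε / 8 * B) := mul_le_mul_of_nonneg_left (hdet.trans h1) hν0.le
      _ = _ := by ring
  have hsub : deviationEvent W p ζ ν M K ε ≤ᵐ[P]
      ({ω | ε / 3 * (ν * B) ≤ |X ω - ν * E|} ∪ {ω | ε / 3 * (ν * B) ≤ R ω} : Set Ω) := by
    filter_upwards [ae_mem_indexEvent hG.poisson (measurableSet_box ν M) (box_subset ν M)
      (volume_box_lt_top ν M)] with ω hω hdev
    have hdev' : ε * (ν * B) ≤
      |boxSum W p ζ ν M (fun _ n => above K n) ω - ν * tailIntegral W ν K| := hdev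
    have h1 : |boxSum W p ζ ν M (fun _ n => above K n) ω - X ω| ≤ R ω :=
      abs_boxSum_sub_le ω (fun x hx n => abs_above_sub_discount_le ht1 hK1 hx n) hω
    by_contra hcon
    have h2 : |X ω - ν * E| < ε / 3 * (ν * B) := by
      by_contra h; exact hcon (Or.inl (not_lt.1 h))
    have h3 : R ω < ε / 3 * (ν * B) := by
      by_contra h; exact hcon (Or.inr (not_lt.1 h))
    have h4 : |boxSum W p ζ ν M (fun _ n => above K n) ω - ν * tailIntegral W ν K| <
        ε * (ν * B) := by
      have : 0 < ε * (ν * B) := by positivity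
      rw [abs_le] at h1 hdet'
      rw [abs_lt] at h2 ⊢
      constructor <;> linarith
    linarith
  refine (measure_mono_ae hsub).trans ((measure_union_le _ _).trans
    ((add_le_add hconc hmarkov).trans ?_))
  rw [← ENNReal.ofReal_add (by positivity) (by positivity)]
  exact ENNReal.ofReal_le_ofReal (by linarith)

/-- Concentration of the count of degrees above a level, uniformly in the level. -/
lemma eventually_deviationEvent_le (hG : IsKEGSource P p ζ) (hW : IsRegularKernel W)
    {ε : ℝ} (hε : 0 < ε) : ∀ᶠ ν in atTop, ∀ K : ℕ, ∀ M ≥ 0, 2 ^ K * (ν * tailMass W M) ≤ 1 →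
      P (deviationEvent W p ζ ν M K ε) ≤ ENNReal.ofReal ε := by
  obtain ⟨K₀, h₀⟩ := eventually_deviationEvent_le_large hG hW hε
  have h₁ : ∀ᶠ ν in atTop, ∀ K ∈ Finset.range K₀, ∀ M ≥ 0, ν * tailMass W M ≤ 1 →
      P (deviationEvent W p ζ ν M K ε) ≤ ENNReal.ofReal ε :=
    (eventually_all_finset _).2 fun K _ => eventually_deviationEvent_le_fixed hG hW K hε
  filter_upwards [h₀, h₁, eventually_ge_atTop 0] with ν h2 h3 hν K M hM hδ
  rcases le_or_gt K₀ K with h | h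
  · exact h2 K h M hM hδ
  · refine h3 K (Finset.mem_range.2 h) M hM ?_
    have h4 : 0 ≤ ν * tailMass W M := mul_nonneg hν (hW.tailMass_nonneg M)
    have h5 : (1 : ℝ) ≤ 2 ^ K := one_le_pow₀ (by norm_num)
    nlinarith

end

/-! ### Loops, coinciding labels and edges leaving the box -/

section

variable {P : Measure Ω} [IsProbabilityMeasure P] {p : ℕ → Ω → ℝ × ℝ} {ζ : Sym2 ℕ → Ω → ℝ}
  {W : ℝ → ℝ → ℝ} {Q : Set (ℝ × ℝ)}

/-- The indicator that the points `i` and `j` are joined. -/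
def edgeIndicator (W : ℝ → ℝ → ℝ) (x : ℕ → ℝ × ℝ) (z : Sym2 ℕ → ℝ) (i j : ℕ) : ℝ≥0∞ :=
  if z s(i, j) < W (x i).2 (x j).2 then 1 else 0

lemma measurable_edgeIndicator (hW : IsEdgeKernel W) (i j : ℕ) :
    Measurable fun y : (ℕ → ℝ × ℝ) × (Sym2 ℕ → ℝ) => edgeIndicator W y.1 y.2 i j :=
  Measurable.ite (measurableSet_lt (by fun_prop)
    (hW.measurable.of_uncurry_comp (by fun_prop) (by fun_prop))) measurable_const measurable_const

lemma IsKEGSource.measurable_edgeIndicator (hG : IsKEGSource P p ζ) (x : ℕ → ℝ × ℝ) (i j : ℕ) :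
    Measurable fun ω => edgeIndicator W x (fun e => ζ e ω) i j :=
  Measurable.ite (measurableSet_lt (hG.measurable _) measurable_const) measurable_const
    measurable_const

/-- `edgeFactor 0 w = 1 - w` is the probability of no edge; the claim follows by complement. -/
lemma lintegral_edgeIndicator (hG : IsKEGSource P p ζ) (hW : IsEdgeKernel W) (x : ℕ → ℝ × ℝ)
    (i j : ℕ) : ∫⁻ ω, edgeIndicator W x (fun e => ζ e ω) i j ∂P =
      ENNReal.ofReal (W (x i).2 (x j).2) := by
  have h := lintegral_edge hG.measurable hG.uniform s(i, j) 0 (hW.nonneg (x i).2 (x j).2)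
    (hW.le_one _ _)
  have hsum : ∫⁻ ω, (edgeIndicator W x (fun e => ζ e ω) i j +
      if ζ s(i, j) ω < W (x i).2 (x j).2 then 0 else 1) ∂P = 1 := by
    rw [← measure_univ (μ := P), ← lintegral_one]
    refine lintegral_congr fun ω => ?_
    unfold edgeIndicator
    split_ifs <;> simp
  rw [lintegral_add_left (hG.measurable_edgeIndicator x i j), h] at hsum
  simp only [edgeFactor, zero_mul, add_zero] at hsum
  have h2 : ENNReal.ofReal (W (x i).2 (x j).2) + ENNReal.ofReal (1 - W (x i).2 (x j).2) = 1 := by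
    rw [← ENNReal.ofReal_add (hW.nonneg _ _) (sub_nonneg.2 (hW.le_one _ _))]
    simp
  exact (ENNReal.add_left_inj ENNReal.ofReal_ne_top).1 (hsum.trans h2.symm)

/-- The mean number of loops in `Q`, with weights. -/
lemma lintegral_sum_loops (hG : IsKEGSource P p ζ) (hW : IsEdgeKernel W)
    (hQm : MeasurableSet Q) (hQ : Q ⊆ Ici (0 : ℝ) ×ˢ Ici (0 : ℝ)) (hQf : volume Q < ∞)
    {α : ℝ × ℝ → ℝ≥0∞} (hα : Measurable α) :
    ∫⁻ ω, ∑ i ∈ boxIndex p Q ω,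
      α (p i ω) * edgeIndicator W (fun i => p i ω) (fun e => ζ e ω) i i ∂P =
      ∫⁻ q in Q, α q * ENNReal.ofReal (W q.2 q.2) := by
  have hα' : Measurable fun q : ℝ × ℝ => α q * ENNReal.ofReal (W q.2 q.2) :=
    hα.mul (hW.measurable.of_uncurry_comp measurable_snd measurable_snd).ennreal_ofReal
  -- At `τ = 1` the degrees drop out and the first moment formula becomes Campbell's formula.
  have h1 := lintegral_sum_pow_boxDegree hG hW hQm hQ hQf hα' zero_le_one
  simp only [one_pow, ENNReal.ofReal_one, mul_one, sub_self, zero_mul, neg_zero,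
    Real.exp_zero] at h1
  rw [← h1]
  refine (lintegral_boxIndex hG.poisson hQm hQ hQf fun F ω => ∑ i ∈ F,
    α (p i ω) * edgeIndicator W (fun i => p i ω) (fun e => ζ e ω) i i).trans
    (Eq.trans ?_ (lintegral_boxIndex hG.poisson hQm hQ hQf fun F ω => ∑ i ∈ F,
      α (p i ω) * ENNReal.ofReal (W (p i ω).2 (p i ω).2)).symm)
  refine tsum_congr fun F => ?_
  have hΦ : ∀ i, Measurable fun y : (ℕ → ℝ × ℝ) × (Sym2 ℕ → ℝ) =>
      α (y.1 i) * edgeIndicator W y.1 y.2 i i := fun i =>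
    (hα.comp (by fun_prop)).mul (measurable_edgeIndicator hW i i)
  have hm1 : ∀ i, Measurable fun ω =>
      α (p i ω) * edgeIndicator W (fun i => p i ω) (fun e => ζ e ω) i i := fun i =>
    (hΦ i).comp hG.measurable_pair
  have hm2 : ∀ i, Measurable fun ω => α (p i ω) * ENNReal.ofReal (W (p i ω).2 (p i ω).2) :=
    fun i => hα'.comp (hG.poisson.measurable i)
  rw [lintegral_finsetSum _ fun i _ => hm1 i, lintegral_finsetSum _ fun i _ => hm2 i]
  refine Finset.sum_congr rfl fun i _ => ?_
  refine (lintegral_indep_points hG hQm F (hΦ i)).trans (lintegral_congr fun ω => ?_)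
  simp only
  rw [lintegral_const_mul _ (hG.measurable_edgeIndicator _ i i),
    lintegral_edgeIndicator hG hW]

/-- The mean number of edges in `Q` between distinct points, with weights. -/
lemma lintegral_sum_edges (hG : IsKEGSource P p ζ) (hW : IsEdgeKernel W)
    (hQm : MeasurableSet Q) (hQ : Q ⊆ Ici (0 : ℝ) ×ˢ Ici (0 : ℝ)) (hQf : volume Q < ∞)
    {α : ℝ × ℝ → ℝ≥0∞} (hα : Measurable α) :
    ∫⁻ ω, ∑ i ∈ boxIndex p Q ω, ∑ j ∈ (boxIndex p Q ω).erase i,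
      α (p i ω) * edgeIndicator W (fun i => p i ω) (fun e => ζ e ω) i j ∂P =
      ∫⁻ q in Q, ∫⁻ q' in Q, α q * ENNReal.ofReal (W q.2 q'.2) := by
  have hα' : Measurable (Function.uncurry fun q q' : ℝ × ℝ =>
      α q * ENNReal.ofReal (W q.2 q'.2)) :=
    (hα.comp measurable_fst).mul (hW.measurable.of_uncurry_comp (by fun_prop)
      (by fun_prop)).ennreal_ofReal
  have h1 := lintegral_sum_sum_pow_boxDegree hG hW hQm hQ hQf hα' zero_le_one zero_le_one
  simp only [one_pow, ENNReal.ofReal_one, mul_one, sub_self, zero_mul, neg_zero, sub_zero,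
    add_zero, Real.exp_zero] at h1
  rw [← h1]
  refine (lintegral_boxIndex hG.poisson hQm hQ hQf fun F ω => ∑ i ∈ F, ∑ j ∈ F.erase i,
    α (p i ω) * edgeIndicator W (fun i => p i ω) (fun e => ζ e ω) i j).trans
    (Eq.trans ?_ (lintegral_boxIndex hG.poisson hQm hQ hQf fun F ω => ∑ i ∈ F, ∑ j ∈ F.erase i,
      α (p i ω) * ENNReal.ofReal (W (p i ω).2 (p j ω).2)).symm)
  refine tsum_congr fun F => ?_
  have hΦ : ∀ i j, Measurable fun y : (ℕ → ℝ × ℝ) × (Sym2 ℕ → ℝ) =>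
      α (y.1 i) * edgeIndicator W y.1 y.2 i j := fun i j =>
    (hα.comp (by fun_prop)).mul (measurable_edgeIndicator hW i j)
  have hm1 : ∀ i j, Measurable fun ω =>
      α (p i ω) * edgeIndicator W (fun i => p i ω) (fun e => ζ e ω) i j := fun i j =>
    (hΦ i j).comp hG.measurable_pair
  have hm2 : ∀ i j, Measurable fun ω => α (p i ω) * ENNReal.ofReal (W (p i ω).2 (p j ω).2) :=
    fun i j => hα'.of_uncurry_comp (hG.poisson.measurable i) (hG.poisson.measurable j)
  rw [lintegral_finsetSum _ fun i _ => Finset.measurable_sum _ fun j _ => hm1 i j,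
    lintegral_finsetSum _ fun i _ => Finset.measurable_sum _ fun j _ => hm2 i j]
  refine Finset.sum_congr rfl fun i _ => ?_
  rw [lintegral_finsetSum _ fun j _ => hm1 i j, lintegral_finsetSum _ fun j _ => hm2 i j]
  refine Finset.sum_congr rfl fun j _ => ?_
  refine (lintegral_indep_points hG hQm F (hΦ i j)).trans (lintegral_congr fun ω => ?_)
  simp only
  rw [lintegral_const_mul _ (hG.measurable_edgeIndicator _ i j),
    lintegral_edgeIndicator hG hW]

/-- Almost surely the points in a bounded set have distinct labels. -/
lemma ae_injOn_label (hG : IsKEGSource P p ζ) (hW : IsEdgeKernel W) (hQm : MeasurableSet Q)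
    (hQ : Q ⊆ Ici (0 : ℝ) ×ˢ Ici (0 : ℝ)) (hQf : volume Q < ∞) :
    ∀ᵐ ω ∂P, ∀ i ∈ boxIndex p Q ω, ∀ j ∈ boxIndex p Q ω, (p i ω).1 = (p j ω).1 → i = j := by
  set α : ℝ × ℝ → ℝ × ℝ → ℝ≥0∞ := fun q q' => if q.1 = q'.1 then 1 else 0 with hαdef
  have hα : Measurable (Function.uncurry α) :=
    Measurable.ite (measurableSet_eq_fun (by fun_prop) (by fun_prop)) measurable_const
      measurable_const
  have h := lintegral_sum_sum_pow_boxDegree hG hW hQm hQ hQf hα zero_le_one zero_le_one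
  simp only [one_pow, ENNReal.ofReal_one, mul_one, sub_self, zero_mul, neg_zero, sub_zero,
    add_zero, Real.exp_zero] at h
  -- A second point with the same label would have to lie on a vertical line, which has area 0.
  have hz : ∀ q : ℝ × ℝ, ∫⁻ q' in Q, α q q' = 0 := by
    intro q
    have h1 : ∀ q', α q q' = ({q.1} ×ˢ univ : Set (ℝ × ℝ)).indicator 1 q' := fun q' => by
      simp only [hαdef, indicator_apply, mem_prod, mem_singleton_iff, mem_univ, and_true,
        Pi.one_apply, eq_comm]
    simp_rw [h1]
    rw [lintegral_indicator_one ((measurableSet_singleton _).prod MeasurableSet.univ)]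
    refine le_antisymm ((Measure.restrict_apply_le _ _).trans ?_) zero_le
    rw [Measure.volume_eq_prod, Measure.prod_prod]
    simp
  simp only [hz, lintegral_zero] at h
  have hmeas : Measurable fun ω => ∑ i ∈ boxIndex p Q ω, ∑ j ∈ (boxIndex p Q ω).erase i,
      α (p i ω) (p j ω) :=
    measurable_boxIndex hG.poisson.measurable hQm
      (Ψ := fun F ω => ∑ i ∈ F, ∑ j ∈ F.erase i, α (p i ω) (p j ω)) fun F =>
      Finset.measurable_sum _ fun i _ => Finset.measurable_sum _ fun j _ =>
        hα.of_uncurry_comp (hG.poisson.measurable i) (hG.poisson.measurable j)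
  filter_upwards [(lintegral_eq_zero_iff hmeas).1 h] with ω hω i hi j hj hij
  by_contra hne
  have h1 := (Finset.sum_eq_zero_iff.1 hω) i hi
  have h2 := (Finset.sum_eq_zero_iff.1 h1) j (Finset.mem_erase.2 ⟨fun h => hne h.symm, hj⟩)
  simp [hαdef, hij] at h2

/-- Some edge of the graph has an endpoint outside of the box `[0,ν] × [0,M]`. -/
def farEvent (W : ℝ → ℝ → ℝ) (p : ℕ → Ω → ℝ × ℝ) (ζ : Sym2 ℕ → Ω → ℝ) (ν M : ℝ) : Set Ω :=
  {ω | ∃ i j, (p i ω).1 ≤ ν ∧ (p j ω).1 ≤ ν ∧ ζ s(i, j) ω < W (p i ω).2 (p j ω).2 ∧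
    M < (p i ω).2}

/-- Markov's inequality for the mean number of loops and edges with first endpoint above `M`,
counted in boxes `[0,ν] × [0,N]` and passed to the limit in `N`. The bound does not involve `N`. -/
lemma measure_farEvent_le (hG : IsKEGSource P p ζ) (hW : IsRegularKernel W)
    (hD : IntegrableOn (fun x => W x x) (Ici 0)) {ν M : ℝ} (hν : 0 ≤ ν) (hM : 0 ≤ M) :
    P (farEvent W p ζ ν M) ≤
      ENNReal.ofReal (ν * (∫ x in Ioi M, W x x) + ν ^ 2 * tailMass W M) := by
  have hE := hW.toIsEdgeKernel
  have hMI : Ioi M ⊆ Ici (0 : ℝ) := fun x hx => hM.trans (le_of_lt hx)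
  set A : ℕ → Set Ω := fun N => {ω | ∃ i j, p i ω ∈ box ν N ∧ p j ω ∈ box ν N ∧
    ζ s(i, j) ω < W (p i ω).2 (p j ω).2 ∧ M < (p i ω).2} with hA
  have hAmono : Monotone A := fun N N' h ω ⟨i, j, hi, hj, hij⟩ => by
    have h' : (N : ℝ) ≤ N' := by exact_mod_cast h
    exact ⟨i, j, ⟨hi.1, hi.2.1, hi.2.2.trans h'⟩, ⟨hj.1, hj.2.1, hj.2.2.trans h'⟩, hij⟩
  have hUnion : farEvent W p ζ ν M = ⋃ N, A N := by
    ext ω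
    simp only [farEvent, mem_ofPred_eq, mem_iUnion, hA]
    constructor
    · rintro ⟨i, j, hi, hj, hij⟩
      obtain ⟨N, hN⟩ := exists_nat_ge (max (p i ω).2 (p j ω).2)
      have hqi := hG.poisson.mem_quadrant i ω
      have hqj := hG.poisson.mem_quadrant j ω
      exact ⟨N, i, j, ⟨⟨hqi.1, hi⟩, hqi.2, (le_max_left _ _).trans hN⟩,
        ⟨⟨hqj.1, hj⟩, hqj.2, (le_max_right _ _).trans hN⟩, hij⟩
    · rintro ⟨N, i, j, hi, hj, hij⟩
      exact ⟨i, j, hi.1.2, hj.1.2, hij⟩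
  rw [hUnion, hAmono.measure_iUnion]
  refine iSup_le fun N => ?_
  set α : ℝ × ℝ → ℝ≥0∞ := fun q => (Ioi M).indicator 1 q.2 with hαdef
  have hαm : Measurable α := (measurable_one.indicator measurableSet_Ioi).comp measurable_snd
  have hl := lintegral_sum_loops hG hE (measurableSet_box ν N) (box_subset ν N)
    (volume_box_lt_top ν N) hαm
  have he := lintegral_sum_edges hG hE (measurableSet_box ν N) (box_subset ν N)
    (volume_box_lt_top ν N) hαm
  set X : Ω → ℝ≥0∞ := fun ω => ∑ i ∈ boxIndex p (box ν N) ω,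
    α (p i ω) * edgeIndicator W (fun i => p i ω) (fun e => ζ e ω) i i with hX
  set Y : Ω → ℝ≥0∞ := fun ω => ∑ i ∈ boxIndex p (box ν N) ω,
    ∑ j ∈ (boxIndex p (box ν N) ω).erase i,
    α (p i ω) * edgeIndicator W (fun i => p i ω) (fun e => ζ e ω) i j with hY
  have hterm : ∀ i j, Measurable fun ω =>
      α (p i ω) * edgeIndicator W (fun i => p i ω) (fun e => ζ e ω) i j := fun i j =>
    (hαm.comp (hG.poisson.measurable i)).mul
      ((measurable_edgeIndicator hE i j).comp hG.measurable_pair)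
  have hXm : Measurable X := measurable_boxIndex hG.poisson.measurable (measurableSet_box ν N)
    (Ψ := fun F ω => ∑ i ∈ F, α (p i ω) *
      edgeIndicator W (fun i => p i ω) (fun e => ζ e ω) i i) fun F =>
    Finset.measurable_sum _ fun i _ => hterm i i
  have hYm : Measurable Y := measurable_boxIndex hG.poisson.measurable (measurableSet_box ν N)
    (Ψ := fun F ω => ∑ i ∈ F, ∑ j ∈ F.erase i, α (p i ω) *
      edgeIndicator W (fun i => p i ω) (fun e => ζ e ω) i j) fun F =>
    Finset.measurable_sum _ fun i _ => Finset.measurable_sum _ fun j _ => hterm i j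
  have hle : A N ≤ᵐ[P] {ω | 1 ≤ X ω + Y ω} := by
    filter_upwards [ae_mem_indexEvent hG.poisson (measurableSet_box ν N) (box_subset ν N)
      (volume_box_lt_top ν N)] with ω hω hAω
    obtain ⟨i, j, hi, hj, hij, hMi⟩ := hAω
    have hi' : i ∈ boxIndex p (box ν N) ω := (hω i).1 hi
    have hj' : j ∈ boxIndex p (box ν N) ω := (hω j).1 hj
    have h1 : α (p i ω) * edgeIndicator W (fun i => p i ω) (fun e => ζ e ω) i j = 1 := by
      simp only [hαdef, edgeIndicator]
      rw [indicator_of_mem (show (p i ω).2 ∈ Ioi M from hMi), if_pos hij]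
      simp
    change 1 ≤ X ω + Y ω
    by_cases h : j = i
    · subst h
      refine le_trans ?_ le_self_add
      rw [← h1]
      exact Finset.single_le_sum (f := fun i => α (p i ω) *
        edgeIndicator W (fun i => p i ω) (fun e => ζ e ω) i i) (fun _ _ => zero_le) hi'
    · refine le_trans ?_ le_add_self
      rw [← h1]
      refine le_trans ?_ (Finset.single_le_sum (f := fun i =>
        ∑ j ∈ (boxIndex p (box ν N) ω).erase i, α (p i ω) *
        edgeIndicator W (fun i => p i ω) (fun e => ζ e ω) i j) (fun _ _ => zero_le) hi')
      exact Finset.single_le_sum (f := fun j => α (p i ω) *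
        edgeIndicator W (fun i => p i ω) (fun e => ζ e ω) i j) (fun _ _ => zero_le)
        (Finset.mem_erase.2 ⟨h, hj'⟩)
  refine (measure_mono_ae hle).trans ?_
  have hmk := mul_meas_ge_le_lintegral (μ := P) (hXm.add hYm) 1
  rw [one_mul] at hmk
  refine hmk.trans ?_
  simp only [Pi.add_apply]
  rw [lintegral_add_left hXm, hl, he]
  have hind : ∀ (f : ℝ → ℝ≥0∞), ∫⁻ x in Icc 0 (N : ℝ), (Ioi M).indicator 1 x * f x ≤
      ∫⁻ x in Ioi M, f x := fun f => by
    have : ∀ x, (Ioi M).indicator 1 x * f x = (Ioi M).indicator f x := fun x => by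
      by_cases hx : x ∈ Ioi M <;> simp [hx]
    simp_rw [this]
    rw [lintegral_indicator measurableSet_Ioi, Measure.restrict_restrict measurableSet_Ioi]
    exact lintegral_mono_set inter_subset_left
  have hdm : Measurable fun x => ENNReal.ofReal (W x x) :=
    (hE.measurable.of_uncurry_comp measurable_id measurable_id).ennreal_ofReal
  have hi1 : Measurable ((Ioi M).indicator (1 : ℝ → ℝ≥0∞)) :=
    measurable_one.indicator measurableSet_Ioi
  have b1 : ∫⁻ q in box ν N, α q * ENNReal.ofReal (W q.2 q.2) ≤
      ENNReal.ofReal (ν * ∫ x in Ioi M, W x x) := by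
    refine (lintegral_box_snd (hi1.mul hdm)).le.trans ?_
    rw [ENNReal.ofReal_mul hν, ofReal_integral_eq_lintegral_ofReal (hD.mono_set hMI)
      (ae_of_all _ fun x => hE.nonneg _ _)]
    exact mul_le_mul' le_rfl (hind _)
  have b2 : ∫⁻ q in box ν N, ∫⁻ q' in box ν N, α q * ENNReal.ofReal (W q.2 q'.2) ≤
      ENNReal.ofReal (ν ^ 2 * tailMass W M) := by
    have hrow : ∀ x, Measurable fun y => ENNReal.ofReal (W x y) := fun x =>
      (hE.measurable.of_uncurry_comp measurable_const measurable_id).ennreal_ofReal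
    have c1 : ∀ q : ℝ × ℝ, ∫⁻ q' in box ν N, α q * ENNReal.ofReal (W q.2 q'.2) ≤
        (Ioi M).indicator 1 q.2 * (ENNReal.ofReal ν * ENNReal.ofReal (marginal W q.2)) := by
      intro q
      rw [lintegral_const_mul' _ _ (by
        simp only [hαdef]
        by_cases h : q.2 ∈ Ioi M <;> simp [h]),
        lintegral_box_snd (hrow q.2)]
      by_cases h : q.2 ∈ Ioi M
      · have hq0 : 0 ≤ q.2 := hMI h
        simp only [hαdef]
        gcongr
        rw [marginal, ofReal_integral_eq_lintegral_ofReal (hW.integrable_row q.2 hq0)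
          (ae_of_all _ fun x => hE.nonneg _ _)]
        exact lintegral_mono_set Icc_subset_Ici_self
      · simp [hαdef, h]
    have hmm := hW.measurable_marginal
    have c2 : Measurable fun x => (Ioi M).indicator 1 x *
        (ENNReal.ofReal ν * ENNReal.ofReal (marginal W x)) :=
      hi1.mul (measurable_const.mul hmm.ennreal_ofReal)
    refine (lintegral_mono c1).trans ((lintegral_box_snd c2).le.trans ?_)
    have c3 := hind fun x => ENNReal.ofReal ν * ENNReal.ofReal (marginal W x)
    rw [lintegral_const_mul _ hmm.ennreal_ofReal] at c3
    rw [sq, mul_assoc, ENNReal.ofReal_mul hν, ENNReal.ofReal_mul hν, tailMass,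
      ofReal_integral_eq_lintegral_ofReal (hW.integrableOn_marginal.mono_set hMI)
      (ae_of_all _ hW.marginal_nonneg)]
    gcongr
  have hdn : 0 ≤ ν * ∫ x in Ioi M, W x x :=
    mul_nonneg hν (integral_nonneg fun x => hE.nonneg _ _)
  rw [ENNReal.ofReal_add hdn (mul_nonneg (sq_nonneg ν) (hW.tailMass_nonneg M))]
  exact add_le_add b1 b2

/-- The number of loops in the box. -/
def loopCount (W : ℝ → ℝ → ℝ) (p : ℕ → Ω → ℝ × ℝ) (ζ : Sym2 ℕ → Ω → ℝ) (ν M : ℝ) (ω : Ω) : ℕ :=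
  ((boxIndex p (box ν M) ω).filter fun i => ζ s(i, i) ω < W (p i ω).2 (p i ω).2).card

lemma measure_loopCount_ge_le (hG : IsKEGSource P p ζ) (hW : IsEdgeKernel W)
    (hD : IntegrableOn (fun x => W x x) (Ici 0)) {ν : ℝ} (hν : 0 ≤ ν) (M : ℝ) {c : ℝ}
    (hc : 0 < c) : P {ω | c ≤ (loopCount W p ζ ν M ω : ℝ)} ≤
      ENNReal.ofReal (ν * (∫ x in Ici (0 : ℝ), W x x) / c) := by
  have hl := lintegral_sum_loops hG hW (measurableSet_box ν M) (box_subset ν M)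
    (volume_box_lt_top ν M) (α := fun _ => 1) measurable_const
  simp only [one_mul] at hl
  have hdm : Measurable fun x => ENNReal.ofReal (W x x) :=
    (hW.measurable.of_uncurry_comp measurable_id measurable_id).ennreal_ofReal
  have b1 : ∫⁻ q in box ν M, ENNReal.ofReal (W q.2 q.2) ≤
      ENNReal.ofReal (ν * ∫ x in Ici (0 : ℝ), W x x) := by
    refine (lintegral_box_snd hdm).le.trans ?_
    rw [ENNReal.ofReal_mul hν, ofReal_integral_eq_lintegral_ofReal hD
      (ae_of_all _ fun x => hW.nonneg _ _)]
    gcongr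
    exact Icc_subset_Ici_self
  set X : Ω → ℝ≥0∞ := fun ω => ∑ i ∈ boxIndex p (box ν M) ω,
    edgeIndicator W (fun i => p i ω) (fun e => ζ e ω) i i with hX
  have hXm : Measurable X := measurable_boxIndex hG.poisson.measurable (measurableSet_box ν M)
    (Ψ := fun F ω => ∑ i ∈ F, edgeIndicator W (fun i => p i ω) (fun e => ζ e ω) i i) fun F =>
    Finset.measurable_sum _ fun i _ => (measurable_edgeIndicator hW i i).comp hG.measurable_pair
  have hXe : ∀ ω, X ω = loopCount W p ζ ν M ω := fun ω => by
    simp only [hX, loopCount, edgeIndicator, Finset.sum_boole]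
  have hset : {ω | c ≤ (loopCount W p ζ ν M ω : ℝ)} = {ω | ENNReal.ofReal c ≤ X ω} := by
    ext ω
    simp only [mem_ofPred_eq, hXe]
    rw [← ENNReal.ofReal_natCast, ENNReal.ofReal_le_ofReal_iff (Nat.cast_nonneg _)]
  rw [hset, ENNReal.ofReal_div_of_pos hc]
  refine (meas_ge_le_lintegral_div hXm.aemeasurable (by simpa using hc)
    ENNReal.ofReal_ne_top).trans ?_
  gcongr
  exact hl.le.trans b1

end

/-! ### Reading the graph off the box -/

section

variable {P : Measure Ω} [IsProbabilityMeasure P] {p : ℕ → Ω → ℝ × ℝ} {ζ : Sym2 ℕ → Ω → ℝ}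
  {W : ℝ → ℝ → ℝ}

/-- The graph `G_ν` is determined by the points in the box `[0,ν] × [0,M]`. -/
structure IsBoxDetermined (W : ℝ → ℝ → ℝ) (p : ℕ → Ω → ℝ × ℝ) (ζ : Sym2 ℕ → Ω → ℝ) (ν M : ℝ)
    (ω : Ω) : Prop where
  mem_index : ω ∈ indexEvent p (box ν M) (boxIndex p (box ν M) ω)
  inj : ∀ i ∈ boxIndex p (box ν M) ω, ∀ j ∈ boxIndex p (box ν M) ω,
    (p i ω).1 = (p j ω).1 → i = j
  not_far : ω ∉ farEvent W p ζ ν M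

namespace IsBoxDetermined

variable {ν M : ℝ} {ω : Ω} (h : IsBoxDetermined W p ζ ν M ω) (hW : IsEdgeKernel W)
  (hq : ∀ i, p i ω ∈ Ici (0 : ℝ) ×ˢ Ici (0 : ℝ))
include h hW hq

/-- `farEvent` tests only the first endpoint, so by symmetry of the kernel its absence keeps both
endpoints of every edge in the box. -/
lemma mem_kegEdges {e : ℝ × ℝ} : e ∈ kegEdges W p ζ ν ω ↔
    ∃ i ∈ boxIndex p (box ν M) ω, ∃ j ∈ boxIndex p (box ν M) ω,
      e = ((p i ω).1, (p j ω).1) ∧ ζ s(i, j) ω < W (p i ω).2 (p j ω).2 := by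
  constructor
  · rintro ⟨⟨i, j, rfl, hij⟩, hi, hj⟩
    have h1 : (p i ω).2 ≤ M := not_lt.1 fun hlt => h.not_far ⟨i, j, hi.2, hj.2, hij, hlt⟩
    have h2 : (p j ω).2 ≤ M := not_lt.1 fun hlt => h.not_far ⟨j, i, hj.2, hi.2, by
      rw [Sym2.eq_swap, hW.symm]; exact hij, hlt⟩
    exact ⟨i, (h.mem_index i).1 ⟨hi, (hq i).2, h1⟩, j, (h.mem_index j).1 ⟨hj, (hq j).2, h2⟩,
      rfl, hij⟩
  · rintro ⟨i, hi, j, hj, rfl, hij⟩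
    exact ⟨⟨i, j, rfl, hij⟩, ((h.mem_index i).2 hi).1, ((h.mem_index j).2 hj).1⟩

lemma label_mem_kegEdges {i j : ℕ} (hi : i ∈ boxIndex p (box ν M) ω)
    (hj : j ∈ boxIndex p (box ν M) ω) :
    ((p i ω).1, (p j ω).1) ∈ kegEdges W p ζ ν ω ↔ ζ s(i, j) ω < W (p i ω).2 (p j ω).2 := by
  rw [h.mem_kegEdges hW hq]
  constructor
  · rintro ⟨i', hi', j', hj', he, hij⟩
    rw [Prod.mk.injEq] at he
    obtain rfl := h.inj i hi i' hi' he.1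
    obtain rfl := h.inj j hj j' hj' he.2
    exact hij
  · exact fun hij => ⟨i, hi, j, hj, rfl, hij⟩

open Classical in
lemma kegDegree_label {i : ℕ} (hi : i ∈ boxIndex p (box ν M) ω) :
    kegDegree W p ζ ν ω (p i ω).1 = boxDegree W p ζ (box ν M) ω i +
      if ζ s(i, i) ω < W (p i ω).2 (p i ω).2 then 2 else 0 := by
  have hset : {y | y ≠ (p i ω).1 ∧ ((p i ω).1, y) ∈ kegEdges W p ζ ν ω} =
      (fun j => (p j ω).1) '' (((boxIndex p (box ν M) ω).erase i).filter fun j =>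
        ζ s(i, j) ω < W (p i ω).2 (p j ω).2 : Finset ℕ) := by
    ext y
    simp only [mem_ofPred_eq, mem_image, Finset.mem_coe, Finset.mem_filter, Finset.mem_erase]
    constructor
    · rintro ⟨hy, he⟩
      obtain ⟨a, _, b, hb, hab, _⟩ := (h.mem_kegEdges hW hq).1 he
      rw [Prod.mk.injEq] at hab
      obtain ⟨_, rfl⟩ := hab
      refine ⟨b, ⟨⟨?_, hb⟩, (h.label_mem_kegEdges hW hq hi hb).1 he⟩, rfl⟩
      rintro rfl
      exact hy rfl
    · rintro ⟨j, ⟨⟨hji, hj⟩, hij⟩, rfl⟩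
      exact ⟨fun he => hji (h.inj j hj i hi he), (h.label_mem_kegEdges hW hq hi hj).2 hij⟩
  rw [kegDegree, hset, InjOn.ncard_image, ncard_coe_finset]
  · simp only [h.label_mem_kegEdges hW hq hi hi]
    rfl
  · intro a ha b hb hab
    rw [Finset.mem_coe, Finset.mem_filter, Finset.mem_erase] at ha hb
    exact h.inj a ha.1.2 b hb.1.2 hab

open Classical in
lemma kegVertices_eq : kegVertices W p ζ ν ω = (fun j => (p j ω).1) ''
    ((boxIndex p (box ν M) ω).filter fun i => 0 < boxDegree W p ζ (box ν M) ω i ∨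
      ζ s(i, i) ω < W (p i ω).2 (p i ω).2 : Finset ℕ) := by
  ext x
  simp only [kegVertices, mem_ofPred_eq, mem_image, Finset.mem_coe, Finset.mem_filter]
  constructor
  · rintro ⟨y, hy⟩
    obtain ⟨i, hi, j, hj, he, hij⟩ := (h.mem_kegEdges hW hq).1 hy
    rw [Prod.mk.injEq] at he
    refine ⟨i, ⟨hi, ?_⟩, he.1.symm⟩
    by_cases hji : j = i
    · subst hji; exact Or.inr hij
    · exact Or.inl (Finset.card_pos.2 ⟨j, Finset.mem_filter.2
        ⟨Finset.mem_erase.2 ⟨hji, hj⟩, hij⟩⟩)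
  · rintro ⟨i, ⟨hi, hd | hl⟩, rfl⟩
    · obtain ⟨j, hj⟩ := Finset.card_pos.1 hd
      rw [Finset.mem_filter, Finset.mem_erase] at hj
      exact ⟨_, (h.label_mem_kegEdges hW hq hi hj.1.2).2 hj.2⟩
    · exact ⟨_, (h.label_mem_kegEdges hW hq hi hi).2 hl⟩

end IsBoxDetermined

lemma toReal_uniformOn_coe {α : Type*} [MeasurableSpace α] [MeasurableSingletonClass α]
    [DecidableEq α] (s : Finset α) (q : α → Prop) [DecidablePred q] :
    (uniformOn (s : Set α) {x | q x}).toReal = (s.filter q).card / (s.card : ℝ) := by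
  have e : (s : Set α) ∩ {x | q x} = ((s.filter q : Finset α) : Set α) := by
    ext x; simp
  rw [uniformOn, cond_apply s.measurableSet, e, Measure.count_apply_finset,
    Measure.count_apply_finset, ENNReal.toReal_mul, ENNReal.toReal_inv]
  simp [div_eq_inv_mul]

lemma boxSum_above (ν M : ℝ) (K : ℕ) (ω : Ω) : boxSum W p ζ ν M (fun _ n => above K n) ω =
    ((boxIndex p (box ν M) ω).filter fun i => K < boxDegree W p ζ (box ν M) ω i).card := by
  simp [boxSum, above, Finset.sum_boole]

open Classical in
/-- Up to loops, the degree tail is the ratio of the counts of degrees in the box. -/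
lemma IsBoxDetermined.exists_kegDegreeTail_eq {ν M : ℝ} {ω : Ω}
    (h : IsBoxDetermined W p ζ ν M ω) (hW : IsEdgeKernel W)
    (hq : ∀ i, p i ω ∈ Ici (0 : ℝ) ×ˢ Ici (0 : ℝ)) {k : ℝ} (hk : 0 ≤ k) :
    ∃ a b : ℝ, kegDegreeTail W p ζ ν k ω = a / b ∧
      |a - boxSum W p ζ ν M (fun _ n => above ⌊k⌋₊ n) ω| ≤ loopCount W p ζ ν M ω ∧
      |b - boxSum W p ζ ν M (fun _ n => above 0 n) ω| ≤ loopCount W p ζ ν M ω := by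
  set F := boxIndex p (box ν M) ω with hF
  set D := boxDegree W p ζ (box ν M) ω with hD
  set L : ℕ → Prop := fun i => ζ s(i, i) ω < W (p i ω).2 (p i ω).2 with hL
  set V := F.filter fun i => 0 < D i ∨ L i with hV
  set A := V.filter fun i => k < (kegDegree W p ζ ν ω (p i ω).1 : ℝ) with hA
  have hinj : Set.InjOn (fun j => (p j ω).1) (V : Set ℕ) := fun a ha b hb hab =>
    h.inj a (Finset.mem_filter.1 ha).1 b (Finset.mem_filter.1 hb).1 hab
  have hinjA : Set.InjOn (fun j => (p j ω).1) (A : Set ℕ) := hinj.mono fun a ha =>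
    (Finset.mem_filter.1 ha).1
  have hvert : kegVertices W p ζ ν ω = ((V.image fun j => (p j ω).1 : Finset ℝ) : Set ℝ) := by
    rw [h.kegVertices_eq hW hq, Finset.coe_image]
  have hfilter : (V.image fun j => (p j ω).1).filter (fun x => k < (kegDegree W p ζ ν ω x : ℝ)) =
      A.image fun j => (p j ω).1 := by
    rw [Finset.filter_image]
  -- Both numerator and denominator differ from the count of non-loop degrees only at points
  -- carrying a loop.
  have hcmp : ∀ (B : Finset ℕ) (K : ℕ), (∀ i, i ∈ B → i ∈ F ∧ (K < D i ∨ L i)) →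
      (∀ i ∈ F, K < D i → i ∈ B) →
      |(B.card : ℝ) - boxSum W p ζ ν M (fun _ n => above K n) ω| ≤ loopCount W p ζ ν M ω := by
    intro B K h1 h2
    rw [boxSum_above, loopCount]
    have c1 : (F.filter fun i => K < D i).card ≤ B.card :=
      Finset.card_le_card fun i hi => h2 i (Finset.mem_filter.1 hi).1 (Finset.mem_filter.1 hi).2
    have c2 : B.card ≤ (F.filter fun i => K < D i).card + (F.filter L).card := by
      refine (Finset.card_le_card (t := F.filter (fun i => K < D i) ∪ F.filter L)
        fun i hi => ?_).trans (Finset.card_union_le _ _)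
      obtain ⟨hiF, h3 | h3⟩ := h1 i hi
      · exact Finset.mem_union_left _ (Finset.mem_filter.2 ⟨hiF, h3⟩)
      · exact Finset.mem_union_right _ (Finset.mem_filter.2 ⟨hiF, h3⟩)
    have c1' : ((F.filter fun i => K < D i).card : ℝ) ≤ B.card := by exact_mod_cast c1
    have c2' : (B.card : ℝ) ≤ (F.filter fun i => K < D i).card + (F.filter L).card := by
      exact_mod_cast c2
    rw [abs_of_nonneg (by linarith)]
    have : (F.filter L).card = (F.filter fun i =>
        ζ s(i, i) ω < W (p i ω).2 (p i ω).2).card := by congr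
    rw [← this]
    linarith
  have hdeg : ∀ i ∈ F, (k < (kegDegree W p ζ ν ω (p i ω).1 : ℝ) ↔
      ⌊k⌋₊ < D i + if L i then 2 else 0) := fun i hi => by
    rw [← Nat.floor_lt hk, h.kegDegree_label hW hq hi]
  refine ⟨A.card, V.card, ?_, hcmp A _ (fun i hi => ?_) fun i hiF hi => ?_,
    hcmp V _ (fun i hi => ?_) fun i hiF hi => ?_⟩
  · rw [kegDegreeTail, hvert, toReal_uniformOn_coe, hfilter, Finset.card_image_of_injOn hinjA,
      Finset.card_image_of_injOn hinj]
  · have hiF := (Finset.mem_filter.1 (Finset.mem_filter.1 hi).1).1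
    refine ⟨hiF, ?_⟩
    have h3 := (hdeg i hiF).1 (Finset.mem_filter.1 hi).2
    by_cases hLi : L i
    · exact Or.inr hLi
    · rw [if_neg hLi, add_zero] at h3
      exact Or.inl h3
  · exact Finset.mem_filter.2 ⟨Finset.mem_filter.2 ⟨hiF, Or.inl (by omega)⟩,
      (hdeg i hiF).2 (by omega)⟩
  · exact Finset.mem_filter.1 hi
  · exact Finset.mem_filter.2 ⟨hiF, Or.inl hi⟩

end

/-! ### Convergence for regular kernels -/

section

variable {P : Measure Ω} [IsProbabilityMeasure P] {p : ℕ → Ω → ℝ × ℝ} {ζ : Sym2 ℕ → Ω → ℝ}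
  {W : ℝ → ℝ → ℝ}

/-- Dominated convergence exchanges sum and integral, and for natural `n` the condition `k < n` is
`⌊k⌋₊ < n`. -/
lemma poissonTailRatio_eq (hW : IsRegularKernel W) {ν k : ℝ} (hν : 0 ≤ ν) (hk : 0 ≤ k) :
    poissonTailRatio W ν k = tailIntegral W ν ⌊k⌋₊ / degreeMass W ν := by
  rw [poissonTailRatio, degreeMass]
  congr 1
  have hlam : ∀ x, 0 ≤ ν * marginal W x := fun x => mul_nonneg hν (hW.marginal_nonneg x)
  have hs : ∀ x, HasSum (fun n => poissonWeight (ν * marginal W x) n * above ⌊k⌋₊ n)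
      (poissonTail ⌊k⌋₊ (ν * marginal W x)) := fun x => hasSum_poissonWeight_mul_above _ _
  have hmm := hW.measurable_marginal
  have h := hasSum_integral_of_dominated_convergence (μ := volume.restrict (Ici (0 : ℝ)))
    (F := fun n x => poissonWeight (ν * marginal W x) n * above ⌊k⌋₊ n)
    (f := fun x => poissonTail ⌊k⌋₊ (ν * marginal W x))
    (fun n x => poissonWeight (ν * marginal W x) n * above ⌊k⌋₊ n)
    (fun n => by unfold poissonWeight; fun_prop)
    (fun n => ae_of_all _ fun x => by
      rw [Real.norm_of_nonneg (mul_nonneg (poissonWeight_nonneg (hlam x) n) (above_nonneg _ n))])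
    (ae_of_all _ fun x => (hs x).summable)
    (by simp_rw [fun x => (hs x).tsum_eq]; exact hW.integrableOn_poissonTail hν _)
    (ae_of_all _ hs)
  rw [tailIntegral, ← h.tsum_eq]
  refine (tsum_subtype {n : ℕ | k < (n : ℝ)} fun n => ∫ x in Ici (0 : ℝ),
    Real.exp (-(ν * marginal W x)) * (ν * marginal W x) ^ n / n.factorial).trans ?_
  refine tsum_congr fun n => ?_
  rw [integral_mul_const]
  by_cases hn : k < n
  · rw [indicator_of_mem (show n ∈ {n : ℕ | k < (n : ℝ)} from hn), above,
      if_pos ((Nat.floor_lt hk).2 hn), mul_one]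
    rfl
  · rw [indicator_of_notMem (show n ∉ {n : ℕ | k < (n : ℝ)} from hn), above,
      if_neg fun h => hn ((Nat.floor_lt hk).1 h), mul_zero]

/-- Since `η ≤ 1/4`, the perturbed denominator is still at least `x / 2`. -/
lemma abs_div_sub_div_le {a b A x η : ℝ} (hx : 0 < x) (hA : 0 ≤ A) (hAx : A ≤ x) (hη : η ≤ 1 / 4)
    (ha : |a - A| ≤ 2 * η * x) (hb : |b - x| ≤ 2 * η * x) : |a / b - A / x| ≤ 8 * η := by
  have hη0 : 0 ≤ η := by
    have := (abs_nonneg _).trans hb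
    by_contra h
    nlinarith
  have hb' := abs_le.1 hb
  have hb0 : x / 2 ≤ b := by nlinarith
  have hbpos : 0 < b := by linarith
  rw [div_sub_div _ _ hbpos.ne' hx.ne', abs_div, abs_of_pos (mul_pos hbpos hx),
    div_le_iff₀ (mul_pos hbpos hx)]
  have e : a * x - b * A = (a - A) * x - A * (b - x) := by ring
  rw [e]
  have h1 : |(a - A) * x - A * (b - x)| ≤ |a - A| * x + A * |b - x| := by
    refine (abs_sub _ _).trans ?_
    rw [abs_mul, abs_mul, abs_of_pos hx, abs_of_nonneg hA]
  have h2 : |a - A| * x ≤ 2 * η * x * x := by gcongr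
  have h3 : A * |b - x| ≤ x * (2 * η * x) := by gcongr
  have h4 : 4 * η * x * x ≤ 8 * η * (b * x) := by
    have : 0 ≤ η * x := by positivity
    nlinarith
  linarith

/-- The degree tail of the graph of a regular kernel is asymptotically its Poisson prediction. -/
theorem IsRegularKernel.tendstoInMeasure_kegDegreeTail (hW : IsRegularKernel W)
    (hD : IntegrableOn (fun x => W x x) (Ici 0)) (hG : IsKEGSource P p ζ) {k : ℝ → ℝ}
    (hk : ∀ ν, 0 ≤ k ν) :
    TendstoInMeasure P
      (fun ν ω => kegDegreeTail W p ζ ν (k ν) ω - poissonTailRatio W ν (k ν)) atTop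
      (fun _ => 0) := by
  rw [tendstoInMeasure_iff_norm]
  intro ε hε
  rw [ENNReal.tendsto_nhds_zero]
  intro r hr
  have hE := hW.toIsEdgeKernel
  set ρ := (min r 1).toReal with hρ
  have hr1 : min r 1 ≠ ∞ := (lt_of_le_of_lt (min_le_right _ _) ENNReal.one_lt_top).ne
  have hρ0 : 0 < ρ := ENNReal.toReal_pos (lt_min hr one_pos).ne' hr1
  have hρr : ENNReal.ofReal ρ ≤ r := by
    rw [hρ, ENNReal.ofReal_toReal hr1]; exact min_le_left _ _
  -- The quotient moves by at most `8η ≤ ε/2`, and four exceptional events of probability at most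
  -- `η` add up to `ρ`.
  set η := min (1 / 4) (min (ε / 16) (ρ / 4)) with hη
  have hη0 : 0 < η := by positivity
  have hη1 : η ≤ 1 / 4 := min_le_left _ _
  have hη2 : η ≤ ε / 16 := (min_le_right _ _).trans (min_le_left _ _)
  have hη3 : η ≤ ρ / 4 := (min_le_right _ _).trans (min_le_right _ _)
  set I := ∫ x in Ici (0 : ℝ), W x x
  have hI0 : 0 ≤ I := integral_nonneg fun x => hE.nonneg _ _
  -- The last threshold handles loops: Markov bounds the probability of `η νB` of them by `I / (η B)
  -- ≤ η`.
  filter_upwards [eventually_deviationEvent_le hG hW hη0, eventually_gt_atTop 0,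
    hW.tendsto_degreeMass.eventually_gt_atTop 0,
    hW.tendsto_degreeMass.eventually_ge_atTop (I / (η * η))] with ν hdev hν0 hB0 hBI
  set K := ⌊k ν⌋₊ with hK
  have hνB : 0 < ν * degreeMass W ν := by positivity
  have h1 : Tendsto (fun M => 2 ^ K * (ν * tailMass W M)) atTop (𝓝 0) := by
    simpa using (hW.tendsto_tailMass.const_mul ν).const_mul (2 ^ K)
  have h2 : Tendsto (fun M => ν * (∫ x in Ioi M, W x x) + ν ^ 2 * tailMass W M) atTop (𝓝 0) := by
    have hd : Tendsto (fun M : ℝ => ∫ x in Ioi M, W x x) atTop (𝓝 0) :=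
      tendsto_integral_Ioi_zero tendsto_id
    simpa using (hd.const_mul ν).add (hW.tendsto_tailMass.const_mul (ν ^ 2))
  -- Only now is `M` fixed, depending on ν and on the level `K`; the concentration bounds hold for
  -- all admissible `M` at once.
  obtain ⟨M, hM0, hM1, hM2⟩ := ((eventually_ge_atTop (0 : ℝ)).and
    ((h1.eventually_le_const one_pos).and (h2.eventually_le_const hη0))).exists
  have hM3 : 2 ^ 0 * (ν * tailMass W M) ≤ 1 := by
    have h3 : (1 : ℝ) ≤ 2 ^ K := one_le_pow₀ (by norm_num)
    have h4 : 0 ≤ ν * tailMass W M := mul_nonneg hν0.le (hW.tailMass_nonneg M)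
    nlinarith
  have p1 := hdev K M hM0 hM1
  have p2 := hdev 0 M hM0 hM3
  have p3 : P (farEvent W p ζ ν M) ≤ ENNReal.ofReal η :=
    (measure_farEvent_le hG hW hD hν0.le hM0).trans (ENNReal.ofReal_le_ofReal hM2)
  have p4 : P {ω | η * (ν * degreeMass W ν) ≤ (loopCount W p ζ ν M ω : ℝ)} ≤ ENNReal.ofReal η := by
    refine (measure_loopCount_ge_le hG hE hD hν0.le M (by positivity)).trans
      (ENNReal.ofReal_le_ofReal ?_)
    rw [div_le_iff₀ (by positivity)] at hBI ⊢
    nlinarith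
  have hsub : {ω | ε ≤ ‖kegDegreeTail W p ζ ν (k ν) ω - poissonTailRatio W ν (k ν) - 0‖} ≤ᵐ[P]
      (deviationEvent W p ζ ν M K η ∪ deviationEvent W p ζ ν M 0 η ∪ farEvent W p ζ ν M ∪
        {ω | η * (ν * degreeMass W ν) ≤ (loopCount W p ζ ν M ω : ℝ)} : Set Ω) := by
    filter_upwards [ae_mem_indexEvent hG.poisson (measurableSet_box ν M) (box_subset ν M)
      (volume_box_lt_top ν M), ae_injOn_label hG hE (measurableSet_box ν M) (box_subset ν M)
      (volume_box_lt_top ν M)] with ω hω hinj hbad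
    by_contra hcon
    have hcon' : ω ∉ deviationEvent W p ζ ν M K η ∪ deviationEvent W p ζ ν M 0 η ∪
      farEvent W p ζ ν M ∪ {ω | η * (ν * degreeMass W ν) ≤ (loopCount W p ζ ν M ω : ℝ)} := hcon
    simp only [mem_union, not_or, deviationEvent, mem_ofPred_eq, not_le] at hcon'
    obtain ⟨⟨⟨c1, c2⟩, c3⟩, c4⟩ := hcon'
    obtain ⟨a, b, hab, ha, hb⟩ := IsBoxDetermined.exists_kegDegreeTail_eq (M := M)
      ⟨hω, hinj, c3⟩ hE (fun i => hG.poisson.mem_quadrant i ω) (hk ν)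
    have hbad' : ε ≤ ‖kegDegreeTail W p ζ ν (k ν) ω - poissonTailRatio W ν (k ν) - 0‖ := hbad
    rw [sub_zero, Real.norm_eq_abs, hab, poissonTailRatio_eq hW hν0.le (hk ν),
      ← mul_div_mul_left (tailIntegral W ν ⌊k ν⌋₊) (degreeMass W ν) hν0.ne'] at hbad'
    rw [tailIntegral_zero] at c2
    have e1 : |a - ν * tailIntegral W ν K| ≤ 2 * η * (ν * degreeMass W ν) :=
      (abs_sub_le _ _ _).trans ((add_le_add ha c1.le).trans (by linarith))
    have e2 : |b - ν * degreeMass W ν| ≤ 2 * η * (ν * degreeMass W ν) :=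
      (abs_sub_le _ _ _).trans ((add_le_add hb c2.le).trans (by linarith))
    have h5 := abs_div_sub_div_le hνB (mul_nonneg hν0.le (hW.tailIntegral_nonneg hν0.le K))
      (mul_le_mul_of_nonneg_left (hW.tailIntegral_le hν0.le K) hν0.le) hη1 e1 e2
    have h6 : ε ≤ 8 * η := hbad'.trans h5
    linarith
  refine (measure_mono_ae hsub).trans (le_trans ?_ hρr)
  refine (measure_union_le _ _).trans ((add_le_add ((measure_union_le _ _).trans
    (add_le_add ((measure_union_le _ _).trans (add_le_add p1 p2)) p3)) p4).trans ?_)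
  rw [← ENNReal.ofReal_add hη0.le hη0.le, ← ENNReal.ofReal_add (by positivity) hη0.le,
    ← ENNReal.ofReal_add (by positivity) hη0.le]
  exact ENNReal.ofReal_le_ofReal (by linarith)

lemma tendstoInMeasure_of_sub_of_tendsto {f : ℝ → Ω → ℝ} {R : ℝ → ℝ} {L : ℝ}
    (h : TendstoInMeasure P (fun ν ω => f ν ω - R ν) atTop fun _ => 0)
    (hR : Tendsto R atTop (𝓝 L)) : TendstoInMeasure P f atTop fun _ => L := by
  rw [tendstoInMeasure_iff_norm] at h ⊢
  intro ε hε
  refine tendsto_of_tendsto_of_tendsto_of_le_of_le' tendsto_const_nhds (h (ε / 2) (by positivity))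
    (Eventually.of_forall fun _ => zero_le) ?_
  filter_upwards [(Metric.tendsto_nhds.1 hR) (ε / 2) (by positivity)] with ν hν
  refine measure_mono fun ω hω => ?_
  simp only [mem_ofPred_eq, sub_zero, Real.norm_eq_abs] at hω ⊢
  rw [Real.dist_eq] at hν
  have := abs_sub_le (f ν ω) (R ν) L
  linarith

end

/-! ### From graphexes to regular kernels -/

section

variable {P : Measure Ω} [IsProbabilityMeasure P] {p : ℕ → Ω → ℝ × ℝ} {ζ : Sym2 ℕ → Ω → ℝ}
  {W : ℝ → ℝ → ℝ}

open Classical in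
/-- The restriction of `W` to the quadrant, extended by zero. -/
def quadrantKernel (W : ℝ → ℝ → ℝ) (x y : ℝ) : ℝ := if 0 ≤ x ∧ 0 ≤ y then W x y else 0

lemma quadrantKernel_of_nonneg (W : ℝ → ℝ → ℝ) {x y : ℝ} (hx : 0 ≤ x) (hy : 0 ≤ y) :
    quadrantKernel W x y = W x y := if_pos ⟨hx, hy⟩

lemma marginal_quadrantKernel (W : ℝ → ℝ → ℝ) {x : ℝ} (hx : 0 ≤ x) :
    marginal (quadrantKernel W) x = marginal W x :=
  setIntegral_congr_fun measurableSet_Ici fun _ hy => quadrantKernel_of_nonneg W hx hy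

lemma IsGraphex.isEdgeKernel (hW : IsGraphex W) : IsEdgeKernel (quadrantKernel W) where
  measurable := by
    have : MeasurableSet {z : ℝ × ℝ | 0 ≤ z.1 ∧ 0 ≤ z.2} :=
      (measurableSet_le measurable_const measurable_fst).inter
        (measurableSet_le measurable_const measurable_snd)
    exact Measurable.ite this hW.measurable measurable_const
  nonneg x y := by
    unfold quadrantKernel
    split_ifs with h
    · exact (hW.mem_Icc x h.1 y h.2).1
    · exact le_rfl
  le_one x y := by
    unfold quadrantKernel
    split_ifs with h
    · exact (hW.mem_Icc x h.1 y h.2).2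
    · exact zero_le_one
  symm x y := by
    unfold quadrantKernel
    by_cases h : 0 ≤ x ∧ 0 ≤ y
    · rw [if_pos h, if_pos h.symm, hW.symm x h.1 y h.2]
    · rw [if_neg h, if_neg fun h' => h h'.symm]

lemma poissonTailRatio_quadrantKernel (W : ℝ → ℝ → ℝ) (ν k : ℝ) :
    poissonTailRatio (quadrantKernel W) ν k = poissonTailRatio W ν k := by
  unfold poissonTailRatio
  congr 1
  · refine tsum_congr fun n => setIntegral_congr_fun measurableSet_Ici fun x hx => ?_
    simp only [marginal_quadrantKernel W hx]
  · refine setIntegral_congr_fun measurableSet_Ici fun x hx => ?_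
    simp only [marginal_quadrantKernel W hx]

lemma kegDegreeTail_quadrantKernel (W : ℝ → ℝ → ℝ) {ω : Ω}
    (hq : ∀ i, p i ω ∈ Ici (0 : ℝ) ×ˢ Ici (0 : ℝ)) (ν k : ℝ) :
    kegDegreeTail (quadrantKernel W) p ζ ν k ω = kegDegreeTail W p ζ ν k ω := by
  have h : kegEdges (quadrantKernel W) p ζ ν ω = kegEdges W p ζ ν ω := by
    unfold kegEdges
    simp only [fun i j => quadrantKernel_of_nonneg W (hq i).2 (hq j).2]
  unfold kegDegreeTail kegVertices kegDegree
  rw [h]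

lemma IsGraphex.marginal_nonneg (hW : IsGraphex W) {x : ℝ} (hx : 0 ≤ x) : 0 ≤ marginal W x :=
  setIntegral_nonneg measurableSet_Ici fun y hy => (hW.mem_Icc x hx y hy).1

/-- A decreasing nonnegative marginal that vanishes at `x` vanishes from there on, and would have
zero derivative beyond `χ`. -/
lemma IsGraphex.marginal_pos (hW : IsGraphex W) (hanti : AntitoneOn (marginal W) (Ici 0))
    {χ : ℝ} (hreg : ∀ x > χ, deriv (marginal W) x ≠ 0) {x : ℝ} (hx : 0 ≤ x) :
    0 < marginal W x := by
  by_contra hcon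
  have hzero : ∀ y ≥ x, marginal W y = 0 := fun y hy =>
    le_antisymm ((hanti hx (show y ∈ Ici 0 from hx.trans hy) hy).trans (not_lt.1 hcon))
      (hW.marginal_nonneg (hx.trans hy))
  have hy : χ < max x χ + 1 := (le_max_right x χ).trans_lt (lt_add_one _)
  refine hreg _ hy ?_
  have : marginal W =ᶠ[𝓝 (max x χ + 1)] fun _ => 0 := by
    filter_upwards [Ioi_mem_nhds ((le_max_left x χ).trans_lt (lt_add_one _))] with z hz
    exact hzero z (le_of_lt hz)
  rw [this.deriv_eq, deriv_const]

/-- The only analytic point is `regular`: as `μ' < 0` beyond `χ`, the bound on `μ / (x μ')` says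
that `(x μ)' = μ + x μ' ≤ 0`. -/
lemma IsGraphex.isRegularKernel (hW : IsGraphex W) (hWint : IntegrableGraphex W)
    (hdep : ∃ C > 0, ∃ T > 0, ∀ l ≥ 0, ∀ w > T,
      ∫ x in Ici (0 : ℝ), W l x * W w x ≤ C * marginal W l * marginal W w)
    (hanti : AntitoneOn (marginal W) (Ici 0))
    (hdiff : DifferentiableOn ℝ (marginal W) (Ioi 0))
    (hreg : ∃ χ > 0, ∀ x > χ, deriv (marginal W) x ≠ 0 ∧
      -1 ≤ marginal W x / (x * deriv (marginal W) x)) : IsRegularKernel (quadrantKernel W) where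
  toIsEdgeKernel := hW.isEdgeKernel
  integrableOn := hWint.congr_fun (fun z hz => (quadrantKernel_of_nonneg W hz.1 hz.2).symm)
    (measurableSet_Ici.prod measurableSet_Ici)
  integrable_row x hx := by
    obtain ⟨χ, _, h⟩ := hreg
    have hpos := hW.marginal_pos hanti (fun y hy => (h y hy).1) hx
    rw [← marginal_quadrantKernel W hx] at hpos
    -- The integral of a non-integrable row would be 0 by convention, against positivity of the
    -- marginal.
    by_contra hn
    exact hpos.ne' (integral_undef hn)
  marginal_pos x hx := by
    obtain ⟨χ, _, h⟩ := hreg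
    rw [marginal_quadrantKernel W hx]
    exact hW.marginal_pos hanti (fun y hy => (h y hy).1) hx
  antitone x hx y hy hxy := by
    rw [marginal_quadrantKernel W hx, marginal_quadrantKernel W hy]
    exact hanti hx hy hxy
  regular := by
    obtain ⟨χ, hχ, h⟩ := hreg
    refine ⟨χ, hχ, ?_⟩
    have hd : ∀ x > χ, HasDerivAt (fun x => x * marginal W x)
        (1 * marginal W x + x * deriv (marginal W) x) x := fun x hx =>
      (hasDerivAt_id x).mul
        ((hdiff x (hχ.trans hx)).differentiableAt (Ioi_mem_nhds (hχ.trans hx))).hasDerivAt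
    have hmain : AntitoneOn (fun x => x * marginal W x) (Ioi χ) := by
      refine antitoneOn_of_deriv_nonpos (convex_Ioi χ)
        (fun x hx => (hd x hx).continuousAt.continuousWithinAt)
        (fun x hx => ?_) fun x hx => ?_
      · rw [interior_Ioi] at hx
        exact (hd x hx).differentiableAt.differentiableWithinAt
      · rw [interior_Ioi] at hx
        have hx0 : 0 < x := hχ.trans hx
        rw [(hd x hx).deriv]
        obtain ⟨hne, hle⟩ := h x hx
        have hnonpos : deriv (marginal W) x ≤ 0 := by
          rw [← derivWithin_of_isOpen isOpen_Ioi hx0]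
          exact (hanti.mono Ioi_subset_Ici_self).derivWithin_nonpos
        have hneg : x * deriv (marginal W) x < 0 :=
          mul_neg_of_pos_of_neg hx0 (lt_of_le_of_ne hnonpos hne)
        -- Clearing the negative denominator reverses the inequality, giving `μ ≤ -x μ'`.
        rw [le_div_iff_of_neg hneg] at hle
        linarith
    intro x hx y hy hxy
    have := hmain hx hy hxy
    simp only
    rw [marginal_quadrantKernel W (hχ.trans hx).le, marginal_quadrantKernel W (hχ.trans hy).le]
    exact this
  overlap := by
    obtain ⟨C, hC, T, hT, h⟩ := hdep
    refine ⟨C, hC, T, hT, fun l hl w hw => ?_⟩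
    have hw0 : 0 ≤ w := (hT.trans hw).le
    rw [marginal_quadrantKernel W hl, marginal_quadrantKernel W hw0]
    refine le_of_eq_of_le (setIntegral_congr_fun measurableSet_Ici fun y hy => ?_) (h l hl w hw)
    rw [quadrantKernel_of_nonneg W hl hy, quadrantKernel_of_nonneg W hw0 hy]

lemma IsGraphex.integrableOn_diagonal (hW : IsGraphex W) :
    IntegrableOn (fun x => quadrantKernel W x x) (Ici 0) := by
  have hE := hW.isEdgeKernel
  refine (lintegral_ofReal_ne_top_iff_integrable
    (hE.measurable.of_uncurry_comp measurable_id measurable_id).aestronglyMeasurable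
    (ae_of_all _ fun x => hE.nonneg x x)).1 ?_
  refine ne_of_lt (lt_of_le_of_lt (le_of_eq ?_) hW.diagonal)
  refine setLIntegral_congr_fun measurableSet_Ici fun x hx => ?_
  simp only [id, quadrantKernel_of_nonneg W hx hx]

end

end

theorem mainTheorem7 {Ω : Type*} [MeasurableSpace Ω] (P : Measure Ω) [IsProbabilityMeasure P]
    (p : ℕ → Ω → ℝ × ℝ) (ζ : Sym2 ℕ → Ω → ℝ) (hG : IsKEGSource P p ζ)
    (W : ℝ → ℝ → ℝ) (hW : IsGraphex W) (hWint : IntegrableGraphex W)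
    (hdep : ∃ C > 0, ∃ T > 0, ∀ l ≥ 0, ∀ w > T,
      ∫ x in Ici (0 : ℝ), W l x * W w x ≤ C * marginal W l * marginal W w)
    (hanti : AntitoneOn (marginal W) (Ici 0))
    (hdiff : DifferentiableOn ℝ (marginal W) (Ioi 0))
    (hreg : ∃ χ > 0, ∀ x > χ, deriv (marginal W) x ≠ 0 ∧
      -1 ≤ marginal W x / (x * deriv (marginal W) x))
    (k : ℝ → ℝ) (hk_nonneg : ∀ ν, 0 ≤ k ν) (hk : k =o[atTop] fun ν : ℝ => ν) :
    TendstoInMeasure P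
        (fun ν ω => kegDegreeTail W p ζ ν (k ν) ω - poissonTailRatio W ν (k ν)) atTop
        (fun _ => 0) ∧
      ∀ L : ℝ, Tendsto (fun ν => poissonTailRatio W ν (k ν)) atTop (𝓝 L) →
        TendstoInMeasure P (fun ν ω => kegDegreeTail W p ζ ν (k ν) ω) atTop (fun _ => L) := by
  have h := (hW.isRegularKernel hWint hdep hanti hdiff hreg).tendstoInMeasure_kegDegreeTail
    hW.integrableOn_diagonal hG hk_nonneg
  simp only [poissonTailRatio_quadrantKernel,
    fun ν ω => kegDegreeTail_quadrantKernel (ζ := ζ) W (fun i => hG.poisson.mem_quadrant i ω) ν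
      (k ν)] at h
  exact ⟨h, fun L hL => tendstoInMeasure_of_sub_of_tendsto h hL⟩
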